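/- **Lemma (Poincaré stabilization).** Let $R=\mathbb Z$ or $R=\mathbb Q$. For a continuous map $f:X\to Y$ write $H_*(Y,X;-)$ and $H^*(Y,X;-)$ for the singular (co)homology, with local coefficients pulled back from $Y$, of the pair $(M_f,X)$, where $M_f$ is the mapping cylinder of $f$. Call $f:X\to Y$ an *$m$-dimensional Poincaré pair over $R$* if $X$ and $Y$ are connected finite complexes (spaces of the homotopy type of a finite CW complex), $f$ induces an isomorphism $\pi_1(X)\to\pi_1(Y)=:\pi$, $H_m(Y,X;R)\cong R$, and a generator $[Y,X]\in H_m(Y,X;R)$ induces, for all integers $k$, cap product isomorphisms $$H^k(Y;R\pi)\xrightarrow{\ \cap[Y,X]\ }H_{m-k}(Y,X;R\pi),\qquad H^k(Y,X;R\pi)\xrightarrow{\ \cap[Y,X]\ }H_{m-k}(Y;R\pi)$$ (groups in negative degrees are zero). For $R=\mathbb Z$ this is an $m$-dimensional Poincaré pair, for $R=\mathbb Q$ an $m$-dimensional rational Poincaré pair. Let $\Gamma$ be a group with a classifying space $B\Gamma=K(\Gamma,1)$ that is a finite complex, let $X$ be a connected finite complex with fundamental group $\Gamma$, and let $f:X\to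 B\Gamma$ be a classifying map, that is, a map inducing an isomorphism on fundamental groups. Let $SX=B\Gamma\cup_X B\Gamma$ be the suspension of $X$ over $B\Gamma$, i.e. the union of two copies of the mapping cylinder of $f$ along $X$, with its canonical map $SX\to B\Gamma$. Let $n\ge 0$. If $SX\to B\Gamma$ is an $(n+1)$-dimensional Poincaré pair, then $X\to B\Gamma$ is an $n$-dimensional Poincaré pair. If $SX\to B\Gamma$ is an $(n+1)$-dimensional rational Poincaré pair, then $X\to B\Gamma$ is an $n$-dimensional rational Poincaré pair. -/

import Mathlib

open CategoryTheory

noncomputable section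

namespace PoincareStab

/-! ### Singular simplices and local coefficient systems -/

section LocalCoefficients

/-- The standard topological `n`-simplex. -/
abbrev Simplex (n : ℕ) : Type := stdSimplex ℝ (Fin (n + 1))

/-- The initial vertex of the standard simplex. -/
abbrev v₀ (n : ℕ) : Simplex n := stdSimplex.vertex 0

/-- The affine map of standard simplices induced by a map of vertices. -/
def simplexMap {m n : ℕ} (f : Fin (m + 1) → Fin (n + 1)) : C(Simplex m, Simplex n) :=
  ⟨stdSimplex.map f, stdSimplex.continuous_map f⟩

/-- Inclusion of the face opposite to the vertex `i`. -/
abbrev face {n : ℕ} (i : Fin (n + 2)) : C(Simplex n, Simplex (n + 1)) :=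
  simplexMap i.succAbove

/-- The front `p`-face, spanned by the vertices `0, …, p`. -/
def front {p q n : ℕ} (h : p + q = n) : C(Simplex p, Simplex n) :=
  simplexMap fun i => ⟨i, by omega⟩

/-- The back `q`-face, spanned by the vertices `p, …, p + q`. -/
def back {p q n : ℕ} (h : p + q = n) : C(Simplex q, Simplex n) :=
  simplexMap fun i => ⟨p + i, by omega⟩

theorem simplexMap_comp {l m n : ℕ} (g : Fin (m + 1) → Fin (n + 1))
    (f : Fin (l + 1) → Fin (m + 1)) :
    (simplexMap g).comp (simplexMap f) = simplexMap (g ∘ f) := by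
  ext1 x
  exact stdSimplex.map_comp_apply f g x

instance (n : ℕ) : ContractibleSpace (Simplex n) :=
  (convex_stdSimplex ℝ (Fin (n + 1))).contractibleSpace ⟨_, (v₀ n).2⟩

/-- A local coefficient system of `R`-modules on `Z`: a functor from the fundamental groupoid. -/
abbrev LocalSystem.{w, r, u} (R : Type r) [CommRing R] (Z : Type u) [TopologicalSpace Z] :=
  FundamentalGroupoid Z ⥤ ModuleCat.{w} R

/-- The constant local system `R`. -/
abbrev constSystem (R : Type*) [CommRing R] (Z : Type*) [TopologicalSpace Z] : LocalSystem R Z :=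
  (Functor.const _).obj (ModuleCat.of R R)

/-- The local system with fibre `R[π₁(Z)]`: its fibre at `z` is the free `R`-module on the
homotopy classes of paths from the base point `z₀` to `z`, that is, on the fibre over `z` of the
universal cover; transport is by concatenation of paths. -/
def groupRingSystem.{r, u} (R : Type r) [CommRing R] {Z : Type u} [TopologicalSpace Z] (z₀ : Z) :
    LocalSystem.{max u r} R Z where
  obj z := ModuleCat.of R ((FundamentalGroupoid.mk z₀ ⟶ z) →₀ R)
  map g := ModuleCat.ofHom (Finsupp.lmapDomain R R (· ≫ g))
  map_id z := by
    ext1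
    refine Finsupp.lhom_ext fun γ r => ?_
    simp
  map_comp g h := by
    ext1
    refine Finsupp.lhom_ext fun γ r => ?_
    simp [Finsupp.mapDomain_single]

variable {R : Type*} [CommRing R] {Z : Type*} [TopologicalSpace Z]

/-- The pull-back of a local system along a continuous map. -/
abbrev LocalSystem.pullback {W : Type*} [TopologicalSpace W] (A : LocalSystem R Z) (f : C(W, Z)) :
    LocalSystem R W :=
  FundamentalGroupoid.map f ⋙ A

variable (A : LocalSystem R Z)

/-- The homotopy class of the image in `Z` of any path from `s` to `t` in the (simply connected)
domain of the singular simplex `σ`. -/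
def edge {n : ℕ} (σ : C(Simplex n, Z)) (s t : Simplex n) :
    FundamentalGroupoid.mk (σ s) ⟶ FundamentalGroupoid.mk (σ t) :=
  (Path.Homotopic.Quotient.mk (PathConnectedSpace.somePath s t)).map σ

theorem edge_trans {n : ℕ} (σ : C(Simplex n, Z)) (s t u : Simplex n) :
    edge σ s t ≫ edge σ t u = edge σ s u := by
  have h : (Path.Homotopic.Quotient.mk (PathConnectedSpace.somePath s t)).trans
      (.mk (PathConnectedSpace.somePath t u)) = .mk (PathConnectedSpace.somePath s u) :=
    Subsingleton.elim _ _
  exact ((FundamentalGroupoid.map σ).map_comp (X := ⟨s⟩) (Y := ⟨t⟩) (Z := ⟨u⟩)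
    (.mk (PathConnectedSpace.somePath s t)) (.mk (PathConnectedSpace.somePath t u))).symm.trans
      (congrArg (fun k : Path.Homotopic.Quotient s u => k.map σ) h)

theorem edge_comp {m n : ℕ} (σ : C(Simplex n, Z)) (F : C(Simplex m, Simplex n)) (s t : Simplex m) :
    edge (σ.comp F) s t = edge σ (F s) (F t) := by
  have h : (Path.Homotopic.Quotient.mk (PathConnectedSpace.somePath s t)).map F =
      .mk (PathConnectedSpace.somePath (F s) (F t)) := Subsingleton.elim _ _
  exact congrArg (fun k : Path.Homotopic.Quotient (F s) (F t) => k.map σ) h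

/-- Transport of coefficients inside a singular simplex `σ`, from the point `s` to the
point `t`. -/
def transport {n : ℕ} (σ : C(Simplex n, Z)) (s t : Simplex n) :
    A.obj ⟨σ s⟩ →ₗ[R] A.obj ⟨σ t⟩ :=
  (A.map (edge σ s t)).hom

theorem transport_trans {n : ℕ} (σ : C(Simplex n, Z)) (s t u : Simplex n) (a : A.obj ⟨σ s⟩) :
    transport A σ t u (transport A σ s t a) = transport A σ s u a := by
  simp only [transport]
  rw [← edge_trans σ s t u, A.map_comp, ModuleCat.hom_comp, LinearMap.comp_apply]

theorem transport_comp {m n : ℕ} (σ : C(Simplex n, Z)) (F : C(Simplex m, Simplex n))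
    (s t : Simplex m) (a : A.obj ⟨σ (F s)⟩) :
    transport A (σ.comp F) s t a = transport A σ (F s) (F t) a :=
  congrArg (fun k => (A.map k).hom a) (edge_comp σ F s t)

/-! ### Chains, cochains and the cap product -/

/-- Singular `n`-chains with coefficients in `A`: finite formal sums of singular simplices `σ`
with coefficients in the fibre of `A` at the initial vertex of `σ`. -/
abbrev Chain (n : ℕ) := Π₀ σ : C(Simplex n, Z), A.obj ⟨σ (v₀ n)⟩

/-- Singular `n`-cochains with coefficients in `A`. -/
abbrev Cochain (n : ℕ) := ∀ σ : C(Simplex n, Z), A.obj ⟨σ (v₀ n)⟩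

open scoped Classical in
/-- The boundary operator `∂ (a σ) = ∑ (-1)^i a σ∘dᵢ`; the coefficient is transported to the
initial vertex of the face. -/
def boundary (n : ℕ) : Chain A (n + 1) →ₗ[R] Chain A n :=
  DFinsupp.lsum ℕ fun σ => ∑ i : Fin (n + 2), (-1 : R) ^ (i : ℕ) •
    (DFinsupp.lsingle (M := fun τ : C(Simplex n, Z) => A.obj ⟨τ (v₀ n)⟩) (σ.comp (face i))) ∘ₗ
      transport A σ (v₀ (n + 1)) (face i (v₀ n))

/-- The coboundary operator `(δ φ) σ = ∑ (-1)^i φ (σ∘dᵢ)`, with values transported to the initial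
vertex of `σ`. -/
def coboundary (n : ℕ) : Cochain A n →ₗ[R] Cochain A (n + 1) :=
  LinearMap.pi fun σ => ∑ i : Fin (n + 2), (-1 : R) ^ (i : ℕ) •
    transport A σ (face i (v₀ n)) (v₀ (n + 1)) ∘ₗ LinearMap.proj (σ.comp (face i))

open scoped Classical in
/-- The cap product of a cochain with coefficients in `A` and a chain with coefficients in `R`:
`φ ∩ σ` is the back `q`-face of `σ` with coefficient the value of `φ` on the front `p`-face,
transported to the initial vertex of the back face. -/
def cap {p q n : ℕ} (h : p + q = n) :
    Cochain A p →ₗ[R] Chain (constSystem R Z) n →ₗ[R] Chain A q :=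
  LinearMap.flip <| DFinsupp.lsum ℕ fun σ => LinearMap.toSpanSingleton R (Cochain A p →ₗ[R] Chain A q)
    ((DFinsupp.lsingle (M := fun τ : C(Simplex q, Z) => A.obj ⟨τ (v₀ q)⟩) (σ.comp (back h))) ∘ₗ
      transport A σ (front h (v₀ p)) (back h (v₀ q)) ∘ₗ LinearMap.proj (σ.comp (front h)))

open scoped Classical in
/-- The elementary chain supported on `σ ∘ G` whose coefficient is the value of `φ` on `σ ∘ F`. -/
def capTerm {p q n : ℕ} (σ : C(Simplex n, Z)) (φ : Cochain A p)
    (F : C(Simplex p, Simplex n)) (G : C(Simplex q, Simplex n)) : Chain A q :=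
  DFinsupp.single (β := fun τ : C(Simplex q, Z) => A.obj ⟨τ (v₀ q)⟩) (σ.comp G)
    (transport A σ (F (v₀ p)) (G (v₀ q)) (φ (σ.comp F)))

open scoped Classical in
/-- A singular simplex, as a chain with constant coefficients. -/
def simplexChain (R : Type*) [CommRing R] {n : ℕ} (σ : C(Simplex n, Z)) :
    Chain (constSystem R Z) n :=
  DFinsupp.single (β := fun τ : C(Simplex n, Z) => (constSystem R Z).obj ⟨τ (v₀ n)⟩) σ (1 : R)

theorem cap_simplex {p q n : ℕ} (h : p + q = n) (φ : Cochain A p) (σ : C(Simplex n, Z)) :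
    cap A h φ (simplexChain R σ) = capTerm A σ φ (front h) (back h) := by
  simp [cap, simplexChain, capTerm]

theorem boundary_simplex {n : ℕ} (σ : C(Simplex (n + 1), Z)) :
    boundary (constSystem R Z) n (simplexChain R σ) =
      ∑ i : Fin (n + 2), (-1 : R) ^ (i : ℕ) • simplexChain R (σ.comp (face i)) := by
  simp [boundary, simplexChain, transport]

theorem boundary_capTerm {p q n : ℕ} (σ : C(Simplex n, Z)) (φ : Cochain A p)
    (F : C(Simplex p, Simplex n)) (G : C(Simplex (q + 1), Simplex n)) :
    boundary A q (capTerm A σ φ F G) =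
      ∑ i : Fin (q + 2), (-1 : R) ^ (i : ℕ) • capTerm A σ φ F (G.comp (face i)) := by
  classical
  simp only [boundary, capTerm, DFinsupp.lsum_single, LinearMap.sum_apply, LinearMap.smul_apply,
    LinearMap.comp_apply, DFinsupp.lsingle_apply]
  refine Finset.sum_congr rfl fun i _ => ?_
  rw [transport_comp, transport_trans]
  rfl

theorem capTerm_coboundary {p q n : ℕ} (σ : C(Simplex n, Z)) (φ : Cochain A p)
    (F : C(Simplex (p + 1), Simplex n)) (G : C(Simplex q, Simplex n)) :
    capTerm A σ (coboundary A p φ) F G =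
      ∑ i : Fin (p + 2), (-1 : R) ^ (i : ℕ) • capTerm A σ φ (F.comp (face i)) G := by
  classical
  simp only [coboundary, capTerm, LinearMap.pi_apply, LinearMap.sum_apply, LinearMap.smul_apply,
    LinearMap.comp_apply, LinearMap.proj_apply, map_sum, map_smul]
  rw [← DFinsupp.lsingle_apply (R := R), map_sum]
  refine Finset.sum_congr rfl fun i _ => ?_
  rw [map_smul, transport_comp, transport_trans]
  rfl

theorem capTerm_face {p q n : ℕ} (σ : C(Simplex (n + 1), Z)) (φ : Cochain A p) (i : Fin (n + 2))
    (F : C(Simplex p, Simplex n)) (G : C(Simplex q, Simplex n)) :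
    capTerm A (σ.comp (face i)) φ F G =
      capTerm A σ φ ((face i).comp F) ((face i).comp G) := by
  simp only [capTerm]
  rw [transport_comp]
  rfl

theorem face_comp_front_of_le {p q n : ℕ} (h : p + q = n) (i : Fin (n + 2)) (j : Fin (p + 2))
    (hij : (i : ℕ) = j) :
    (face i).comp (front h) = (front (q := q) (by omega)).comp (face j) := by
  simp only [face, front, simplexMap_comp]
  congr 1
  funext k
  simp only [Function.comp_apply, Fin.succAbove, Fin.lt_def, Fin.ext_iff]
  split_ifs <;> (simp_all; try omega)

theorem face_comp_back_of_le {p q n : ℕ} (h : p + q = n) (i : Fin (n + 2)) (hi : (i : ℕ) ≤ p) :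
    (face i).comp (back h) = back (p := p + 1) (by omega) := by
  simp only [face, back, simplexMap_comp]
  congr 1
  funext k
  simp only [Function.comp_apply, Fin.succAbove, Fin.lt_def, Fin.ext_iff]
  split_ifs <;> simp_all <;> omega

theorem face_comp_front_of_gt {p q n : ℕ} (h : p + q = n) (i : Fin (n + 2)) (hi : p < i) :
    (face i).comp (front h) = front (q := q + 1) (by omega) := by
  simp only [face, front, simplexMap_comp]
  congr 1
  funext k
  simp only [Function.comp_apply, Fin.succAbove, Fin.lt_def, Fin.ext_iff]
  split_ifs <;> (simp_all; try omega)

theorem face_comp_back_of_gt {p q n : ℕ} (h : p + q = n) (i : Fin (n + 2)) (j : Fin (q + 2))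
    (hij : (i : ℕ) = p + j) :
    (face i).comp (back h) = (back (p := p) (by omega)).comp (face j) := by
  simp only [face, back, simplexMap_comp]
  congr 1
  funext k
  simp only [Function.comp_apply, Fin.succAbove, Fin.lt_def, Fin.ext_iff]
  split_ifs <;> simp_all <;> omega

theorem front_comp_face_last {p q n : ℕ} (h : p + 1 + q = n) :
    (front h).comp (face (Fin.last (p + 1))) = front (q := q + 1) (by omega) := by
  simp only [face, front, simplexMap_comp]
  congr 1
  funext k
  simp

theorem back_comp_face_zero {p q n : ℕ} (h : p + (q + 1) = n) :
    (back h).comp (face 0) = back (p := p + 1) (by omega) := by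
  simp only [face, back, simplexMap_comp]
  congr 1
  funext k
  simp
  omega

/-- The Leibniz rule `φ ∩ ∂c = δφ ∩ c + (-1)^p ∂(φ ∩ c)`. -/
theorem cap_boundary {p q n : ℕ} (h : p + q = n) (φ : Cochain A p)
    (c : Chain (constSystem R Z) (n + 1)) :
    cap A h φ (boundary _ n c) =
      cap A (show p + 1 + q = n + 1 by omega) (coboundary A p φ) c +
        (-1 : R) ^ p • boundary A q (cap A (show p + (q + 1) = n + 1 by omega) φ c) := by
  classical
  suffices H : (cap A h φ) ∘ₗ (boundary _ n) =
      cap A (show p + 1 + q = n + 1 by omega) (coboundary A p φ) +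
        (-1 : R) ^ p • (boundary A q) ∘ₗ (cap A (show p + (q + 1) = n + 1 by omega) φ) from
    LinearMap.congr_fun H c
  refine DFinsupp.lhom_ext' fun σ => LinearMap.ext_ring ?_
  change cap A h φ (boundary _ n (simplexChain R σ)) =
      cap A (show p + 1 + q = n + 1 by omega) (coboundary A p φ) (simplexChain R σ) +
        (-1 : R) ^ p • boundary A q
          (cap A (show p + (q + 1) = n + 1 by omega) φ (simplexChain R σ))
  simp only [boundary_simplex, cap_simplex, boundary_capTerm, capTerm_coboundary, map_sum,
    map_smul, capTerm_face]
  rw [Fin.sum_univ_castSucc (n := p + 1), Fin.sum_univ_succ (n := q + 1), front_comp_face_last,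
    back_comp_face_zero, smul_add, Finset.smul_sum]
  rw [← Equiv.sum_comp (finCongr (show (p + 1) + (q + 1) = n + 2 by omega)), Fin.sum_univ_add]
  have h1 : ∀ (i : Fin (n + 2)) (j : Fin (p + 1)), (i : ℕ) = j →
      (-1 : R) ^ (i : ℕ) • capTerm A σ φ ((face i).comp (front h)) ((face i).comp (back h)) =
      (-1 : R) ^ ((j.castSucc : Fin (p + 2)) : ℕ) • capTerm A σ φ
        ((front (show p + 1 + q = n + 1 by omega)).comp (face j.castSucc))
        (back (show p + 1 + q = n + 1 by omega)) := by
    intro i j hij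
    rw [face_comp_front_of_le h i j.castSucc (by simpa using hij),
      face_comp_back_of_le h i (by omega), hij, Fin.val_castSucc]
  have h2 : ∀ (i : Fin (n + 2)) (j : Fin (q + 1)), (i : ℕ) = p + 1 + j →
      (-1 : R) ^ (i : ℕ) • capTerm A σ φ ((face i).comp (front h)) ((face i).comp (back h)) =
      (-1 : R) ^ p • (-1 : R) ^ ((j.succ : Fin (q + 2)) : ℕ) • capTerm A σ φ
        (front (show p + (q + 1) = n + 1 by omega))
        ((back (show p + (q + 1) = n + 1 by omega)).comp (face j.succ)) := by
    intro i j hij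
    rw [face_comp_front_of_gt h i (by omega),
      face_comp_back_of_gt h i j.succ (by simp only [Fin.val_succ]; omega), smul_smul,
      ← pow_add, hij, Fin.val_succ, add_assoc, add_comm 1]
  have h3 : (-1 : R) ^ ((Fin.last (p + 1) : Fin (p + 2)) : ℕ) = -(-1 : R) ^ p := by
    simp [pow_succ]
  rw [Finset.sum_congr rfl fun j _ => h1 _ j (by simp),
    Finset.sum_congr rfl fun j _ => h2 _ j (by simp), h3]
  simp

/-! ### Relative singular homology and cohomology with local coefficients

For a subset `S` of `Z` these are the groups of the pair `(Z, S)`; the absolute groups are the case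
`S = ∅`. -/

/-- The submodule `C_n(S; A)` of chains all of whose simplices lie in `S`. -/
def chainsIn (S : Set Z) (n : ℕ) : Submodule R (Chain A n) where
  carrier := {c | ∀ σ : C(Simplex n, Z), ¬ Set.range σ ⊆ S → c σ = 0}
  add_mem' := fun ha hb σ hσ => by simp [ha σ hσ, hb σ hσ]
  zero_mem' := fun _ _ => rfl
  smul_mem' := fun r c hc σ hσ => by simp [hc σ hσ]

/-- The submodule `C^n(Z, S; A)` of cochains that vanish on all simplices lying in `S`. -/
def relCochains (S : Set Z) (n : ℕ) : Submodule R (Cochain A n) where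
  carrier := {φ | ∀ σ : C(Simplex n, Z), Set.range σ ⊆ S → φ σ = 0}
  add_mem' := fun ha hb σ hσ => by simp [ha σ hσ, hb σ hσ]
  zero_mem' := fun _ _ => rfl
  smul_mem' := fun r c hc σ hσ => by simp [hc σ hσ]

/-- Relative cycles: chains whose boundary lies in `S`. -/
def cycles (S : Set Z) : ∀ n : ℕ, Submodule R (Chain A n)
  | 0 => ⊤
  | n + 1 => (chainsIn A S n).comap (boundary A n)

/-- Relative boundaries: boundaries up to chains in `S`. -/
def boundaries (S : Set Z) (n : ℕ) : Submodule R (Chain A n) :=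
  LinearMap.range (boundary A n) ⊔ chainsIn A S n

/-- The relative homology module `H_n(Z, S; A)`. -/
abbrev Homology (S : Set Z) (n : ℕ) :=
  cycles A S n ⧸ (boundaries A S n).submoduleOf (cycles A S n)

/-- Relative cocycles. -/
def cocycles (S : Set Z) (n : ℕ) : Submodule R (Cochain A n) :=
  relCochains A S n ⊓ LinearMap.ker (coboundary A n)

/-- Relative coboundaries. -/
def coboundaries (S : Set Z) : ∀ n : ℕ, Submodule R (Cochain A n)
  | 0 => ⊥
  | n + 1 => (relCochains A S n).map (coboundary A n)

/-- The relative cohomology module `H^n(Z, S; A)`. -/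
abbrev Cohomology (S : Set Z) (n : ℕ) :=
  cocycles A S n ⧸ (coboundaries A S n).submoduleOf (cocycles A S n)

theorem range_comp_subset {m n : ℕ} (σ : C(Simplex n, Z)) (F : C(Simplex m, Simplex n)) :
    Set.range (σ.comp F) ⊆ Set.range σ := by
  rintro _ ⟨x, rfl⟩
  exact ⟨F x, rfl⟩

theorem cap_mem_chainsIn {S S' T : Set Z} (hS : S' ⊆ S ∨ S' ⊆ T) {p q n : ℕ} (h : p + q = n)
    {φ : Cochain A p} (hφ : φ ∈ relCochains A S p) {c : Chain (constSystem R Z) n}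
    (hc : c ∈ chainsIn (constSystem R Z) S' n) : cap A h φ c ∈ chainsIn A T q := by
  classical
  rw [← DFinsupp.sum_single (f := c), DFinsupp.sum, map_sum]
  refine Submodule.sum_mem _ fun σ hσ => ?_
  have hσ' : Set.range σ ⊆ S' := by
    by_contra hn
    exact (DFinsupp.mem_support_iff.1 hσ) (hc σ hn)
  have hsmul : (DFinsupp.single σ (c σ) : Chain (constSystem R Z) n) =
      (show R from c σ) • simplexChain R σ := by
    rw [simplexChain, ← DFinsupp.single_smul]
    congr 1
    exact (mul_one (show R from c σ)).symm
  rw [hsmul, map_smul, cap_simplex]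
  refine Submodule.smul_mem _ _ ?_
  rcases hS with hS | hS
  · have h0 : φ (σ.comp (front h)) = 0 :=
      hφ _ ((range_comp_subset σ _).trans (hσ'.trans hS))
    rw [capTerm, h0, map_zero, DFinsupp.single_zero]
    exact Submodule.zero_mem _
  · intro τ hτ
    refine DFinsupp.single_eq_of_ne fun hne => hτ ?_
    rw [hne]
    exact (range_comp_subset σ _).trans (hσ'.trans hS)

theorem cap_mem_cycles {S S' T : Set Z} (hS : S' ⊆ S ∨ S' ⊆ T) {p q n : ℕ} (h : p + q = n)
    {φ : Cochain A p} (hφ : φ ∈ cocycles A S p) {c : Chain (constSystem R Z) n}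
    (hc : c ∈ cycles (constSystem R Z) S' n) : cap A h φ c ∈ cycles A T q := by
  cases q with
  | zero => exact Submodule.mem_top
  | succ q =>
    obtain ⟨n, rfl⟩ : ∃ m, n = m + 1 := ⟨p + q, by omega⟩
    have hδ : coboundary A p φ = 0 := hφ.2
    have hL := cap_boundary A (show p + q = n by omega) φ c
    rw [hδ, map_zero, LinearMap.zero_apply, zero_add] at hL
    have hmem := cap_mem_chainsIn A hS (show p + q = n by omega) hφ.1 hc
    rw [hL] at hmem
    have := Submodule.smul_mem _ ((-1 : R) ^ p) hmem
    rwa [smul_smul, ← mul_pow, neg_one_mul, neg_neg, one_pow, one_smul] at this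

theorem cap_mem_boundaries_left {S S' T : Set Z} (hS : S' ⊆ S ∨ S' ⊆ T) {p q n : ℕ}
    (h : p + q = n) {φ : Cochain A p} (hφ : φ ∈ coboundaries A S p)
    {c : Chain (constSystem R Z) n} (hc : c ∈ cycles (constSystem R Z) S' n) :
    cap A h φ c ∈ boundaries A T q := by
  cases p with
  | zero =>
    obtain rfl : φ = 0 := hφ
    rw [map_zero]
    exact Submodule.zero_mem _
  | succ p =>
    obtain ⟨n, rfl⟩ : ∃ m, n = m + 1 := ⟨p + q, by omega⟩
    obtain ⟨ψ, hψ, rfl⟩ := hφ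
    have hL := cap_boundary A (show p + q = n by omega) ψ c
    rw [← sub_eq_iff_eq_add] at hL
    rw [← hL]
    refine Submodule.sub_mem _ (Submodule.mem_sup_right ?_)
      (Submodule.mem_sup_left (Submodule.smul_mem _ _ ⟨_, rfl⟩))
    exact cap_mem_chainsIn A hS _ hψ hc

theorem cap_mem_boundaries_right {S S' T : Set Z} (hS : S' ⊆ S ∨ S' ⊆ T) {p q n : ℕ}
    (h : p + q = n) {φ : Cochain A p} (hφ : φ ∈ cocycles A S p)
    {c : Chain (constSystem R Z) n} (hc : c ∈ boundaries (constSystem R Z) S' n) :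
    cap A h φ c ∈ boundaries A T q := by
  obtain ⟨_, ⟨e, rfl⟩, c', hc', rfl⟩ := Submodule.mem_sup.1 hc
  rw [map_add]
  refine Submodule.add_mem _ (Submodule.mem_sup_left ?_)
    (Submodule.mem_sup_right (cap_mem_chainsIn A hS h hφ.1 hc'))
  have hδ : coboundary A p φ = 0 := hφ.2
  rw [cap_boundary, hδ, map_zero, LinearMap.zero_apply, zero_add]
  exact Submodule.smul_mem _ _ ⟨_, rfl⟩

/-- The cap product on the level of relative cocycles and relative cycles. -/
def capCycles {S S' T : Set Z} (hS : S' ⊆ S ∨ S' ⊆ T) {p q n : ℕ} (h : p + q = n) :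
    cocycles A S p →ₗ[R] cycles (constSystem R Z) S' n →ₗ[R] Homology A T q :=
  LinearMap.mk₂ R
    (fun φ c => Submodule.Quotient.mk ⟨cap A h φ c, cap_mem_cycles A hS h φ.2 c.2⟩)
    (fun φ ψ c => by
      rw [← Submodule.Quotient.mk_add]; congr 1; ext1; simp)
    (fun r φ c => by
      rw [← Submodule.Quotient.mk_smul]; congr 1; ext1; simp)
    (fun φ c d => by
      rw [← Submodule.Quotient.mk_add]; congr 1; ext1; simp)
    (fun r φ c => by
      rw [← Submodule.Quotient.mk_smul]; congr 1; ext1; simp)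

/-- The cap product `H^p(Z, S; A) → H_q(Z, T; A)`, `φ ↦ φ ∩ z`, with a class `z ∈ H_n(Z, S'; R)`,
where `p + q = n` and `S'` is contained in `S` or in `T`. -/
def homologyCap {S S' T : Set Z} (hS : S' ⊆ S ∨ S' ⊆ T) {p q n : ℕ} (h : p + q = n) :
    Homology (constSystem R Z) S' n →ₗ[R] Cohomology A S p →ₗ[R] Homology A T q :=
  Submodule.liftQ _
    (LinearMap.flip (Submodule.liftQ _ (capCycles A hS h) (fun φ hφ => by
      ext c
      exact (Submodule.Quotient.mk_eq_zero _).2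
        (cap_mem_boundaries_left A hS h hφ c.2))))
    (fun c hc => by
      refine Submodule.linearMap_qext _ (LinearMap.ext fun φ => ?_)
      exact (Submodule.Quotient.mk_eq_zero _).2 (cap_mem_boundaries_right A hS h φ.2 hc))

end LocalCoefficients

/-! ### Finite complexes, mapping cylinders and the suspension over `B` -/

section Spaces

/-- `X` is a finite complex: a space homotopy equivalent to a finite CW complex. Every finite CW
complex is one, and so is the union of two mapping cylinders of a map of finite CW complexes along
their common end, also if the map is not cellular. -/
def IsFiniteComplex.{u} (X : Type u) [TopologicalSpace X] : Prop :=
  ∃ (T : Type u) (_ : TopologicalSpace T) (_ : T2Space T)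
    (_ : Topology.CWComplex (Set.univ : Set T)),
    Topology.RelCWComplex.Finite (Set.univ : Set T) ∧
      Nonempty (ContinuousMap.HomotopyEquiv X T)

/-- `B` is a classifying space of the group `Γ` (a space of type `K(Γ, 1)`). -/
structure IsClassifyingSpace (Γ : Type*) [Group Γ] (B : Type*) [TopologicalSpace B] : Prop where
  pathConnected : PathConnectedSpace B
  pi_one : ∀ b : B, Nonempty (FundamentalGroup B b ≃* Γ)
  pi_trivial : ∀ (n : ℕ) (b : B), 2 ≤ n → Subsingleton (HomotopyGroup.Pi n B b)

variable {X Y : Type*} [TopologicalSpace X] [TopologicalSpace Y]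

/-- `f` induces isomorphisms of fundamental groups. -/
def IsPiOneIso (f : C(X, Y)) : Prop :=
  ∀ x : X, Function.Bijective (FundamentalGroup.map f x)

/-- The identifications `(x, 0) ∼ f x` in the disjoint union of `X × [0, 1]` and `Y`. -/
inductive MappingCylinder.Rel (f : C(X, Y)) :
    (X × unitInterval) ⊕ Y → (X × unitInterval) ⊕ Y → Prop
  | glue (x : X) : MappingCylinder.Rel f (Sum.inl (x, 0)) (Sum.inr (f x))

/-- The mapping cylinder of `f`. -/
def MappingCylinder (f : C(X, Y)) := Quot (MappingCylinder.Rel f)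

instance (f : C(X, Y)) : TopologicalSpace (MappingCylinder f) :=
  inferInstanceAs (TopologicalSpace (Quot (MappingCylinder.Rel f)))

/-- The inclusion `x ↦ (x, 1)` of `X` in the mapping cylinder of `f`. -/
def MappingCylinder.top (f : C(X, Y)) : C(X, MappingCylinder f) where
  toFun x := Quot.mk _ (Sum.inl (x, 1))
  continuous_toFun := continuous_quot_mk.comp (by fun_prop)

/-- The projection of the mapping cylinder of `f` onto `Y`, `(x, t) ↦ f x`, `y ↦ y`. -/
def MappingCylinder.proj (f : C(X, Y)) : C(MappingCylinder f, Y) where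
  toFun := Quot.lift (Sum.elim (fun a => f a.1) id) (by rintro _ _ ⟨x⟩; rfl)
  continuous_toFun := continuous_quot_lift _ (by fun_prop)

/-- The identifications `i x ∼ i x` between two copies of `Z`. -/
inductive Double.Rel {Z : Type*} [TopologicalSpace Z] (i : C(X, Z)) : Z ⊕ Z → Z ⊕ Z → Prop
  | glue (x : X) : Double.Rel i (Sum.inl (i x)) (Sum.inr (i x))

/-- The union `Z ∪_X Z` of two copies of `Z` along the image of `i : X → Z`. -/
def Double {Z : Type*} [TopologicalSpace Z] (i : C(X, Z)) := Quot (Double.Rel i)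

instance {Z : Type*} [TopologicalSpace Z] (i : C(X, Z)) : TopologicalSpace (Double i) :=
  inferInstanceAs (TopologicalSpace (Quot (Double.Rel i)))

/-- The suspension `SX = B ∪_X B` of `f : X → B`: the map `f` is replaced by the inclusion of `X`
in the mapping cylinder of `f`, and two copies of the cylinder are glued along `X`. -/
abbrev Suspension (f : C(X, Y)) := Double (MappingCylinder.top f)

/-- The canonical map `SX = B ∪_X B → B`, which is the projection on both copies of `B`. -/
def suspensionMap (f : C(X, Y)) : C(Suspension f, Y) where
  toFun := Quot.lift (Sum.elim (MappingCylinder.proj f) (MappingCylinder.proj f))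
    (by rintro _ _ ⟨x⟩; rfl)
  continuous_toFun := continuous_quot_lift _ (by fun_prop)

/-! ### Poincaré pairs -/

/-- The class `z ∈ H_n(Y, X; R)` of the pair (mapping cylinder of `f`, `X`) induces duality
isomorphisms with coefficients in the local system `A` on `Y`, in all degrees. The groups in
negative degrees are zero, so in the degrees above `n` all groups have to vanish. -/
structure IsDualityClass {R : Type*} [CommRing R] (n : ℕ) (f : C(X, Y)) (A : LocalSystem R Y)
    (z : Homology (constSystem R (MappingCylinder f)) (Set.range (MappingCylinder.top f)) n) :
    Prop where
  /-- `H^p(Y; A) ≅ H_q(Y, X; A)` -/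
  bijective_abs : ∀ (p q : ℕ) (h : p + q = n), Function.Bijective
    (homologyCap (A.pullback (MappingCylinder.proj f)) (S := ∅)
      (T := Set.range (MappingCylinder.top f)) (Or.inr subset_rfl) h z)
  /-- `H^p(Y, X; A) ≅ H_q(Y; A)` -/
  bijective_rel : ∀ (p q : ℕ) (h : p + q = n), Function.Bijective
    (homologyCap (A.pullback (MappingCylinder.proj f)) (S := Set.range (MappingCylinder.top f))
      (T := ∅) (Or.inl subset_rfl) h z)
  cohomology_abs : ∀ k, n < k →
    Subsingleton (Cohomology (A.pullback (MappingCylinder.proj f)) ∅ k)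
  homology_rel : ∀ k, n < k → Subsingleton
    (Homology (A.pullback (MappingCylinder.proj f)) (Set.range (MappingCylinder.top f)) k)
  cohomology_rel : ∀ k, n < k → Subsingleton
    (Cohomology (A.pullback (MappingCylinder.proj f)) (Set.range (MappingCylinder.top f)) k)
  homology_abs : ∀ k, n < k →
    Subsingleton (Homology (A.pullback (MappingCylinder.proj f)) ∅ k)

/-- `f : X → Y` is an `n`-dimensional Poincaré pair over `R`: a `π₁`-isomorphism of finite
connected complexes such that `H_n(Y, X; R) ≅ R` and a generator induces duality isomorphisms with
coefficients in the group ring `R[π₁(Y)]`. For `R = ℤ` this is a Poincaré pair, for `R = ℚ` a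
rational Poincaré pair. -/
structure IsPoincarePair (R : Type*) [CommRing R] (n : ℕ) (f : C(X, Y)) : Prop where
  finite_source : IsFiniteComplex X
  finite_target : IsFiniteComplex Y
  connected_source : PathConnectedSpace X
  connected_target : PathConnectedSpace Y
  piOneIso : IsPiOneIso f
  duality : ∃ e : Homology (constSystem R (MappingCylinder f))
      (Set.range (MappingCylinder.top f)) n ≃ₗ[R] R,
    ∀ y₀ : Y, IsDualityClass n f (groupRingSystem R y₀) (e.symm 1)

end Spaces

end PoincareStab

end

/-!
The mapping cylinder `M` of `SX → B` contains `SX` and two copies of the mapping cylinder `M_f`,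
which meet in `X`. A copy `M_f⁻` is a deformation retract of `M`, so `H_*(M, M_f⁻)` vanishes, and
the boundary map of the triple `(M, SX, M_f⁻)` followed by excision of `M_f⁻` gives
`H_{k+1}(B, SX) ≅ H_k(SX, M_f⁻) ≅ H_k(M_f, X) = H_k(B, X)`, and likewise in cohomology with any
local coefficients. By the Leibniz rule the cap product with a class `z` in `H_{n+1}(B, SX)`
corresponds, up to sign, to the cap product with the image of `z` in `H_n(B, X)`; so one is
bijective if and only if the other is. Only degree `n + 1` needs a separate argument: there duality
for `SX` gives `H^{n+1}(B) ≅ H_0(B, SX) = 0` and `H_{n+1}(B) ≅ H^0(B, SX) = 0`.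

Chain homotopies (subdivision, prisms) are written as operators over `B` on formal sums of singular
simplices with path classes in `B`. An operator acts on chains covariantly and on cochains
contravariantly, for all local coefficients, so each homotopy is constructed only once.
-/

noncomputable section

namespace PoincareStab

/-! ### Operators on singular simplices over a base space -/

section ModelPaths

variable {Z W W₁ : Type*} [TopologicalSpace Z] [TopologicalSpace W] [TopologicalSpace W₁]
  [ContractibleSpace W] [ContractibleSpace W₁]

/-- The homotopy class of the image of any path from `s` to `t` in a contractible model. -/
def modelEdge (Φ : C(W, Z)) (s t : W) :
    FundamentalGroupoid.mk (Φ s) ⟶ FundamentalGroupoid.mk (Φ t) :=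
  (Path.Homotopic.Quotient.mk (PathConnectedSpace.somePath s t)).map Φ

theorem modelEdge_trans (Φ : C(W, Z)) (s t u : W) :
    modelEdge Φ s t ≫ modelEdge Φ t u = modelEdge Φ s u := by
  have h : (Path.Homotopic.Quotient.mk (PathConnectedSpace.somePath s t)).trans
      (.mk (PathConnectedSpace.somePath t u)) = .mk (PathConnectedSpace.somePath s u) :=
    Subsingleton.elim _ _
  exact ((FundamentalGroupoid.map Φ).map_comp (X := ⟨s⟩) (Y := ⟨t⟩) (Z := ⟨u⟩)
    (.mk (PathConnectedSpace.somePath s t)) (.mk (PathConnectedSpace.somePath t u))).symm.trans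
      (congrArg (fun k : Path.Homotopic.Quotient s u => k.map Φ) h)

theorem modelEdge_self (Φ : C(W, Z)) (s : W) : modelEdge Φ s s = 𝟙 _ := by
  have : Path.Homotopic.Quotient.mk (PathConnectedSpace.somePath s s) =
    Path.Homotopic.Quotient.mk (Path.refl s) := Subsingleton.elim _ _
  rw [modelEdge, this]
  rfl

theorem modelEdge_comp (Φ : C(W, Z)) (G : C(W₁, W)) (s t : W₁) :
    modelEdge (Φ.comp G) s t = modelEdge Φ (G s) (G t) := by
  have h : (Path.Homotopic.Quotient.mk (PathConnectedSpace.somePath s t)).map G =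
      .mk (PathConnectedSpace.somePath (G s) (G t)) := Subsingleton.elim _ _
  exact congrArg (fun k : Path.Homotopic.Quotient (G s) (G t) => k.map Φ) h

theorem modelEdge_congr {Φ Φ' : C(W, Z)} (h : Φ = Φ') (s t : W) :
    modelEdge Φ s t = eqToHom (by rw [h]) ≫ modelEdge Φ' s t ≫ eqToHom (by rw [h]) := by
  subst h
  simp

theorem edge_self {n : ℕ} (σ : C(Simplex n, Z)) (s : Simplex n) : edge σ s s = 𝟙 _ :=
  modelEdge_self σ s

theorem inv_edge {n : ℕ} (σ : C(Simplex n, Z)) (s t : Simplex n) :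
    Groupoid.inv (edge σ s t) = edge σ t s := by
  rw [Groupoid.inv_eq_inv, ← IsIso.eq_inv_of_hom_inv_id (f := edge σ s t) (g := edge σ t s)]
  rw [edge_trans, edge_self]

end ModelPaths

section Supports

variable {R : Type*} [CommRing R] {Z : Type*} [TopologicalSpace Z]

theorem chainsIn_mono (A : LocalSystem R Z) {S T : Set Z} (h : S ⊆ T) (n : ℕ) :
    chainsIn A S n ≤ chainsIn A T n :=
  fun _ hc σ hσ => hc σ fun hS => hσ (hS.trans h)

variable {A : LocalSystem R Z} {n : ℕ}

open scoped Classical in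
theorem chainsIn_le {T : Set Z} {N : Submodule R (Chain A n)}
    (h : ∀ (σ : C(Simplex n, Z)) (x : A.obj ⟨σ (v₀ n)⟩), Set.range σ ⊆ T →
      DFinsupp.single (β := fun σ : C(Simplex n, Z) => A.obj ⟨σ (v₀ n)⟩) σ x ∈ N) :
    chainsIn A T n ≤ N := by
  intro c hc
  rw [← DFinsupp.sum_single (f := c), DFinsupp.sum]
  refine Submodule.sum_mem _ fun σ hσ => h σ (c σ) ?_
  by_contra hn
  exact (DFinsupp.mem_support_iff.1 hσ) (hc σ hn)

open scoped Classical in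
theorem single_mem_chainsIn {T : Set Z} {σ : C(Simplex n, Z)} (hσ : Set.range σ ⊆ T)
    (x : A.obj ⟨σ (v₀ n)⟩) :
    DFinsupp.single (β := fun σ : C(Simplex n, Z) => A.obj ⟨σ (v₀ n)⟩) σ x ∈ chainsIn A T n :=
  fun _ hτ => DFinsupp.single_eq_of_ne fun hne => hτ (hne ▸ hσ)

end Supports

section Operators

variable {R : Type*} [CommRing R] {B Z Z' Z'' Z''' : Type*} [TopologicalSpace B]
  [TopologicalSpace Z] [TopologicalSpace Z'] [TopologicalSpace Z''] [TopologicalSpace Z''']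
  {p : C(Z, B)} {p' : C(Z', B)} {p'' : C(Z'', B)} {p''' : C(Z''', B)} {n q r s : ℕ}

/-- The image in the base of the initial vertex of a singular simplex. -/
abbrev basePt (p : C(Z, B)) {n : ℕ} (σ : C(Simplex n, Z)) : FundamentalGroupoid B :=
  (FundamentalGroupoid.map p).obj ⟨σ (v₀ n)⟩

/-- A singular simplex of `Z` with a homotopy class of paths in `B` from `b` to the image of its
initial vertex. -/
abbrev Term (p : C(Z, B)) (b : FundamentalGroupoid B) (n : ℕ) :=
  Σ σ : C(Simplex n, Z), b ⟶ basePt p σ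

/-- Precomposition of the path class of a term. -/
def Term.shift {b b' : FundamentalGroupoid B} (γ : b ⟶ b') (t : Term p b' n) : Term p b n :=
  ⟨t.1, γ ≫ t.2⟩

theorem Term.shift_shift {b b' b'' : FundamentalGroupoid B} (γ : b ⟶ b') (γ' : b' ⟶ b'')
    (t : Term p b'' n) : (t.shift γ').shift γ = t.shift (γ ≫ γ') := by
  simp [Term.shift]

theorem Term.shift_id {b : FundamentalGroupoid B} (t : Term p b n) : t.shift (𝟙 b) = t := by
  simp [Term.shift]

theorem Term.ext_of_eq {b : FundamentalGroupoid B} {t t' : Term p b n} (h : t.1 = t'.1)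
    (hγ : t.2 ≫ eqToHom (by rw [h]) = t'.2) : t = t' := by
  obtain ⟨σ, γ⟩ := t
  obtain ⟨σ', γ'⟩ := t'
  obtain rfl : σ = σ' := h
  simpa using hγ

/-- An operator from the `n`-simplices of `Z` to the `q`-chains of `Z'`, over the base `B`. It
acts on chains and, contravariantly, on cochains with coefficients in any local system on `B`, so
that an identity between operators holds in homology and in cohomology. -/
abbrev Op (R : Type*) [CommRing R] (p : C(Z, B)) (p' : C(Z', B)) (n q : ℕ) :=
  ∀ σ : C(Simplex n, Z), Term p' (basePt p σ) q →₀ R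

namespace Op

/-- The linear extension of operators to formal sums of terms. -/
def extend (b : FundamentalGroupoid B) :
    Op R p p' n q →ₗ[R] (Term p b n →₀ R) →ₗ[R] (Term p' b q →₀ R) :=
  LinearMap.flip <| Finsupp.linearCombination R fun t =>
    Finsupp.lmapDomain R R (Term.shift t.2) ∘ₗ LinearMap.proj t.1

/-- Composition of operators. -/
def comp (L' : Op R p' p'' q r) (L : Op R p p' n q) : Op R p p'' n r :=
  fun σ => extend _ L' (L σ)

/-- The identity operator. -/
def one (p : C(Z, B)) (n : ℕ) : Op R p p n n := fun σ => Finsupp.single ⟨σ, 𝟙 _⟩ 1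

theorem extend_single (L : Op R p p' n q) {b : FundamentalGroupoid B} (t : Term p b n) (a : R) :
    extend b L (Finsupp.single t a) = a • Finsupp.mapDomain (Term.shift t.2) (L t.1) := by
  simp [extend]

theorem extend_shift (L : Op R p p' n q) {b b' : FundamentalGroupoid B} (γ : b ⟶ b')
    (y : Term p b' n →₀ R) :
    extend b L (Finsupp.mapDomain (Term.shift γ) y) =
      Finsupp.mapDomain (Term.shift γ) (extend b' L y) := by
  induction y using Finsupp.induction_linear with
  | zero => simp
  | add y y' h h' => simp only [Finsupp.mapDomain_add, map_add, h, h']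
  | single t a =>
    simp only [Finsupp.mapDomain_single, extend_single, Finsupp.mapDomain_smul]
    rw [← Finsupp.mapDomain_comp]
    congr 2
    funext u
    exact (Term.shift_shift γ t.2 u).symm

theorem extend_one (b : FundamentalGroupoid B) : extend b (one p n) = LinearMap.id (R := R) := by
  refine Finsupp.lhom_ext fun t a => ?_
  simp [extend_single, one, Finsupp.mapDomain_single, Term.shift]

theorem extend_comp (L' : Op R p' p'' q r) (L : Op R p p' n q) (b : FundamentalGroupoid B)
    (y : Term p b n →₀ R) : extend b (L'.comp L) y = extend b L' (extend b L y) := by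
  induction y using Finsupp.induction_linear with
  | zero => simp
  | add y y' h h' => simp only [map_add, h, h']
  | single t a => simp only [extend_single, comp, map_smul, extend_shift]

theorem comp_assoc (L'' : Op R p'' p''' r s) (L' : Op R p' p'' q r) (L : Op R p p' n q) :
    (L''.comp L').comp L = L''.comp (L'.comp L) :=
  funext fun σ => extend_comp _ _ _ (L σ)

theorem one_comp (L : Op R p p' n q) : (one p' q).comp L = L :=
  funext fun σ => by rw [comp, extend_one, LinearMap.id_apply]

theorem comp_one (L : Op R p p' n q) : L.comp (one p n) = L := by
  funext σ
  rw [comp, one, extend_single, one_smul]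
  have : Term.shift (𝟙 (basePt p σ)) = (id : Term p' (basePt p σ) q → _) :=
    funext fun t => t.shift_id
  exact (congrArg (fun g => Finsupp.mapDomain g (L σ)) this).trans Finsupp.mapDomain_id

theorem zero_comp (L : Op R p p' n q) : (0 : Op R p' p'' q r).comp L = 0 :=
  funext fun σ => LinearMap.congr_fun (map_zero (extend _)) (L σ)

theorem comp_zero (L' : Op R p' p'' q r) : L'.comp (0 : Op R p p' n q) = 0 :=
  funext fun _ => map_zero _

theorem comp_add (L' : Op R p' p'' q r) (L₁ L₂ : Op R p p' n q) :
    L'.comp (L₁ + L₂) = L'.comp L₁ + L'.comp L₂ :=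
  funext fun _ => map_add _ _ _

theorem comp_sub (L' : Op R p' p'' q r) (L₁ L₂ : Op R p p' n q) :
    L'.comp (L₁ - L₂) = L'.comp L₁ - L'.comp L₂ :=
  funext fun _ => map_sub _ _ _

theorem add_comp (L₁ L₂ : Op R p' p'' q r) (L : Op R p p' n q) :
    (L₁ + L₂).comp L = L₁.comp L + L₂.comp L :=
  funext fun σ => LinearMap.congr_fun (map_add (extend _) L₁ L₂) (L σ)

theorem sub_comp (L₁ L₂ : Op R p' p'' q r) (L : Op R p p' n q) :
    (L₁ - L₂).comp L = L₁.comp L - L₂.comp L :=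
  funext fun σ => LinearMap.congr_fun (map_sub (extend _) L₁ L₂) (L σ)

section Action

variable (A : LocalSystem R B)

open scoped Classical in
/-- A formal sum of terms, applied to a coefficient. -/
def chainEval (p : C(Z, B)) (n : ℕ) {b : FundamentalGroupoid B} :
    A.obj b →ₗ[R] (Term p b n →₀ R) →ₗ[R] Chain (A.pullback p) n :=
  LinearMap.flip <| Finsupp.linearCombination R fun t =>
    DFinsupp.lsingle (M := fun σ : C(Simplex n, Z) => (A.pullback p).obj ⟨σ (v₀ n)⟩) t.1 ∘ₗ
      (A.map t.2).hom

open scoped Classical in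
theorem chainEval_single {b : FundamentalGroupoid B} (x : A.obj b) (t : Term p b n) (a : R) :
    chainEval A p n x (Finsupp.single t a) =
      a • DFinsupp.single (β := fun σ : C(Simplex n, Z) => (A.pullback p).obj ⟨σ (v₀ n)⟩) t.1
        ((A.map t.2).hom x) := by
  simp [chainEval]

theorem chainEval_shift {b b' : FundamentalGroupoid B} (γ : b ⟶ b') (x : A.obj b)
    (y : Term p b' n →₀ R) :
    chainEval A p n x (Finsupp.mapDomain (Term.shift γ) y) =
      chainEval A p n ((A.map γ).hom x) y := by
  induction y using Finsupp.induction_linear with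
  | zero => simp
  | add y y' h h' => simp only [Finsupp.mapDomain_add, map_add, h, h']
  | single t a => simp [chainEval_single, Finsupp.mapDomain_single, Term.shift]

open scoped Classical in
/-- The action of operators on chains. -/
def chain : Op R p p' n q →ₗ[R] Chain (A.pullback p) n →ₗ[R] Chain (A.pullback p') q :=
  (DFinsupp.lsum R).toLinearMap ∘ₗ
    LinearMap.pi fun σ => (chainEval A p' q).flip ∘ₗ LinearMap.proj σ

open scoped Classical in
theorem chain_single (L : Op R p p' n q) (σ : C(Simplex n, Z))
    (x : (A.pullback p).obj ⟨σ (v₀ n)⟩) :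
    chain A L (DFinsupp.single σ x) = chainEval A p' q x (L σ) := by
  simp [chain]

theorem chain_chainEval (L : Op R p p' n q) {b : FundamentalGroupoid B} (x : A.obj b)
    (y : Term p b n →₀ R) :
    chain A L (chainEval A p n x y) = chainEval A p' q x (extend b L y) := by
  induction y using Finsupp.induction_linear with
  | zero => simp
  | add y y' h h' => simp only [map_add, h, h']
  | single t a => rw [chainEval_single, map_smul, chain_single, extend_single, map_smul,
      chainEval_shift]

theorem chain_comp (L' : Op R p' p'' q r) (L : Op R p p' n q) (c : Chain (A.pullback p) n) :
    chain A (L'.comp L) c = chain A L' (chain A L c) := by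
  classical
  suffices h : chain A (L'.comp L) = chain A L' ∘ₗ chain A L from LinearMap.congr_fun h c
  refine DFinsupp.lhom_ext fun σ x => ?_
  rw [LinearMap.comp_apply, chain_single, chain_single, chain_chainEval, comp]

theorem chain_one (c : Chain (A.pullback p) n) : chain A (one p n) c = c := by
  classical
  suffices h : chain A (one p n) = LinearMap.id from LinearMap.congr_fun h c
  refine DFinsupp.lhom_ext fun σ x => ?_
  rw [LinearMap.id_apply, chain_single, one, chainEval_single, one_smul, A.map_id]
  rfl

/-- A cochain, applied to a formal sum of terms: the value on a simplex is transported back along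
the path class of the term. -/
def cochainEval {p : C(Z, B)} {n : ℕ} {b : FundamentalGroupoid B} :
    Cochain (A.pullback p) n →ₗ[R] (Term p b n →₀ R) →ₗ[R] A.obj b :=
  LinearMap.flip <| Finsupp.linearCombination R fun t =>
    (A.map (Groupoid.inv t.2)).hom ∘ₗ
      LinearMap.proj (φ := fun σ : C(Simplex n, Z) => (A.pullback p).obj ⟨σ (v₀ n)⟩) t.1

theorem cochainEval_single {b : FundamentalGroupoid B} (φ : Cochain (A.pullback p) n)
    (t : Term p b n) (a : R) :
    cochainEval A φ (Finsupp.single t a) = a • (A.map (Groupoid.inv t.2)).hom (φ t.1) := by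
  simp [cochainEval]

theorem cochainEval_shift {b b' : FundamentalGroupoid B} (γ : b ⟶ b')
    (φ : Cochain (A.pullback p) n) (y : Term p b' n →₀ R) :
    cochainEval A φ (Finsupp.mapDomain (Term.shift γ) y) =
      (A.map (Groupoid.inv γ)).hom (cochainEval A φ y) := by
  induction y using Finsupp.induction_linear with
  | zero => simp
  | add y y' h h' => simp only [Finsupp.mapDomain_add, map_add, h, h']
  | single t a =>
    rw [Finsupp.mapDomain_single, cochainEval_single, cochainEval_single, map_smul]
    have : Groupoid.inv (t.shift γ).2 = Groupoid.inv t.2 ≫ Groupoid.inv γ := by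
      simp [Term.shift, Groupoid.inv_eq_inv]
    rw [this]
    exact congrArg (fun g => a • g.hom (φ t.1)) (A.map_comp (Groupoid.inv t.2) (Groupoid.inv γ))

/-- The contravariant action of operators on cochains. -/
def cochain : Op R p p' n q →ₗ[R] Cochain (A.pullback p') q →ₗ[R] Cochain (A.pullback p) n :=
  LinearMap.flip
    { toFun := fun φ => LinearMap.pi fun σ => cochainEval A φ ∘ₗ LinearMap.proj σ
      map_add' := fun φ ψ => by ext1; simp only [map_add]; rfl
      map_smul' := fun a φ => by ext1; simp only [map_smul]; rfl }

theorem cochain_apply (L : Op R p p' n q) (φ : Cochain (A.pullback p') q) (σ : C(Simplex n, Z)) :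
    cochain A L φ σ = cochainEval A φ (L σ) := rfl

theorem cochainEval_cochain (L : Op R p p' n q) {b : FundamentalGroupoid B}
    (φ : Cochain (A.pullback p') q) (y : Term p b n →₀ R) :
    cochainEval A (cochain A L φ) y = cochainEval A φ (extend b L y) := by
  induction y using Finsupp.induction_linear with
  | zero => simp
  | add y y' h h' => simp only [map_add, h, h']
  | single t a => rw [cochainEval_single, extend_single, map_smul, cochainEval_shift,
      cochain_apply]

theorem cochain_comp (L' : Op R p' p'' q r) (L : Op R p p' n q) (φ : Cochain (A.pullback p'') r) :
    cochain A (L'.comp L) φ = cochain A L (cochain A L' φ) :=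
  funext fun σ => by rw [cochain_apply, cochain_apply, cochainEval_cochain, comp]

theorem cochain_one (φ : Cochain (A.pullback p) n) : cochain A (one p n) φ = φ := by
  funext σ
  rw [cochain_apply, one, cochainEval_single, one_smul]
  have : Groupoid.inv (𝟙 (basePt p σ)) = 𝟙 _ := by simp [Groupoid.inv_eq_inv]
  rw [this, A.map_id]
  rfl

end Action

/-- The boundary operator: the `i`-th face occurs with the path class of the image of the `i`-th
face in the base. -/
def bd (p : C(Z, B)) (n : ℕ) : Op R p p (n + 1) n := fun σ =>
  ∑ i : Fin (n + 2), Finsupp.single ⟨σ.comp (face i),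
    (FundamentalGroupoid.map p).map (edge σ (v₀ (n + 1)) (face i (v₀ n)))⟩ ((-1 : R) ^ (i : ℕ))

theorem chain_bd (A : LocalSystem R B) : chain A (bd p n) = boundary (A.pullback p) n := by
  classical
  refine DFinsupp.lhom_ext fun σ x => ?_
  rw [chain_single, bd, map_sum, boundary, DFinsupp.lsum_single, LinearMap.sum_apply]
  refine Finset.sum_congr rfl fun i _ => ?_
  rw [chainEval_single]
  rfl

theorem cochain_bd (A : LocalSystem R B) : cochain A (bd p n) = coboundary (A.pullback p) n := by
  refine LinearMap.ext fun φ => funext fun σ => ?_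
  rw [cochain_apply, bd, map_sum, coboundary, LinearMap.pi_apply, LinearMap.sum_apply]
  refine Finset.sum_congr rfl fun i _ => ?_
  have : Groupoid.inv ((FundamentalGroupoid.map p).map (edge σ (v₀ (n + 1)) (face i (v₀ n)))) =
      (FundamentalGroupoid.map p).map (edge σ (face i (v₀ n)) (v₀ (n + 1))) := by
    rw [← inv_edge σ (v₀ (n + 1)), Groupoid.inv_eq_inv, Groupoid.inv_eq_inv, Functor.map_inv]
  rw [cochainEval_single, this]
  rfl

/-- The identity class at a point of `B` with two descriptions. -/
def overHom {z : Z} {z' : Z'} (h : p' z' = p z) :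
    (FundamentalGroupoid.map p).obj ⟨z⟩ ⟶ (FundamentalGroupoid.map p').obj ⟨z'⟩ :=
  eqToHom (congrArg FundamentalGroupoid.mk h.symm)

theorem overHom_comp_overHom_symm_assoc {z : Z} {z' : Z'} (h : p' z' = p z)
    {c : FundamentalGroupoid B} (γ : (FundamentalGroupoid.map p).obj ⟨z⟩ ⟶ c) :
    overHom h ≫ overHom h.symm ≫ γ = γ :=
  (eqToHom_trans_assoc _ _ γ).trans (Category.id_comp γ)

/-- Push-forward of simplices along a map over `B`. -/
def push (g : C(Z, Z')) (hg : ∀ z, p' (g z) = p z) (n : ℕ) : Op R p p' n n := fun σ =>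
  Finsupp.single ⟨g.comp σ, overHom (hg (σ (v₀ n)))⟩ 1

/-- The operator carries simplices in `T` to chains in `T'`. -/
def Carries (L : Op R p p' n q) (T : Set Z) (T' : Set Z') : Prop :=
  ∀ σ : C(Simplex n, Z), Set.range σ ⊆ T → ∀ t ∈ (L σ).support, Set.range t.1 ⊆ T'

section Carries

variable {L L' : Op R p p' n q} {T : Set Z} {T' : Set Z'} {T'' : Set Z''}

theorem Carries.add (h : L.Carries T T') (h' : L'.Carries T T') : (L + L').Carries T T' := by
  classical
  intro σ hσ t ht
  rcases Finset.mem_union.1 (Finsupp.support_add ht) with ht | ht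
  exacts [h σ hσ t ht, h' σ hσ t ht]

theorem Carries.sub (h : L.Carries T T') (h' : L'.Carries T T') : (L - L').Carries T T' := by
  classical
  intro σ hσ t ht
  rcases Finset.mem_union.1 (Finsupp.support_sub ht) with ht | ht
  exacts [h σ hσ t ht, h' σ hσ t ht]

theorem exists_of_mem_support_extend {L : Op R p p' n q} {b : FundamentalGroupoid B}
    {y : Term p b n →₀ R} {t : Term p' b q} (ht : t ∈ (extend b L y).support) :
    ∃ u ∈ y.support, ∃ v ∈ (L u.1).support, t = v.shift u.2 := by
  classical
  rw [extend, LinearMap.flip_apply, Finsupp.linearCombination_apply, Finsupp.sum,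
    LinearMap.sum_apply] at ht
  obtain ⟨u, hu, hut⟩ := Finset.mem_biUnion.1 (Finsupp.support_finsetSum ht)
  have h1 := Finsupp.mapDomain_support (Finsupp.support_smul hut)
  obtain ⟨v, hv, rfl⟩ := Finset.mem_image.1 h1
  exact ⟨u, hu, v, hv, rfl⟩

theorem Carries.comp {L' : Op R p' p'' q r} (h' : L'.Carries T' T'') (h : L.Carries T T') :
    (L'.comp L).Carries T T'' := by
  intro σ hσ t ht
  obtain ⟨u, hu, v, hv, rfl⟩ := exists_of_mem_support_extend ht
  exact h' u.1 (h σ hσ u hu) v hv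

theorem carries_one (T : Set Z) : (one p n : Op R p p n n).Carries T T := by
  intro σ hσ t ht
  obtain rfl := Finset.mem_singleton.1 (Finsupp.support_single_subset ht)
  exact hσ

theorem carries_bd (T : Set Z) : (bd p n : Op R p p (n + 1) n).Carries T T := by
  classical
  intro σ hσ t ht
  obtain ⟨i, -, hi⟩ := Finset.mem_biUnion.1 (Finsupp.support_finsetSum ht)
  obtain rfl := Finset.mem_singleton.1 (Finsupp.support_single_subset hi)
  exact (range_comp_subset σ _).trans hσ

theorem carries_push {g : C(Z, Z')} {hg : ∀ z, p' (g z) = p z} (h : Set.MapsTo g T T') :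
    (push g hg n : Op R p p' n n).Carries T T' := by
  intro σ hσ t ht
  obtain rfl := Finset.mem_singleton.1 (Finsupp.support_single_subset ht)
  rintro _ ⟨x, rfl⟩
  exact h (hσ ⟨x, rfl⟩)

variable (A : LocalSystem R B)

theorem chainEval_mem {b : FundamentalGroupoid B} (x : A.obj b) {y : Term p b n →₀ R}
    {N : Submodule R (Chain (A.pullback p) n)}
    (h : ∀ t ∈ y.support, chainsIn (A.pullback p) (Set.range t.1) n ≤ N) :
    chainEval A p n x y ∈ N := by
  classical
  rw [← Finsupp.sum_single y, Finsupp.sum, map_sum]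
  refine Submodule.sum_mem _ fun t ht => ?_
  rw [chainEval_single]
  exact Submodule.smul_mem _ _ (h t ht (single_mem_chainsIn subset_rfl _))

theorem chain_mem {N : Submodule R (Chain (A.pullback p') q)}
    (h : ∀ σ : C(Simplex n, Z), Set.range σ ⊆ T → ∀ t ∈ (L σ).support,
      chainsIn (A.pullback p') (Set.range t.1) q ≤ N)
    {c : Chain (A.pullback p) n} (hc : c ∈ chainsIn (A.pullback p) T n) : chain A L c ∈ N := by
  classical
  refine chainsIn_le (N := N.comap (chain A L)) (fun σ x hσ => ?_) hc
  rw [Submodule.mem_comap, chain_single]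
  exact chainEval_mem A x (h σ hσ)

theorem Carries.chain_mem (h : L.Carries T T') {c : Chain (A.pullback p) n}
    (hc : c ∈ chainsIn (A.pullback p) T n) : chain A L c ∈ chainsIn (A.pullback p') T' q :=
  Op.chain_mem A (fun σ hσ t ht => chainsIn_mono _ (h σ hσ t ht) q) hc

theorem cochainEval_eq_zero {b : FundamentalGroupoid B} {φ : Cochain (A.pullback p) n}
    {y : Term p b n →₀ R} (h : ∀ t ∈ y.support, φ t.1 = 0) : cochainEval A φ y = 0 := by
  rw [← Finsupp.sum_single y, Finsupp.sum, map_sum]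
  refine Finset.sum_eq_zero fun t ht => ?_
  rw [cochainEval_single, h t ht, map_zero, smul_zero]

theorem Carries.cochain_mem (h : L.Carries T T') {φ : Cochain (A.pullback p') q}
    (hφ : φ ∈ relCochains (A.pullback p') T' q) :
    cochain A L φ ∈ relCochains (A.pullback p) T n :=
  fun σ hσ => cochainEval_eq_zero A fun t ht => hφ _ (h σ hσ t ht)

end Carries

end Op

end Operators

/-! ### Ordered chains on a set of vertices -/

section OrderedChains

/-- Formal sums of `q`-tuples of points of `W`; the empty tuple is one of them. -/
abbrev OrdChain (R : Type*) [CommRing R] (W : Type*) (q : ℕ) := (Fin q → W) →₀ R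

namespace OrdChain

variable {R : Type*} [CommRing R] {W W' V V' : Type*} {q n : ℕ}

/-- The boundary of an ordered chain. -/
def bdry (q : ℕ) : OrdChain R W (q + 1) →ₗ[R] OrdChain R W q :=
  Finsupp.linearCombination R fun w =>
    ∑ i : Fin (q + 1), Finsupp.single (w ∘ i.succAbove) ((-1 : R) ^ (i : ℕ))

/-- The cone with apex `b`. -/
def cone (b : W) (q : ℕ) : OrdChain R W q →ₗ[R] OrdChain R W (q + 1) :=
  Finsupp.lmapDomain R R fun w => (Fin.cons b w : Fin (q + 1) → W)

/-- The chain map induced by a map of vertices. -/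
def map (g : W → W') (q : ℕ) : OrdChain R W q →ₗ[R] OrdChain R W' q :=
  Finsupp.lmapDomain R R fun w => g ∘ w

theorem bdry_single (w : Fin (q + 1) → W) :
    bdry q (Finsupp.single w (1 : R)) =
      ∑ i : Fin (q + 1), Finsupp.single (w ∘ i.succAbove) ((-1 : R) ^ (i : ℕ)) := by
  simp [bdry]

theorem cone_single (b : W) (w : Fin q → W) (a : R) :
    cone b q (Finsupp.single w a) = Finsupp.single (Fin.cons b w : Fin (q + 1) → W) a := by
  simp [cone, Finsupp.mapDomain_single]

theorem map_single (g : W → W') (w : Fin q → W) (a : R) :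
    map g q (Finsupp.single w a) = Finsupp.single (g ∘ w) a := by
  simp [map, Finsupp.mapDomain_single]

theorem hom_ext {M : Type*} [AddCommGroup M] [Module R M] {F G : OrdChain R W q →ₗ[R] M}
    (h : ∀ w, F (Finsupp.single w 1) = G (Finsupp.single w 1)) : F = G :=
  Finsupp.lhom_ext' fun w => LinearMap.ext_ring (h w)

theorem cons_comp_succAbove_succ (b : W) (w : Fin (q + 1) → W) (i : Fin (q + 1)) :
    (Fin.cons b w : Fin (q + 2) → W) ∘ i.succ.succAbove =
      (Fin.cons b (w ∘ i.succAbove) : Fin (q + 1) → W) := by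
  funext j
  refine Fin.cases ?_ (fun k => ?_) j
  · simp
  · simp [Fin.succ_succAbove_succ]

theorem bdry_cone (b : W) (y : OrdChain R W (q + 1)) :
    bdry (q + 1) (cone b (q + 1) y) = y - cone b q (bdry q y) := by
  suffices h : bdry (q + 1) ∘ₗ cone b (q + 1) = LinearMap.id - cone b q ∘ₗ bdry (R := R) q from
    LinearMap.congr_fun h y
  refine hom_ext fun w => ?_
  simp only [LinearMap.comp_apply, LinearMap.sub_apply, LinearMap.id_apply, cone_single,
    bdry_single, map_sum]
  rw [Fin.sum_univ_succ, sub_eq_add_neg, ← Finset.sum_neg_distrib]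
  congr 1
  · simp only [Fin.val_zero, pow_zero]
    congr 1
  · refine Finset.sum_congr rfl fun i _ => ?_
    rw [cons_comp_succAbove_succ, Fin.val_succ, pow_succ, mul_neg_one, Finsupp.single_neg]

theorem bdry_cone_zero (b : W) (y : OrdChain R W 0) : bdry 0 (cone b 0 y) = y := by
  suffices h : bdry 0 ∘ₗ cone b 0 = LinearMap.id (R := R) from LinearMap.congr_fun h y
  refine hom_ext fun w => ?_
  simp only [LinearMap.comp_apply, LinearMap.id_apply, cone_single, bdry_single]
  rw [Fin.sum_univ_succ, Fin.sum_univ_zero, add_zero, Fin.val_zero, pow_zero]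
  congr 1

theorem cone_tail (w : Fin (q + 1) → W) :
    (Finsupp.single w 1 : OrdChain R W (q + 1)) =
      cone (w 0) q (Finsupp.single (Fin.tail w) 1) := by
  rw [cone_single, Fin.cons_self_tail]

theorem bdry_bdry (y : OrdChain R W (q + 2)) : bdry q (bdry (q + 1) y) = 0 := by
  suffices h : bdry q ∘ₗ bdry (q + 1) = (0 : OrdChain R W (q + 2) →ₗ[R] _) from
    LinearMap.congr_fun h y
  clear y
  induction q with
  | zero =>
    refine hom_ext fun w => ?_
    rw [LinearMap.comp_apply, cone_tail, bdry_cone, map_sub, bdry_cone_zero, sub_self]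
    rfl
  | succ q ih =>
    refine hom_ext fun w => ?_
    have := LinearMap.congr_fun ih (Finsupp.single (Fin.tail w) 1)
    rw [LinearMap.comp_apply] at this
    rw [LinearMap.comp_apply, cone_tail, bdry_cone, map_sub, bdry_cone, this]
    simp

theorem map_bdry (g : W → W') (y : OrdChain R W (q + 1)) :
    map g q (bdry q y) = bdry q (map g (q + 1) y) := by
  suffices h : map g q ∘ₗ bdry q = bdry q ∘ₗ map (R := R) g (q + 1) from LinearMap.congr_fun h y
  refine hom_ext fun w => ?_
  simp only [LinearMap.comp_apply, map_single, bdry_single, map_sum]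
  rfl

theorem map_cone (g : W → W') (b : W) (y : OrdChain R W q) :
    map g (q + 1) (cone b q y) = cone (g b) q (map g q y) := by
  suffices h : map g (q + 1) ∘ₗ cone b q = cone (g b) q ∘ₗ map (R := R) g q from
    LinearMap.congr_fun h y
  refine hom_ext fun w => ?_
  simp only [LinearMap.comp_apply, map_single, cone_single]
  congr 1
  funext j
  refine Fin.cases ?_ (fun k => ?_) j <;> simp

theorem map_zero_eq (g g' : W → W') : map (R := R) g 0 = map g' 0 := by
  refine hom_ext fun w => ?_
  rw [map_single, map_single]
  congr 1
  exact Subsingleton.elim _ _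

/-- The homotopy between `F` and `G` obtained by iterated cones with apices `α`. -/
def coneHomotopy (F G : ∀ q, OrdChain R W q →ₗ[R] OrdChain R W' q)
    (α : ∀ q, (Fin (q + 1) → W) → W') : ∀ q, OrdChain R W q →ₗ[R] OrdChain R W' (q + 1)
  | 0 => 0
  | q + 1 => Finsupp.linearCombination R fun w => cone (α q w) (q + 1)
      (F (q + 1) (Finsupp.single w 1) - G (q + 1) (Finsupp.single w 1) -
        coneHomotopy F G α q (bdry q (Finsupp.single w 1)))

theorem coneHomotopy_single (F G : ∀ q, OrdChain R W q →ₗ[R] OrdChain R W' q)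
    (α : ∀ q, (Fin (q + 1) → W) → W') (w : Fin (q + 1) → W) :
    coneHomotopy F G α (q + 1) (Finsupp.single w 1) = cone (α q w) (q + 1)
      (F (q + 1) (Finsupp.single w 1) - G (q + 1) (Finsupp.single w 1) -
        coneHomotopy F G α q (bdry q (Finsupp.single w 1))) := by
  simp [coneHomotopy]

theorem bdry_coneHomotopy {F G : ∀ q, OrdChain R W q →ₗ[R] OrdChain R W' q}
    (hF : ∀ q y, bdry q (F (q + 1) y) = F q (bdry q y))
    (hG : ∀ q y, bdry q (G (q + 1) y) = G q (bdry q y)) (h0 : F 0 = G 0)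
    (α : ∀ q, (Fin (q + 1) → W) → W') (y : OrdChain R W (q + 1)) :
    bdry (q + 1) (coneHomotopy F G α (q + 1) y) =
      F (q + 1) y - G (q + 1) y - coneHomotopy F G α q (bdry q y) := by
  suffices h : bdry (q + 1) ∘ₗ coneHomotopy F G α (q + 1) =
      F (q + 1) - G (q + 1) - coneHomotopy F G α q ∘ₗ bdry q from LinearMap.congr_fun h y
  clear y
  induction q with
  | zero =>
    refine hom_ext fun w => ?_
    rw [LinearMap.comp_apply, coneHomotopy_single, bdry_cone]
    simp only [map_sub, hF, hG, h0]
    simp [coneHomotopy]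
  | succ q ih =>
    refine hom_ext fun w => ?_
    have := LinearMap.congr_fun ih (bdry (q + 1) (Finsupp.single w 1))
    simp only [LinearMap.comp_apply, LinearMap.sub_apply, bdry_bdry, map_zero, sub_zero] at this
    rw [LinearMap.comp_apply, coneHomotopy_single, bdry_cone]
    simp only [map_sub, hF, hG, this]
    simp

theorem map_coneHomotopy {F G : ∀ q, OrdChain R W q →ₗ[R] OrdChain R W' q}
    {F' G' : ∀ q, OrdChain R V q →ₗ[R] OrdChain R V' q} {α : ∀ q, (Fin (q + 1) → W) → W'}
    {α' : ∀ q, (Fin (q + 1) → V) → V'} {g : W → V} {g' : W' → V'}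
    (hF : ∀ q y, map g' q (F q y) = F' q (map g q y))
    (hG : ∀ q y, map g' q (G q y) = G' q (map g q y))
    (hα : ∀ q w, g' (α q w) = α' q (g ∘ w)) (y : OrdChain R W q) :
    map g' (q + 1) (coneHomotopy F G α q y) = coneHomotopy F' G' α' q (map g q y) := by
  suffices h : map g' (q + 1) ∘ₗ coneHomotopy F G α q = coneHomotopy F' G' α' q ∘ₗ map g q from
    LinearMap.congr_fun h y
  clear y
  induction q with
  | zero => simp [coneHomotopy]
  | succ q ih =>
    refine hom_ext fun w => ?_
    have := LinearMap.congr_fun ih (bdry q (Finsupp.single w 1))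
    simp only [LinearMap.comp_apply] at this
    rw [LinearMap.comp_apply, LinearMap.comp_apply, coneHomotopy_single, map_single,
      coneHomotopy_single, map_cone]
    simp only [map_sub, hF, hG, this, map_bdry, hα, map_single]

/-- Barycentric subdivision with respect to a choice `β` of barycentres. -/
def sd (β : ∀ q, (Fin (q + 1) → W) → W) : ∀ q, OrdChain R W q →ₗ[R] OrdChain R W q
  | 0 => LinearMap.id
  | q + 1 => Finsupp.linearCombination R fun w =>
      cone (β q w) q (sd β q (bdry q (Finsupp.single w 1)))

theorem sd_single (β : ∀ q, (Fin (q + 1) → W) → W) (w : Fin (q + 1) → W) :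
    sd (R := R) β (q + 1) (Finsupp.single w 1) =
      cone (β q w) q (sd β q (bdry q (Finsupp.single w 1))) := by
  simp [sd]

theorem bdry_sd (β : ∀ q, (Fin (q + 1) → W) → W) (y : OrdChain R W (q + 1)) :
    bdry q (sd β (q + 1) y) = sd β q (bdry q y) := by
  suffices h : bdry q ∘ₗ sd β (q + 1) = sd (R := R) β q ∘ₗ bdry q from LinearMap.congr_fun h y
  clear y
  induction q with
  | zero =>
    refine hom_ext fun w => ?_
    rw [LinearMap.comp_apply, sd_single, bdry_cone_zero, LinearMap.comp_apply]
  | succ q ih =>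
    refine hom_ext fun w => ?_
    have := LinearMap.congr_fun ih (bdry (q + 1) (Finsupp.single w 1))
    simp only [LinearMap.comp_apply, bdry_bdry, map_zero] at this
    rw [LinearMap.comp_apply, sd_single, bdry_cone, this, map_zero, sub_zero,
      LinearMap.comp_apply]

theorem map_sd {β : ∀ q, (Fin (q + 1) → W) → W} {β' : ∀ q, (Fin (q + 1) → W') → W'} {g : W → W'}
    (hβ : ∀ q w, g (β q w) = β' q (g ∘ w)) (y : OrdChain R W q) :
    map g q (sd β q y) = sd β' q (map g q y) := by
  suffices h : map g q ∘ₗ sd β q = sd (R := R) β' q ∘ₗ map g q from LinearMap.congr_fun h y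
  clear y
  induction q with
  | zero => rfl
  | succ q ih =>
    refine hom_ext fun w => ?_
    have := LinearMap.congr_fun ih (bdry q (Finsupp.single w 1))
    simp only [LinearMap.comp_apply] at this
    rw [LinearMap.comp_apply, LinearMap.comp_apply, sd_single, map_single, sd_single, map_cone,
      this, map_bdry, hβ, map_single]

/-- The homotopy from the identity to barycentric subdivision. -/
def sdHomotopy (β : ∀ q, (Fin (q + 1) → W) → W) (q : ℕ) :
    OrdChain R W q →ₗ[R] OrdChain R W (q + 1) :=
  coneHomotopy (fun _ => LinearMap.id) (sd β) β q

/-- The homotopy from the identity to the `k`-fold subdivision. -/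
def sdHomotopyIter (β : ∀ q, (Fin (q + 1) → W) → W) (k q : ℕ) :
    OrdChain R W q →ₗ[R] OrdChain R W (q + 1) :=
  ∑ i ∈ Finset.range k, sdHomotopy β q ∘ₗ sd β q ^ i

theorem bdry_sd_pow (β : ∀ q, (Fin (q + 1) → W) → W) (k : ℕ) (y : OrdChain R W (q + 1)) :
    bdry q ((sd β (q + 1) ^ k) y) = (sd β q ^ k) (bdry q y) := by
  induction k with
  | zero => simp
  | succ k ih => rw [pow_succ', pow_succ', Module.End.mul_apply, Module.End.mul_apply, bdry_sd, ih]

theorem map_sd_pow {β : ∀ q, (Fin (q + 1) → W) → W} {β' : ∀ q, (Fin (q + 1) → W') → W'}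
    {g : W → W'} (hβ : ∀ q w, g (β q w) = β' q (g ∘ w)) (k : ℕ) (y : OrdChain R W q) :
    map g q ((sd β q ^ k) y) = (sd β' q ^ k) (map g q y) := by
  induction k with
  | zero => simp
  | succ k ih =>
    rw [pow_succ', pow_succ', Module.End.mul_apply, Module.End.mul_apply, map_sd hβ, ih]

theorem bdry_sdHomotopy (β : ∀ q, (Fin (q + 1) → W) → W) (y : OrdChain R W (q + 1)) :
    bdry (q + 1) (sdHomotopy β (q + 1) y) =
      y - sd β (q + 1) y - sdHomotopy β q (bdry q y) :=
  bdry_coneHomotopy (F := fun _ => LinearMap.id) (G := sd β) (fun _ _ => rfl)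
    (fun _ y => bdry_sd β y) (by simp [sd]) β y

theorem map_sdHomotopy {β : ∀ q, (Fin (q + 1) → W) → W} {β' : ∀ q, (Fin (q + 1) → W') → W'}
    {g : W → W'} (hβ : ∀ q w, g (β q w) = β' q (g ∘ w)) (y : OrdChain R W q) :
    map g (q + 1) (sdHomotopy β q y) = sdHomotopy β' q (map g q y) :=
  map_coneHomotopy (F := fun _ => LinearMap.id) (G := sd β) (F' := fun _ => LinearMap.id)
    (G' := sd β') (fun _ _ => rfl) (fun _ y => map_sd hβ y) hβ y

theorem bdry_sdHomotopyIter (β : ∀ q, (Fin (q + 1) → W) → W) (k : ℕ) (y : OrdChain R W (q + 1)) :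
    bdry (q + 1) (sdHomotopyIter β k (q + 1) y) =
      y - (sd β (q + 1) ^ k) y - sdHomotopyIter β k q (bdry q y) := by
  induction k with
  | zero => simp [sdHomotopyIter]
  | succ k ih =>
    have h : ∀ (q : ℕ) (y : OrdChain R W q), sdHomotopyIter β (k + 1) q y =
        sdHomotopyIter β k q y + sdHomotopy β q ((sd β q ^ k) y) := fun q y => by
      rw [sdHomotopyIter, Finset.sum_range_succ]
      rfl
    rw [h, h, map_add, ih, bdry_sdHomotopy, bdry_sd_pow, pow_succ', Module.End.mul_apply]
    abel

theorem map_sdHomotopyIter {β : ∀ q, (Fin (q + 1) → W) → W} {β' : ∀ q, (Fin (q + 1) → W') → W'}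
    {g : W → W'} (hβ : ∀ q w, g (β q w) = β' q (g ∘ w)) (k : ℕ) (y : OrdChain R W q) :
    map g (q + 1) (sdHomotopyIter β k q y) = sdHomotopyIter β' k q (map g q y) := by
  simp only [sdHomotopyIter, LinearMap.sum_apply, map_sum, LinearMap.comp_apply,
    map_sdHomotopy hβ, map_sd_pow hβ]

theorem sdHomotopyIter_sub (β : ∀ q, (Fin (q + 1) → W) → W) {k l : ℕ} (h : k ≤ l)
    (y : OrdChain R W q) : sdHomotopyIter β l q y - sdHomotopyIter β k q y =
      ∑ i ∈ Finset.Ico k l, sdHomotopy β q ((sd β q ^ i) y) := by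
  simp only [sdHomotopyIter, LinearMap.sum_apply, LinearMap.comp_apply]
  exact (Finset.sum_Ico_eq_sub _ h).symm

/-- Chains all of whose tuples have their vertices in `C`. -/
def supportedIn (R : Type*) [CommRing R] (C : Set W) (q : ℕ) : Submodule R (OrdChain R W q) :=
  Finsupp.supported R R {w | ∀ i, w i ∈ C}

theorem linearMap_mem {F : OrdChain R W q →ₗ[R] OrdChain R W' n} {s : Set (Fin q → W)}
    {s' : Set (Fin n → W')} (h : ∀ w ∈ s, F (Finsupp.single w 1) ∈ Finsupp.supported R R s')
    {y : OrdChain R W q} (hy : y ∈ Finsupp.supported R R s) :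
    F y ∈ Finsupp.supported R R s' := by
  have : Finsupp.supported R R s ≤ (Finsupp.supported R R s').comap F := by
    rw [Finsupp.supported_eq_span_single, Submodule.span_le]
    rintro _ ⟨w, hw, rfl⟩
    exact h w hw
  exact this hy

theorem bdry_mem {C : Set W} {y : OrdChain R W (q + 1)} (hy : y ∈ supportedIn R C (q + 1)) :
    bdry q y ∈ supportedIn R C q := by
  refine linearMap_mem (fun w hw => ?_) hy
  rw [bdry_single]
  exact Submodule.sum_mem _ fun i _ => Finsupp.single_mem_supported R _ fun j => hw _

theorem cone_mem {C : Set W} {b : W} (hb : b ∈ C) {y : OrdChain R W q}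
    (hy : y ∈ supportedIn R C q) : cone b q y ∈ supportedIn R C (q + 1) := by
  refine linearMap_mem (fun w hw => ?_) hy
  rw [cone_single]
  refine Finsupp.single_mem_supported R _ fun j => ?_
  refine Fin.cases ?_ (fun k => ?_) j
  · simpa using hb
  · simpa using hw k

theorem coneHomotopy_mem {F G : ∀ q, OrdChain R W q →ₗ[R] OrdChain R W' q}
    {α : ∀ q, (Fin (q + 1) → W) → W'} {C : Set W} {C' : Set W'}
    (hF : ∀ q y, y ∈ supportedIn R C q → F q y ∈ supportedIn R C' q)
    (hG : ∀ q y, y ∈ supportedIn R C q → G q y ∈ supportedIn R C' q)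
    (hα : ∀ q w, (∀ i, w i ∈ C) → α q w ∈ C') {y : OrdChain R W q}
    (hy : y ∈ supportedIn R C q) : coneHomotopy F G α q y ∈ supportedIn R C' (q + 1) := by
  induction q with
  | zero => exact Submodule.zero_mem _
  | succ q ih =>
    refine linearMap_mem (fun w hw => ?_) hy
    have hw' : (Finsupp.single w 1 : OrdChain R W (q + 1)) ∈ supportedIn R C (q + 1) :=
      Finsupp.single_mem_supported R _ hw
    rw [coneHomotopy_single]
    exact cone_mem (hα q w hw) (Submodule.sub_mem _ (Submodule.sub_mem _ (hF _ _ hw')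
      (hG _ _ hw')) (ih (bdry_mem hw')))

theorem sd_mem {β : ∀ q, (Fin (q + 1) → W) → W} {C : Set W}
    (hβ : ∀ q w, (∀ i, w i ∈ C) → β q w ∈ C) {y : OrdChain R W q} (hy : y ∈ supportedIn R C q) :
    sd β q y ∈ supportedIn R C q := by
  induction q with
  | zero => exact hy
  | succ q ih =>
    refine linearMap_mem (fun w hw => ?_) hy
    rw [sd_single]
    exact cone_mem (hβ q w hw) (ih (bdry_mem (Finsupp.single_mem_supported R _ hw)))

theorem sdHomotopy_mem {β : ∀ q, (Fin (q + 1) → W) → W} {C : Set W}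
    (hβ : ∀ q w, (∀ i, w i ∈ C) → β q w ∈ C) {y : OrdChain R W q} (hy : y ∈ supportedIn R C q) :
    sdHomotopy β q y ∈ supportedIn R C (q + 1) :=
  coneHomotopy_mem (F := fun _ => LinearMap.id) (G := sd β) (fun _ _ h => h)
    (fun _ _ h => sd_mem hβ h) hβ hy

end OrdChain

end OrderedChains

/-! ### Affine simplices in convex models -/

section Models

/-- A contractible space with affine simplices spanned by arbitrary vertices. -/
class ConvexModel (W : Type*) [TopologicalSpace W] where
  contractible : ContractibleSpace W
  aff {q : ℕ} (w : Fin (q + 1) → W) : C(Simplex q, W)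
  aff_comp {q r : ℕ} (w : Fin (q + 1) → W) (g : Fin (r + 1) → Fin (q + 1)) :
    (aff w).comp (simplexMap g) = aff (w ∘ g)

attribute [instance] ConvexModel.contractible

open ConvexModel (aff aff_comp)

section Convex

variable {V : Type*} [AddCommGroup V] [Module ℝ V] [TopologicalSpace V] [IsTopologicalAddGroup V]
  [ContinuousSMul ℝ V] {K : Set V}

/-- The affine simplex in a convex set with given vertices. -/
def convexAff (hK : Convex ℝ K) {q : ℕ} (w : Fin (q + 1) → K) : C(Simplex q, K) where
  toFun x := ⟨∑ i, x i • (w i : V),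
    hK.sum_mem (fun i _ => x.2.1 i) x.2.2 fun i _ => (w i).2⟩
  continuous_toFun := by
    refine Continuous.subtype_mk (continuous_finsetSum _ fun i _ => ?_) _
    exact ((continuous_apply i).comp continuous_subtype_val).smul continuous_const

/-- A nonempty convex set is a model. -/
abbrev convexModel (hK : Convex ℝ K) (hne : K.Nonempty) : ConvexModel K where
  contractible := hK.contractibleSpace hne
  aff w := convexAff hK w
  aff_comp w g := by
    ext x
    simp only [convexAff, simplexMap, ContinuousMap.comp_apply, ContinuousMap.coe_mk,
      Function.comp_apply]
    change ∑ i, (stdSimplex.map g x).1 i • (w i : V) = ∑ i, x.1 i • (w (g i) : V)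
    rw [← Finset.sum_fiberwise Finset.univ g]
    refine Finset.sum_congr rfl fun j _ => ?_
    have h : (stdSimplex.map g x).1 j = ∑ i with g i = j, x.1 i :=
      FunOnFinite.linearMap_apply_apply ℝ ℝ g x.1 j
    rw [h, Finset.sum_smul]
    refine Finset.sum_congr rfl fun i hi => ?_
    rw [(Finset.mem_filter.1 hi).2]

end Convex

instance (n : ℕ) : ConvexModel (Simplex n) :=
  convexModel (convex_stdSimplex ℝ (Fin (n + 1))) ⟨_, (v₀ n).2⟩

instance : ConvexModel unitInterval := convexModel (convex_Icc 0 1) ⟨0, by simp⟩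

instance {W W' : Type*} [TopologicalSpace W] [TopologicalSpace W'] [ConvexModel W]
    [ConvexModel W'] : ConvexModel (W × W') where
  contractible := inferInstance
  aff w := (aff (Prod.fst ∘ w)).prodMk (aff (Prod.snd ∘ w))
  aff_comp w g := by
    ext1 x
    exact Prod.ext (DFunLike.congr_fun (aff_comp (Prod.fst ∘ w) g) x)
      (DFunLike.congr_fun (aff_comp (Prod.snd ∘ w) g) x)

/-- The vertices of the standard simplex. -/
abbrev vert (n : ℕ) : Fin (n + 1) → Simplex n := fun i => stdSimplex.vertex i

theorem aff_apply_simplex {q n : ℕ} (w : Fin (q + 1) → Simplex n) (x : Simplex q)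
    (j : Fin (n + 1)) : aff w x j = ∑ i, x i * w i j := by
  change (∑ i, x i • (w i : Fin (n + 1) → ℝ)) j = _
  simp

theorem aff_vert (n : ℕ) : aff (vert n) = ContinuousMap.id (Simplex n) := by
  ext x j
  change aff (vert n) x j = x j
  rw [aff_apply_simplex]
  simp [Pi.single_apply]

theorem simplexMap_vert {m n : ℕ} (g : Fin (m + 1) → Fin (n + 1)) :
    simplexMap g ∘ vert m = vert n ∘ g := by
  funext i
  exact stdSimplex.map_vertex g i

theorem aff_vert_comp {m n : ℕ} (g : Fin (m + 1) → Fin (n + 1)) :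
    aff (vert n ∘ g) = simplexMap g := by
  rw [← aff_comp, aff_vert, ContinuousMap.id_comp]

theorem simplexMap_aff {q m n : ℕ} (g : Fin (m + 1) → Fin (n + 1)) (w : Fin (q + 1) → Simplex m) :
    (simplexMap g).comp (aff w) = aff (simplexMap g ∘ w) := by
  ext1 x
  refine Subtype.ext ?_
  change FunOnFinite.linearMap ℝ ℝ g (∑ i, x i • (w i : Fin (m + 1) → ℝ)) =
    ∑ i, x i • FunOnFinite.linearMap ℝ ℝ g (w i : Fin (m + 1) → ℝ)
  simp only [map_sum, map_smul]

theorem aff_const (t : unitInterval) {q : ℕ} :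
    aff (fun _ : Fin (q + 1) => t) = ContinuousMap.const _ t := by
  ext x
  change ∑ i, x i • (t : ℝ) = t
  rw [← Finset.sum_smul, stdSimplex.sum_eq_one, one_smul]

end Models

/-! ### Operators defined by ordered chains in models -/

open ConvexModel (aff aff_comp)

section Terms

variable {B Z W W₁ : Type*} [TopologicalSpace B] [TopologicalSpace Z] [TopologicalSpace W]
  [TopologicalSpace W₁] [ContractibleSpace W] [ContractibleSpace W₁] {p : C(Z, B)} {q : ℕ}

/-- The term of a simplex `κ` in a model `W` with a map `Φ` to `Z`; its path class runs through
the model, after an initial class `γ₀` ending at the image of `w₀`. -/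
def Term.ofModel (Φ : C(W, Z)) {w₀ : W} {b : FundamentalGroupoid B}
    (γ₀ : b ⟶ (FundamentalGroupoid.map p).obj ⟨Φ w₀⟩) (κ : C(Simplex q, W)) : Term p b q :=
  ⟨Φ.comp κ, γ₀ ≫ (FundamentalGroupoid.map p).map (modelEdge Φ w₀ (κ (v₀ q)))⟩

theorem Term.ofModel_comp (Φ : C(W, Z)) {w₀ : W} {b : FundamentalGroupoid B}
    (γ₀ : b ⟶ (FundamentalGroupoid.map p).obj ⟨Φ w₀⟩) (G : C(W₁, W)) {w₁ : W₁}
    {b₁ : FundamentalGroupoid B} (γ₁ : b₁ ⟶ (FundamentalGroupoid.map p).obj ⟨(Φ.comp G) w₁⟩)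
    (γ : b ⟶ b₁)
    (h : γ ≫ γ₁ = γ₀ ≫ (FundamentalGroupoid.map p).map (modelEdge Φ w₀ (G w₁)))
    (κ : C(Simplex q, W₁)) :
    (Term.ofModel (Φ.comp G) γ₁ κ).shift γ = Term.ofModel Φ γ₀ (G.comp κ) := by
  refine Sigma.ext rfl (heq_of_eq ?_)
  change γ ≫ γ₁ ≫ (FundamentalGroupoid.map p).map (modelEdge (Φ.comp G) w₁ (κ (v₀ q))) =
    γ₀ ≫ (FundamentalGroupoid.map p).map (modelEdge Φ w₀ (G (κ (v₀ q))))
  rw [← Category.assoc, h, modelEdge_comp, Category.assoc]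
  erw [← Functor.map_comp]
  rw [modelEdge_trans]

end Terms

section ModelOperators

variable {R : Type*} [CommRing R] {B Z Z' W W₁ : Type*} [TopologicalSpace B]
  [TopologicalSpace Z] [TopologicalSpace Z'] [TopologicalSpace W] [TopologicalSpace W₁]
  {p : C(Z, B)} {p' : C(Z', B)} {n q : ℕ}

/-- The formal sum of terms of an ordered chain in a model. -/
def realize [ConvexModel W] (Φ : C(W, Z)) {w₀ : W} {b : FundamentalGroupoid B}
    (γ₀ : b ⟶ (FundamentalGroupoid.map p).obj ⟨Φ w₀⟩) (q : ℕ) :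
    OrdChain R W (q + 1) →ₗ[R] (Term p b q →₀ R) :=
  Finsupp.lmapDomain R R fun w => Term.ofModel Φ γ₀ (aff w)

theorem realize_single [ConvexModel W] (Φ : C(W, Z)) {w₀ : W} {b : FundamentalGroupoid B}
    (γ₀ : b ⟶ (FundamentalGroupoid.map p).obj ⟨Φ w₀⟩) (w : Fin (q + 1) → W) (a : R) :
    realize Φ γ₀ q (Finsupp.single w a) = Finsupp.single (Term.ofModel Φ γ₀ (aff w)) a := by
  simp [realize, Finsupp.mapDomain_single]

theorem extend_bd_realize [ConvexModel W] (Φ : C(W, Z)) {w₀ : W} {b : FundamentalGroupoid B}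
    (γ₀ : b ⟶ (FundamentalGroupoid.map p).obj ⟨Φ w₀⟩) (y : OrdChain R W (q + 2)) :
    Op.extend b (Op.bd p q) (realize Φ γ₀ (q + 1) y) =
      realize Φ γ₀ q (OrdChain.bdry (q + 1) y) := by
  suffices h : Op.extend b (Op.bd p q) ∘ₗ realize Φ γ₀ (q + 1) =
      realize (R := R) Φ γ₀ q ∘ₗ OrdChain.bdry (q + 1) from LinearMap.congr_fun h y
  refine OrdChain.hom_ext fun w => ?_
  rw [LinearMap.comp_apply, LinearMap.comp_apply, realize_single, OrdChain.bdry_single,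
    Op.extend_single, one_smul, Op.bd, Finsupp.mapDomain_finsetSum, map_sum]
  refine Finset.sum_congr rfl fun i _ => ?_
  rw [Finsupp.mapDomain_single, realize_single, ← aff_comp]
  congr 1
  have := Term.ofModel_comp (p := p) Φ γ₀ (aff w)
    (w₁ := v₀ (q + 1)) (𝟙 _) (Term.ofModel (p := p) Φ γ₀ (aff w)).2 (by simp [Term.ofModel])
    (face i)
  rw [← this]
  simp only [Term.ofModel, Category.id_comp]
  rfl

theorem mapDomain_shift_realize [ConvexModel W] [ConvexModel W₁] (Φ : C(W, Z)) {w₀ : W}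
    {b : FundamentalGroupoid B} (γ₀ : b ⟶ (FundamentalGroupoid.map p).obj ⟨Φ w₀⟩) (G : C(W₁, W))
    (hG : ∀ w : Fin (q + 1) → W₁, G.comp (aff w) = aff (G ∘ w)) {w₁ : W₁}
    {b₁ : FundamentalGroupoid B} (γ₁ : b₁ ⟶ (FundamentalGroupoid.map p).obj ⟨(Φ.comp G) w₁⟩)
    (γ : b ⟶ b₁)
    (h : γ ≫ γ₁ = γ₀ ≫ (FundamentalGroupoid.map p).map (modelEdge Φ w₀ (G w₁)))
    (y : OrdChain R W₁ (q + 1)) :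
    Finsupp.mapDomain (Term.shift γ) (realize (Φ.comp G) γ₁ q y) =
      realize Φ γ₀ q (OrdChain.map G (q + 1) y) := by
  suffices h : Finsupp.lmapDomain R R (Term.shift γ) ∘ₗ realize (Φ.comp G) γ₁ q =
      realize (R := R) Φ γ₀ q ∘ₗ OrdChain.map G (q + 1) from LinearMap.congr_fun h y
  refine OrdChain.hom_ext fun w => ?_
  rw [LinearMap.comp_apply, LinearMap.comp_apply, realize_single, OrdChain.map_single,
    realize_single, Finsupp.lmapDomain_apply, Finsupp.mapDomain_single,
    Term.ofModel_comp Φ γ₀ G γ₁ γ h, hG]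

namespace Op

/-- The operator that replaces a singular simplex by subdivided pieces of it. -/
def localOp (p : C(Z, B)) (u : C(Simplex n, Z) → OrdChain R (Simplex n) (q + 1)) : Op R p p n q :=
  fun σ => realize σ (w₀ := v₀ n) (𝟙 _) q (u σ)

theorem one_eq_localOp :
    (one p n : Op R p p n n) = localOp p fun _ => Finsupp.single (vert n) 1 := by
  funext σ
  rw [localOp, realize_single, aff_vert, one]
  congr 1
  refine Sigma.ext (by rfl) (heq_of_eq ?_)
  change 𝟙 _ = 𝟙 _ ≫ (FundamentalGroupoid.map p).map (modelEdge σ (v₀ n) (v₀ n))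
  rw [modelEdge_self]
  exact ((Category.id_comp _).trans ((FundamentalGroupoid.map p).map_id _)).symm

theorem bd_comp_localOp (u : C(Simplex n, Z) → OrdChain R (Simplex n) (q + 2)) :
    (bd p q).comp (localOp p u) = localOp p fun σ => OrdChain.bdry (q + 1) (u σ) :=
  funext fun _ => extend_bd_realize _ _ _

theorem localOp_comp_bd (u : C(Simplex n, Z) → OrdChain R (Simplex n) (q + 1)) :
    (localOp p u).comp (bd p n) = localOp p fun σ =>
      ∑ i : Fin (n + 2), (-1 : R) ^ (i : ℕ) •
        OrdChain.map (face i) (q + 1) (u (σ.comp (face i))) := by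
  funext σ
  simp only [comp, bd, localOp, map_sum, map_smul]
  refine Finset.sum_congr rfl fun i _ => ?_
  rw [extend_single]
  congr 1
  refine mapDomain_shift_realize σ (𝟙 _) (face i) (fun w => simplexMap_aff _ w) (𝟙 _) _ ?_ _
  exact (Category.comp_id _).trans (Category.id_comp _).symm

theorem localOp_sub (u u' : C(Simplex n, Z) → OrdChain R (Simplex n) (q + 1)) :
    localOp p u - localOp p u' = localOp p fun σ => u σ - u' σ :=
  funext fun _ => (map_sub _ _ _).symm

theorem bd_eq_localOp : (bd p n : Op R p p (n + 1) n) =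
    localOp p fun _ => OrdChain.bdry (n + 1) (Finsupp.single (vert (n + 1)) 1) := by
  rw [← bd_comp_localOp (p := p) (fun _ => Finsupp.single (vert (n + 1)) 1), ← one_eq_localOp,
    comp_one]

theorem bd_comp_bd : (bd p n).comp (bd p (n + 1)) = (0 : Op R p p (n + 2) n) := by
  rw [bd_eq_localOp (n := n + 1), bd_comp_localOp]
  funext σ
  simp [OrdChain.bdry_bdry, localOp]

theorem exists_of_mem_support_localOp {u : C(Simplex n, Z) → OrdChain R (Simplex n) (q + 1)}
    {σ : C(Simplex n, Z)} {t : Term p (basePt p σ) q} (ht : t ∈ (localOp p u σ).support) :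
    ∃ w ∈ (u σ).support, t.1 = σ.comp (aff w) := by
  classical
  obtain ⟨w, hw, rfl⟩ := Finset.mem_image.1 (Finsupp.mapDomain_support ht)
  exact ⟨w, hw, rfl⟩

theorem carries_localOp (u : C(Simplex n, Z) → OrdChain R (Simplex n) (q + 1)) (T : Set Z) :
    (localOp p u).Carries T T := by
  intro σ hσ t ht
  obtain ⟨w, -, h⟩ := exists_of_mem_support_localOp ht
  rw [h]
  exact (range_comp_subset σ _).trans hσ

/-- The operator `∂K + K∂`. -/
def homotopyBd (K : ∀ n, Op R p p' n (n + 1)) : ∀ n, Op R p p' n n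
  | 0 => (bd p' 0).comp (K 0)
  | n + 1 => (bd p' (n + 1)).comp (K (n + 1)) + (K n).comp (bd p n)

/-- The operator that the homotopy `K` connects to the identity. -/
def deformation (K : ∀ n, Op R p p n (n + 1)) (n : ℕ) : Op R p p n n :=
  one p n - homotopyBd K n

/-- The inclusion of `W` in `W × [0, 1]` at height `t`. -/
def atHeight (W : Type*) [TopologicalSpace W] (t : unitInterval) : C(W, W × unitInterval) :=
  (ContinuousMap.id W).prodMk (ContinuousMap.const W t)

/-- The ordered chain of the prism. -/
def prismChain (R : Type*) [CommRing R] (W : Type*) [TopologicalSpace W] (q : ℕ) :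
    OrdChain R W q →ₗ[R] OrdChain R (W × unitInterval) (q + 1) :=
  OrdChain.coneHomotopy (OrdChain.map (atHeight W 1)) (OrdChain.map (atHeight W 0))
    (fun _ w => atHeight W 0 (w 0)) q

theorem bdry_prismChain (y : OrdChain R W (q + 1)) :
    OrdChain.bdry (q + 1) (prismChain R W (q + 1) y) = OrdChain.map (atHeight W 1) (q + 1) y -
      OrdChain.map (atHeight W 0) (q + 1) y - prismChain R W q (OrdChain.bdry q y) :=
  OrdChain.bdry_coneHomotopy (fun _ y => (OrdChain.map_bdry _ y).symm)
    (fun _ y => (OrdChain.map_bdry _ y).symm) (OrdChain.map_zero_eq _ _) _ y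

theorem map_prismChain (g : C(W, W₁)) (y : OrdChain R W q) :
    OrdChain.map (g.prodMap (ContinuousMap.id unitInterval)) (q + 1) (prismChain R W q y) =
      prismChain R W₁ q (OrdChain.map g q y) := by
  refine OrdChain.map_coneHomotopy ?_ ?_ (fun _ _ => rfl) y <;>
  · intro q y
    simp only [OrdChain.map, Finsupp.lmapDomain_apply, ← Finsupp.mapDomain_comp]
    rfl

theorem aff_atHeight_comp_vert (t : unitInterval) :
    aff (atHeight (Simplex n) t ∘ vert n) = atHeight (Simplex n) t :=
  ContinuousMap.ext fun x =>
    Prod.ext (DFunLike.congr_fun (aff_vert n) x) (DFunLike.congr_fun (aff_const t) x)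

theorem prodMap_aff {m : ℕ} (g : Fin (m + 1) → Fin (n + 1))
    (w : Fin (q + 1) → Simplex m × unitInterval) :
    ((simplexMap g).prodMap (ContinuousMap.id unitInterval)).comp (aff w) =
      aff ((simplexMap g).prodMap (ContinuousMap.id unitInterval) ∘ w) :=
  ContinuousMap.ext fun x =>
    Prod.ext (DFunLike.congr_fun (simplexMap_aff g (Prod.fst ∘ w)) x) rfl

section Prism

variable (Φ : C(Z × unitInterval, Z')) (hΦ : ∀ z t, p' (Φ (z, t)) = p z)

/-- The restriction of a homotopy to the prism over a singular simplex. -/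
abbrev prismMap (σ : C(Simplex n, Z)) : C(Simplex n × unitInterval, Z') :=
  Φ.comp (σ.prodMap (ContinuousMap.id unitInterval))

/-- The identity class at the image in the base of the initial vertex of the bottom of a prism. -/
def prismStart (σ : C(Simplex n, Z)) :
    basePt p σ ⟶ (FundamentalGroupoid.map p').obj ⟨prismMap Φ σ (v₀ n, 0)⟩ :=
  overHom (hΦ (σ (v₀ n)) 0)

/-- The prism operator of a homotopy `Φ` over `B`. -/
def prism (n : ℕ) : Op R p p' n (n + 1) := fun σ =>
  realize (prismMap Φ σ) (w₀ := (v₀ n, 0)) (prismStart Φ hΦ σ) (n + 1)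
    (prismChain R (Simplex n) (n + 1) (Finsupp.single (vert n) 1))

theorem prismStart_comp_map_modelEdge (σ : C(Simplex n, Z)) (x : Simplex n) (t : unitInterval) :
    prismStart Φ hΦ σ ≫ (FundamentalGroupoid.map p').map
        (modelEdge (prismMap Φ σ) (v₀ n, 0) (x, t)) =
      (FundamentalGroupoid.map p).map (edge σ (v₀ n) x) ≫ overHom (hΦ (σ x) t) := by
  have h : p'.comp (prismMap Φ σ) = (p.comp σ).comp ContinuousMap.fst :=
    ContinuousMap.ext fun z => hΦ _ _
  have hedge : (FundamentalGroupoid.map p').map (modelEdge (prismMap Φ σ) (v₀ n, 0) (x, t)) =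
      overHom (hΦ (σ (v₀ n)) 0).symm ≫ (FundamentalGroupoid.map p).map (edge σ (v₀ n) x) ≫
        overHom (hΦ (σ x) t) := by
    change modelEdge (p'.comp (prismMap Φ σ)) _ _ = _
    rw [modelEdge_congr h, modelEdge_comp]
    rfl
  exact (congrArg (prismStart Φ hΦ σ ≫ ·) hedge).trans (overHom_comp_overHom_symm_assoc _ _)

theorem realize_map_atHeight {t : unitInterval} {g : C(Z, Z')} (h : ∀ z, Φ (z, t) = g z)
    (hg : ∀ z, p' (g z) = p z) (σ : C(Simplex n, Z)) :
    realize (prismMap Φ σ) (w₀ := (v₀ n, 0)) (prismStart Φ hΦ σ) n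
      (OrdChain.map (atHeight (Simplex n) t) (n + 1) (Finsupp.single (vert n) 1)) =
      push (R := R) g hg n σ := by
  rw [OrdChain.map_single, realize_single, push, aff_atHeight_comp_vert]
  congr 1
  refine Term.ext_of_eq (ContinuousMap.ext fun x => h (σ x)) ?_
  have hself : (FundamentalGroupoid.map p).map (edge σ (v₀ n) (v₀ n)) = 𝟙 _ :=
    (congrArg _ (edge_self σ _)).trans ((FundamentalGroupoid.map p).map_id _)
  change (prismStart Φ hΦ σ ≫ (FundamentalGroupoid.map p').map
    (modelEdge (prismMap Φ σ) (v₀ n, 0) (v₀ n, t))) ≫ eqToHom _ = _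
  rw [prismStart_comp_map_modelEdge, hself, Category.id_comp]
  exact eqToHom_trans _ _

theorem prism_comp_bd (σ : C(Simplex (n + 1), Z)) :
    (prism Φ hΦ n).comp (bd p n) σ =
      realize (prismMap Φ σ) (w₀ := (v₀ (n + 1), 0)) (prismStart Φ hΦ σ) (n + 1)
        (prismChain R (Simplex (n + 1)) (n + 1)
          (OrdChain.bdry (n + 1) (Finsupp.single (vert (n + 1)) 1))) := by
  rw [OrdChain.bdry_single, map_sum, map_sum, comp, bd, map_sum]
  refine Finset.sum_congr rfl fun i _ => ?_
  rw [extend_single, ← mul_one ((-1 : R) ^ (i : ℕ)), ← smul_eq_mul, ← Finsupp.smul_single,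
    map_smul, map_smul, smul_eq_mul, mul_one, ← simplexMap_vert, ← OrdChain.map_single]
  congr 1
  rw [← map_prismChain]
  refine mapDomain_shift_realize (prismMap Φ σ) _
    ((face i).prodMap (ContinuousMap.id unitInterval)) (prodMap_aff _) _ _ ?_ _
  exact (prismStart_comp_map_modelEdge Φ hΦ σ _ _).symm

theorem homotopyBd_prism {g₀ g₁ : C(Z, Z')} (h₀ : ∀ z, Φ (z, 0) = g₀ z)
    (h₁ : ∀ z, Φ (z, 1) = g₁ z) (hg₀ : ∀ z, p' (g₀ z) = p z) (hg₁ : ∀ z, p' (g₁ z) = p z) :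
    homotopyBd (prism (R := R) Φ hΦ) n = push g₁ hg₁ n - push g₀ hg₀ n := by
  funext σ
  cases n with
  | zero =>
    rw [homotopyBd, comp, prism, extend_bd_realize, bdry_prismChain, map_sub, map_sub,
      realize_map_atHeight Φ hΦ h₁ hg₁, realize_map_atHeight Φ hΦ h₀ hg₀]
    simp [prismChain, OrdChain.coneHomotopy]
  | succ n =>
    rw [homotopyBd, Pi.add_apply, comp, prism, extend_bd_realize, bdry_prismChain, map_sub,
      map_sub, realize_map_atHeight Φ hΦ h₁ hg₁, realize_map_atHeight Φ hΦ h₀ hg₀,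
      ← prism_comp_bd, sub_add_cancel, Pi.sub_apply]

theorem carries_prism {T : Set Z} {T' : Set Z'} (h : ∀ z ∈ T, ∀ t, Φ (z, t) ∈ T') :
    (prism (R := R) Φ hΦ n).Carries T T' := by
  classical
  intro σ hσ t ht
  obtain ⟨w, -, rfl⟩ := Finset.mem_image.1 (Finsupp.mapDomain_support ht)
  rintro _ ⟨x, rfl⟩
  exact h _ (hσ ⟨_, rfl⟩) _

end Prism

end Op

end ModelOperators

/-! ### Small simplices -/

section Subdivision

open ConvexModel (aff aff_comp)

variable {R : Type*} [CommRing R] {B Z : Type*} [TopologicalSpace B] [TopologicalSpace Z]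
  {p : C(Z, B)} {n q : ℕ}

/-- The barycentre of an affine simplex in the standard simplex. -/
def bary (n q : ℕ) (w : Fin (q + 1) → Simplex n) : Simplex n := aff w stdSimplex.barycenter

theorem simplexMap_bary {m n : ℕ} (g : Fin (m + 1) → Fin (n + 1)) (q : ℕ)
    (w : Fin (q + 1) → Simplex m) : simplexMap g (bary m q w) = bary n q (simplexMap g ∘ w) :=
  DFunLike.congr_fun (simplexMap_aff g w) _

theorem aff_mem_closedBall {w : Fin (q + 1) → Simplex n} {c : Simplex n} {D : ℝ}
    (h : ∀ i, w i ∈ Metric.closedBall c D) (x : Simplex q) : aff w x ∈ Metric.closedBall c D := by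
  have := (convex_closedBall (c : Fin (n + 1) → ℝ) D).sum_mem (t := Finset.univ)
    (w := fun i => x i) (z := fun i => (w i : Fin (n + 1) → ℝ)) (fun i _ => x.2.1 i) x.2.2
    (fun i _ => h i)
  exact this

theorem dist_bary_le {w : Fin (q + 1) → Simplex n} {D : ℝ} (h : ∀ i j, dist (w i) (w j) ≤ D)
    (i : Fin (q + 1)) : dist (w i) (bary n q w) ≤ q / (q + 1) * D := by
  have hq : (0 : ℝ) < q + 1 := by positivity
  have h1 : (bary n q w).1 = ∑ j, ((q : ℝ) + 1)⁻¹ • (w j).1 := by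
    change ∑ j, (stdSimplex.barycenter : Simplex q).1 j • (w j).1 = _
    simp [stdSimplex.barycenter_apply]
  have h2 : (w i).1 = ∑ _j : Fin (q + 1), ((q : ℝ) + 1)⁻¹ • (w i).1 := by
    rw [Finset.sum_const, Finset.card_univ, Fintype.card_fin, ← Nat.cast_smul_eq_nsmul ℝ,
      smul_smul, Nat.cast_add_one, mul_inv_cancel₀ hq.ne', one_smul]
  rw [Subtype.dist_eq, h1, h2, dist_eq_norm, ← Finset.sum_sub_distrib]
  rw [Fin.sum_univ_succAbove _ i, sub_self, zero_add]
  refine (norm_sum_le _ _).trans ?_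
  have h3 : ∀ j : Fin q, ‖((q : ℝ) + 1)⁻¹ • (w i).1 - ((q : ℝ) + 1)⁻¹ • (w (i.succAbove j)).1‖ ≤
      ((q : ℝ) + 1)⁻¹ * D := fun j => by
    rw [← smul_sub, norm_smul, Real.norm_of_nonneg (inv_nonneg.2 hq.le), ← dist_eq_norm]
    exact mul_le_mul_of_nonneg_left (h _ _) (inv_nonneg.2 hq.le)
  refine (Finset.sum_le_sum fun j _ => h3 j).trans (le_of_eq ?_)
  simp
  ring

/-- Tuples of diameter at most `D`. -/
def diamLE (n q : ℕ) (D : ℝ) : Set (Fin q → Simplex n) := {w | ∀ i j, dist (w i) (w j) ≤ D}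

theorem bary_mem_closedBall {c : Simplex n} {D : ℝ} (q : ℕ) (w : Fin (q + 1) → Simplex n)
    (h : ∀ i, w i ∈ Metric.closedBall c D) : bary n q w ∈ Metric.closedBall c D :=
  aff_mem_closedBall h _

theorem cons_mem_diamLE {b : Simplex n} {v : Fin q → Simplex n} {D : ℝ} (hD : 0 ≤ D)
    (hv : v ∈ diamLE n q D) (hb : ∀ i, v i ∈ Metric.closedBall b D) :
    (Fin.cons b v : Fin (q + 1) → Simplex n) ∈ diamLE n (q + 1) D := by
  intro i j
  refine Fin.cases ?_ (fun i => ?_) i <;> refine Fin.cases ?_ (fun j => ?_) j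
  · simpa using hD
  · simpa [dist_comm] using hb j
  · simpa using hb i
  · simpa using hv i j

theorem sd_mem_diamLE {D : ℝ} {w : Fin (q + 1) → Simplex n} (hw : w ∈ diamLE n (q + 1) D) :
    OrdChain.sd (bary n) (q + 1) (Finsupp.single w (1 : R)) ∈
      Finsupp.supported R R (diamLE n (q + 1) (q / (q + 1) * D)) := by
  induction q with
  | zero =>
    intro v _ i j
    rw [Subsingleton.elim (α := Fin 1) i j, dist_self]
    simp
  | succ q ih =>
    have hD : 0 ≤ D := dist_nonneg.trans (hw 0 0)
    rw [OrdChain.sd_single]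
    set b := bary n (q + 1) w
    set y := OrdChain.sd (bary n) (q + 1) (OrdChain.bdry (q + 1) (Finsupp.single w (1 : R)))
    set D' : ℝ := (q + 1 : ℕ) / ((q + 1 : ℕ) + 1) * D
    have hD' : 0 ≤ D' := by positivity
    have hle : (q : ℝ) / (q + 1) * D ≤ D' := by
      refine mul_le_mul_of_nonneg_right ?_ hD
      rw [div_le_div_iff₀ (by positivity) (by positivity)]
      push_cast
      nlinarith
    have hy' : y ∈ Finsupp.supported R R (diamLE n (q + 1) (q / (q + 1) * D)) := by
      simp only [y, OrdChain.bdry_single, map_sum]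
      refine Submodule.sum_mem _ fun i _ => ?_
      rw [← Finsupp.smul_single_one, map_smul]
      exact Submodule.smul_mem _ _ (ih fun j k => hw _ _)
    have hdiam : y ∈ Finsupp.supported R R (diamLE n (q + 1) D') :=
      Finsupp.supported_mono (fun v (hv : v ∈ diamLE _ _ _) i j => (hv i j).trans hle) hy'
    have hball : y ∈ OrdChain.supportedIn R (Metric.closedBall b D') (q + 1) :=
      OrdChain.sd_mem bary_mem_closedBall (OrdChain.bdry_mem
        (Finsupp.single_mem_supported R _ fun i => dist_bary_le hw i))
    have hy := Submodule.mem_inf.2 ⟨hdiam, hball⟩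
    rw [OrdChain.supportedIn, ← Finsupp.supported_inter] at hy
    refine OrdChain.linearMap_mem (fun v hv => ?_) hy
    rw [OrdChain.cone_single]
    exact Finsupp.single_mem_supported R _ (cons_mem_diamLE hD' hv.1 hv.2)

theorem sd_pow_mem_diamLE {D : ℝ} {y : OrdChain R (Simplex n) (q + 1)}
    (hy : y ∈ Finsupp.supported R R (diamLE n (q + 1) D)) (k : ℕ) :
    (OrdChain.sd (bary n) (q + 1) ^ k) y ∈
      Finsupp.supported R R (diamLE n (q + 1) ((q / (q + 1)) ^ k * D)) := by
  induction k with
  | zero => simpa using hy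
  | succ k ih =>
    rw [pow_succ' (OrdChain.sd (bary n) (q + 1)), Module.End.mul_apply, pow_succ', mul_assoc]
    exact OrdChain.linearMap_mem (fun w hw => sd_mem_diamLE hw) ih

theorem sdHomotopy_mem_diamLE {D : ℝ} {y : OrdChain R (Simplex n) q}
    (hy : y ∈ Finsupp.supported R R (diamLE n q D)) :
    OrdChain.sdHomotopy (bary n) q y ∈ Finsupp.supported R R (diamLE n (q + 1) D) := by
  refine OrdChain.linearMap_mem (fun w hw => ?_) hy
  have key : ∀ c : Simplex n, (∀ k, w k ∈ Metric.closedBall c D) →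
      OrdChain.sdHomotopy (bary n) q (Finsupp.single w (1 : R)) ∈
        OrdChain.supportedIn R (Metric.closedBall c D) (q + 1) := fun c hc =>
    OrdChain.sdHomotopy_mem bary_mem_closedBall (Finsupp.single_mem_supported R _ hc)
  intro v hv i j
  rw [dist_comm]
  refine key (v i) (fun k => ?_) hv j
  rw [Metric.mem_closedBall_comm]
  exact key (w k) (fun l => hw l k) hv i

variable {ι : Type*} {U : ι → Set Z}

/-- The simplex lies in one of the members of the cover `U`. -/
def IsSmall (U : ι → Set Z) {q : ℕ} (σ : C(Simplex q, Z)) : Prop := ∃ j, Set.range σ ⊆ U j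

/-- Tuples spanning an affine simplex with small image under `σ`. -/
def smallTuples (U : ι → Set Z) (σ : C(Simplex n, Z)) (q : ℕ) : Set (Fin (q + 1) → Simplex n) :=
  {w | IsSmall U (σ.comp (aff w))}

theorem exists_diamLE_subset_smallTuples (hU : ∀ j, IsOpen (U j)) (hcov : ⋃ j, U j = Set.univ)
    (σ : C(Simplex n, Z)) : ∃ δ > 0, ∀ D < δ, ∀ q, diamLE n (q + 1) D ⊆ smallTuples U σ q := by
  have : CompactSpace (Simplex n) := isCompact_iff_compactSpace.1 (isCompact_stdSimplex ℝ _)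
  obtain ⟨δ, hδ, h⟩ := lebesgue_number_lemma_of_metric (isCompact_univ (X := Simplex n))
    (c := fun j => σ ⁻¹' U j) (fun j => (hU j).preimage σ.continuous)
    (fun x _ => by
      have : σ x ∈ ⋃ j, U j := hcov ▸ Set.mem_univ _
      simpa using this)
  refine ⟨δ, hδ, fun D hD q w hw => ?_⟩
  obtain ⟨j, hj⟩ := h (w 0) (Set.mem_univ _)
  refine ⟨j, ?_⟩
  rintro _ ⟨x, rfl⟩
  exact hj ((Metric.closedBall_subset_ball hD) (aff_mem_closedBall (fun i => hw i 0) x))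

theorem exists_sd_pow_small (R : Type*) [CommRing R] (hU : ∀ j, IsOpen (U j))
    (hcov : ⋃ j, U j = Set.univ) (σ : C(Simplex n, Z)) :
    ∃ m : ℕ, ∀ k ≥ m,
      (OrdChain.sd (bary n) (n + 1) ^ k) (Finsupp.single (vert n) 1) ∈
        Finsupp.supported R R (smallTuples U σ n) ∧
      OrdChain.sdHomotopy (bary n) (n + 1)
          ((OrdChain.sd (bary n) (n + 1) ^ k) (Finsupp.single (vert n) 1)) ∈
        Finsupp.supported R R (smallTuples U σ (n + 1)) := by
  obtain ⟨δ, hδ, h⟩ := exists_diamLE_subset_smallTuples hU hcov σ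
  have hlim : Filter.Tendsto (fun k : ℕ => ((n : ℝ) / (n + 1)) ^ k *
      Metric.diam (Set.univ : Set (Simplex n))) Filter.atTop (nhds 0) := by
    have := (tendsto_pow_atTop_nhds_zero_of_lt_one (r := (n : ℝ) / (n + 1)) (by positivity)
      ((div_lt_one (by positivity)).2 (by linarith))).mul_const
      (Metric.diam (Set.univ : Set (Simplex n)))
    simpa using this
  obtain ⟨m, hm⟩ := Filter.eventually_atTop.1 (hlim.eventually_lt_const hδ)
  refine ⟨m, fun k hk => ?_⟩
  have : CompactSpace (Simplex n) := isCompact_iff_compactSpace.1 (isCompact_stdSimplex ℝ _)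
  have h1 := sd_pow_mem_diamLE (R := R) (D := Metric.diam (Set.univ : Set (Simplex n)))
    (Finsupp.single_mem_supported R (1 : R) (s := diamLE n (n + 1) _) (a := vert n)
      fun i j => Metric.dist_le_diam_of_mem isCompact_univ.isBounded (Set.mem_univ _)
        (Set.mem_univ _)) k
  exact ⟨Finsupp.supported_mono (h _ (hm k hk) _) h1,
    Finsupp.supported_mono (h _ (hm k hk) _) (sdHomotopy_mem_diamLE h1)⟩

/-- A number of subdivisions after which `σ` has become small. -/
def sdNumber (R : Type*) [CommRing R] (hU : ∀ j, IsOpen (U j)) (hcov : ⋃ j, U j = Set.univ)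
    (σ : C(Simplex n, Z)) : ℕ := (exists_sd_pow_small R hU hcov σ).choose

/-- A number of subdivisions after which `σ` and all its faces have become small. -/
def sdNumberFaces (R : Type*) [CommRing R] (hU : ∀ j, IsOpen (U j)) (hcov : ⋃ j, U j = Set.univ)
    (σ : C(Simplex n, Z)) : ℕ :=
  (Finset.range (n + 1)).sup fun k => Finset.univ.sup fun g : Fin (k + 1) → Fin (n + 1) =>
    sdNumber R hU hcov (σ.comp (simplexMap g))

theorem sdNumber_comp_le (hU : ∀ j, IsOpen (U j)) (hcov : ⋃ j, U j = Set.univ)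
    (σ : C(Simplex n, Z)) {k : ℕ} (hk : k ≤ n) (g : Fin (k + 1) → Fin (n + 1)) :
    sdNumber R hU hcov (σ.comp (simplexMap g)) ≤ sdNumberFaces R hU hcov σ :=
  (Finset.le_sup (f := fun g : Fin (k + 1) → Fin (n + 1) =>
    sdNumber R hU hcov (σ.comp (simplexMap g))) (Finset.mem_univ g)).trans
    (Finset.le_sup (f := fun k => Finset.univ.sup fun g : Fin (k + 1) → Fin (n + 1) =>
      sdNumber R hU hcov (σ.comp (simplexMap g))) (Finset.mem_range_succ_iff.2 hk))

theorem sdNumber_le (hU : ∀ j, IsOpen (U j)) (hcov : ⋃ j, U j = Set.univ) (σ : C(Simplex n, Z)) :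
    sdNumber R hU hcov σ ≤ sdNumberFaces R hU hcov σ := by
  have hid : σ.comp (simplexMap id) = σ := by
    rw [← aff_vert_comp, Function.comp_id, aff_vert, ContinuousMap.comp_id]
  have hle := sdNumber_comp_le (R := R) hU hcov σ le_rfl id
  rwa [hid] at hle

theorem sdNumberFaces_face_le (hU : ∀ j, IsOpen (U j)) (hcov : ⋃ j, U j = Set.univ)
    (σ : C(Simplex (n + 1), Z)) (i : Fin (n + 2)) :
    sdNumberFaces R hU hcov (σ.comp (face i)) ≤ sdNumberFaces R hU hcov σ := by
  refine Finset.sup_le fun k hk => Finset.sup_le fun g _ => ?_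
  rw [ContinuousMap.comp_assoc, face, simplexMap_comp]
  exact sdNumber_comp_le hU hcov σ (Finset.mem_range.1 hk).le _

theorem map_face_mem_smallTuples {σ : C(Simplex (n + 1), Z)} {i : Fin (n + 2)}
    {y : OrdChain R (Simplex n) (q + 1)}
    (hy : y ∈ Finsupp.supported R R (smallTuples U (σ.comp (face i)) q)) :
    OrdChain.map (face i) (q + 1) y ∈ Finsupp.supported R R (smallTuples U σ q) := by
  refine OrdChain.linearMap_mem (fun w hw => ?_) hy
  rw [OrdChain.map_single]
  refine Finsupp.single_mem_supported R _ ?_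
  rw [smallTuples, Set.mem_ofPred_eq, ← simplexMap_aff, ← ContinuousMap.comp_assoc]
  exact hw

namespace Op

/-- The homotopy from the identity to the operator that subdivides each simplex `σ` a number
`N n σ` of times and interpolates between the subdivisions of `σ` and of its faces. -/
def sdHomotopy (p : C(Z, B)) (N : ∀ n, C(Simplex n, Z) → ℕ) (n : ℕ) : Op R p p n (n + 1) :=
  localOp p fun σ =>
    OrdChain.sdHomotopyIter (bary n) (N n σ) (n + 1) (Finsupp.single (vert n) 1)

theorem deformation_sdHomotopy_zero (N : ∀ n, C(Simplex n, Z) → ℕ) :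
    (deformation (sdHomotopy p N) 0 : Op R p p 0 0) =
      localOp p fun σ => (OrdChain.sd (bary 0) 1 ^ N 0 σ) (Finsupp.single (vert 0) 1) := by
  rw [deformation, homotopyBd, sdHomotopy, bd_comp_localOp, one_eq_localOp, localOp_sub]
  congr 1
  funext σ
  have h0 : OrdChain.sdHomotopyIter (bary 0) (N 0 σ) 0
      (OrdChain.bdry 0 (Finsupp.single (vert 0) (1 : R))) = 0 := by
    simp [OrdChain.sdHomotopyIter, OrdChain.sdHomotopy, OrdChain.coneHomotopy]
  rw [OrdChain.bdry_sdHomotopyIter, h0, sub_zero, sub_sub_cancel]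

theorem sdHomotopyIter_bdry_vert (k n : ℕ) :
    OrdChain.sdHomotopyIter (bary (n + 1)) k (n + 1)
        (OrdChain.bdry (n + 1) (Finsupp.single (vert (n + 1)) (1 : R))) =
      ∑ i : Fin (n + 2), (-1 : R) ^ (i : ℕ) • OrdChain.map (face i) (n + 2)
        (OrdChain.sdHomotopyIter (bary n) k (n + 1) (Finsupp.single (vert n) 1)) := by
  rw [OrdChain.bdry_single, map_sum]
  refine Finset.sum_congr rfl fun i _ => ?_
  rw [← Finsupp.smul_single_one, map_smul, OrdChain.map_sdHomotopyIter (simplexMap_bary _),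
    OrdChain.map_single, simplexMap_vert]

theorem deformation_sdHomotopy_succ {N : ∀ n, C(Simplex n, Z) → ℕ}
    (hN : ∀ (σ : C(Simplex (n + 1), Z)) i, N n (σ.comp (face i)) ≤ N (n + 1) σ) :
    (deformation (sdHomotopy p N) (n + 1) : Op R p p (n + 1) (n + 1)) =
      localOp p fun σ =>
        (OrdChain.sd (bary (n + 1)) (n + 2) ^ N (n + 1) σ) (Finsupp.single (vert (n + 1)) 1) +
        ∑ i : Fin (n + 2), (-1 : R) ^ (i : ℕ) • OrdChain.map (face i) (n + 2)
          (∑ k ∈ Finset.Ico (N n (σ.comp (face i))) (N (n + 1) σ),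
            OrdChain.sdHomotopy (bary n) (n + 1)
              ((OrdChain.sd (bary n) (n + 1) ^ k) (Finsupp.single (vert n) 1))) := by
  rw [deformation, homotopyBd, sdHomotopy, sdHomotopy, bd_comp_localOp, one_eq_localOp,
    localOp_comp_bd, ← sub_sub, localOp_sub, localOp_sub]
  congr 1
  funext σ
  have hsub : ∀ a b c d : OrdChain R (Simplex (n + 1)) (n + 2),
      a - (a - b - c) - d = b + (c - d) := fun _ _ _ _ => by abel
  rw [OrdChain.bdry_sdHomotopyIter, sdHomotopyIter_bdry_vert, hsub, ← Finset.sum_sub_distrib]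
  congr 1
  refine Finset.sum_congr rfl fun i _ => ?_
  rw [← smul_sub, ← map_sub, OrdChain.sdHomotopyIter_sub _ (hN σ i)]

/-- The homotopy from the identity to an operator with small values. -/
def smallHomotopy (p : C(Z, B)) (hU : ∀ j, IsOpen (U j)) (hcov : ⋃ j, U j = Set.univ) (n : ℕ) :
    Op R p p n (n + 1) :=
  sdHomotopy p (fun _ σ => sdNumberFaces R hU hcov σ) n

theorem isSmall_of_mem_support_localOp {u : C(Simplex n, Z) → OrdChain R (Simplex n) (q + 1)}
    {σ : C(Simplex n, Z)} (hu : u σ ∈ Finsupp.supported R R (smallTuples U σ q))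
    {t : Term p (basePt p σ) q} (ht : t ∈ (localOp p u σ).support) : IsSmall U t.1 := by
  obtain ⟨w, hw, h⟩ := exists_of_mem_support_localOp ht
  rw [h]
  exact hu hw

theorem isSmall_of_mem_support (hU : ∀ j, IsOpen (U j)) (hcov : ⋃ j, U j = Set.univ)
    (σ : C(Simplex n, Z)) {t : Term p (basePt p σ) n}
    (ht : t ∈ (deformation (R := R) (smallHomotopy p hU hcov) n σ).support) :
    IsSmall U t.1 := by
  have hsd {n : ℕ} (σ : C(Simplex n, Z)) {k : ℕ} (hk : sdNumberFaces R hU hcov σ ≤ k) :=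
    (exists_sd_pow_small R hU hcov σ).choose_spec k ((sdNumber_le hU hcov σ).trans hk)
  cases n with
  | zero =>
    rw [show smallHomotopy p hU hcov = sdHomotopy p _ from rfl,
      deformation_sdHomotopy_zero] at ht
    exact isSmall_of_mem_support_localOp (hsd σ le_rfl).1 ht
  | succ n =>
    rw [show smallHomotopy p hU hcov = sdHomotopy p _ from rfl,
      deformation_sdHomotopy_succ (sdNumberFaces_face_le hU hcov)] at ht
    refine isSmall_of_mem_support_localOp (Submodule.add_mem _ (hsd σ le_rfl).1 <|
      Submodule.sum_mem _ fun i _ => Submodule.smul_mem _ _ <| map_face_mem_smallTuples <|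
      Submodule.sum_mem _ fun k hk => ?_) ht
    exact (hsd (σ.comp (face i)) (Finset.mem_Ico.1 hk).1).2

end Op

end Subdivision

/-! ### Chains and cochains of pairs -/

section RelativeGroups

variable {R : Type*} [CommRing R] {Z : Type*} [TopologicalSpace Z] (A : LocalSystem R Z) {n : ℕ}

theorem chainsIn_empty (n : ℕ) : chainsIn A ∅ n = ⊥ := by
  refine (Submodule.eq_bot_iff _).2 fun c hc => DFinsupp.ext fun σ => hc σ fun h => ?_
  exact h ⟨v₀ n, rfl⟩

theorem mem_chainsIn_univ (c : Chain A n) : c ∈ chainsIn A Set.univ n :=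
  fun _ h => (h (Set.subset_univ _)).elim

theorem relCochains_anti {S T : Set Z} (h : S ⊆ T) (n : ℕ) :
    relCochains A T n ≤ relCochains A S n :=
  fun _ hφ σ hσ => hφ σ (hσ.trans h)

theorem mem_relCochains_empty (φ : Cochain A n) : φ ∈ relCochains A ∅ n :=
  fun _ h => (h ⟨v₀ n, rfl⟩).elim

theorem eq_zero_of_mem_relCochains_univ {φ : Cochain A n} (h : φ ∈ relCochains A Set.univ n) :
    φ = 0 :=
  funext fun σ => h σ (Set.subset_univ _)

theorem boundaries_mono {S T : Set Z} (h : S ⊆ T) (n : ℕ) : boundaries A S n ≤ boundaries A T n :=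
  sup_le_sup_left (chainsIn_mono A h n) _

theorem cocycles_anti {S T : Set Z} (h : S ⊆ T) (n : ℕ) : cocycles A T n ≤ cocycles A S n :=
  inf_le_inf_right _ (relCochains_anti A h n)

theorem cycles_mono {S T : Set Z} (h : S ⊆ T) : ∀ n, cycles A S n ≤ cycles A T n
  | 0 => le_rfl
  | n + 1 => Submodule.comap_mono (chainsIn_mono A h n)

theorem mem_boundaries_empty {c : Chain A n} :
    c ∈ boundaries A ∅ n ↔ ∃ d, boundary A n d = c := by
  rw [boundaries, chainsIn_empty, sup_bot_eq, LinearMap.mem_range]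

theorem mem_cycles_succ {S : Set Z} {c : Chain A (n + 1)} :
    c ∈ cycles A S (n + 1) ↔ boundary A n c ∈ chainsIn A S n := Iff.rfl

theorem mem_cocycles {S : Set Z} {φ : Cochain A n} :
    φ ∈ cocycles A S n ↔ φ ∈ relCochains A S n ∧ coboundary A n φ = 0 := Iff.rfl

/-- The cycles of the pair `(S, T)` of subsets of `Z`. -/
def pairCycles (S T : Set Z) (n : ℕ) : Submodule R (Chain A n) := chainsIn A S n ⊓ cycles A T n

/-- The boundaries of the pair `(S, T)` of subsets of `Z`. -/
def pairBoundaries (S T : Set Z) (n : ℕ) : Submodule R (Chain A n) :=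
  (chainsIn A S (n + 1)).map (boundary A n) ⊔ chainsIn A T n

/-- Cochains of `(Z, T)` representing cocycles of the pair `(S, T)`. -/
def pairCocycles (S T : Set Z) (n : ℕ) : Submodule R (Cochain A n) :=
  relCochains A T n ⊓ (relCochains A S (n + 1)).comap (coboundary A n)

/-- Cochains of `(Z, T)` representing coboundaries of the pair `(S, T)`. -/
def pairCoboundaries (S T : Set Z) (n : ℕ) : Submodule R (Cochain A n) :=
  coboundaries A T n ⊔ relCochains A S n

theorem mem_pairCocycles {S T : Set Z} {φ : Cochain A n} : φ ∈ pairCocycles A S T n ↔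
    φ ∈ relCochains A T n ∧ coboundary A n φ ∈ relCochains A S (n + 1) := Iff.rfl

theorem pairBoundaries_le (S T : Set Z) (n : ℕ) : pairBoundaries A S T n ≤ boundaries A T n :=
  sup_le_sup_right (LinearMap.map_le_range) _

end RelativeGroups

/-! ### Push-forward and homotopies -/

section PushForward

variable {R : Type*} [CommRing R] {B Z Z' Z'' : Type*} [TopologicalSpace B]
  [TopologicalSpace Z] [TopologicalSpace Z'] [TopologicalSpace Z'']
  {p : C(Z, B)} {p' : C(Z', B)} {p'' : C(Z'', B)} {n : ℕ}

namespace Op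

theorem overHom_comp_edge {g : C(Z, Z')} (hg : ∀ z, p' (g z) = p z) (σ : C(Simplex n, Z))
    (s t : Simplex n) :
    overHom (p := p) (p' := p') (hg (σ s)) ≫
        (FundamentalGroupoid.map p').map (edge (g.comp σ) s t) =
      (FundamentalGroupoid.map p).map (edge σ s t) ≫ overHom (hg (σ t)) := by
  have h : p'.comp (g.comp σ) = p.comp σ := ContinuousMap.ext fun x => hg (σ x)
  have h1 : (FundamentalGroupoid.map p').map (edge (g.comp σ) s t) =
      overHom (p := p') (p' := p) (hg (σ s)).symm ≫ (FundamentalGroupoid.map p).map (edge σ s t) ≫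
        overHom (hg (σ t)) := modelEdge_congr h s t
  exact (congrArg (overHom _ ≫ ·) h1).trans (overHom_comp_overHom_symm_assoc _ _)

theorem extend_push (g : C(Z, Z')) (hg : ∀ z, p' (g z) = p z) {b : FundamentalGroupoid B}
    (t : Term p b n) (a : R) :
    extend b (push g hg n) (Finsupp.single t a) =
      Finsupp.single ⟨g.comp t.1, t.2 ≫ overHom (hg (t.1 (v₀ n)))⟩ a := by
  rw [extend_single, push, Finsupp.mapDomain_single, Finsupp.smul_single_one]
  rfl

theorem bd_comp_push (g : C(Z, Z')) (hg : ∀ z, p' (g z) = p z) :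
    (bd p' n).comp (push g hg (n + 1)) = (push g hg n).comp (bd p n : Op R p p (n + 1) n) := by
  funext σ
  rw [comp, comp, push, extend_single, one_smul, bd, bd, Finsupp.mapDomain_finsetSum, map_sum]
  refine Finset.sum_congr rfl fun i _ => ?_
  rw [extend_push, Finsupp.mapDomain_single]
  congr 1
  exact Sigma.ext rfl (heq_of_eq (overHom_comp_edge hg σ _ _))

theorem push_comp_push (g : C(Z, Z')) (hg : ∀ z, p' (g z) = p z) (g' : C(Z', Z''))
    (hg' : ∀ z, p'' (g' z) = p' z) :
    (push g' hg' n).comp (push g hg n : Op R p p' n n) =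
      push (g'.comp g) (fun z => (hg' (g z)).trans (hg z)) n := by
  funext σ
  rw [comp, push, extend_push, push]
  congr 1
  exact Sigma.ext rfl (heq_of_eq (eqToHom_trans
    (congrArg FundamentalGroupoid.mk (hg (σ (v₀ n))).symm)
    (congrArg FundamentalGroupoid.mk (hg' (g (σ (v₀ n)))).symm)))

theorem push_id : (push (ContinuousMap.id Z) (fun _ => rfl) n : Op R p p n n) = one p n := rfl

theorem comp_homotopyBd (g : C(Z', Z'')) (hg : ∀ z, p'' (g z) = p' z)
    (K : ∀ n, Op R p p' n (n + 1)) :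
    (push g hg n).comp (homotopyBd K n) =
      homotopyBd (fun n => (push g hg (n + 1)).comp (K n)) n := by
  cases n with
  | zero => rw [homotopyBd, homotopyBd, ← comp_assoc, ← bd_comp_push, comp_assoc]
  | succ n =>
    rw [homotopyBd, homotopyBd, comp_add, ← comp_assoc, ← bd_comp_push, comp_assoc, comp_assoc]

theorem homotopyBd_sub (K K' : ∀ n, Op R p p' n (n + 1)) :
    homotopyBd (fun n => K n - K' n) n = homotopyBd K n - homotopyBd K' n := by
  cases n with
  | zero => simp only [homotopyBd, comp_sub]
  | succ n =>
    simp only [homotopyBd, comp_sub, sub_comp]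
    abel

theorem homotopyBd_add (K K' : ∀ n, Op R p p' n (n + 1)) :
    homotopyBd (fun n => K n + K' n) n = homotopyBd K n + homotopyBd K' n := by
  cases n with
  | zero => simp only [homotopyBd, comp_add]
  | succ n =>
    simp only [homotopyBd, comp_add, add_comp]
    abel

theorem bd_comp_homotopyBd (K : ∀ n, Op R p p' n (n + 1)) :
    (bd p' n).comp (homotopyBd K (n + 1)) = (homotopyBd K n).comp (bd p n) := by
  have h : (bd p' n).comp (homotopyBd K (n + 1)) = ((bd p' n).comp (K n)).comp (bd p n) := by
    rw [homotopyBd, comp_add, ← comp_assoc, bd_comp_bd, zero_comp, zero_add, comp_assoc]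
  rw [h]
  cases n with
  | zero => rw [homotopyBd]
  | succ n => rw [homotopyBd, add_comp, comp_assoc (K n), bd_comp_bd, comp_zero, add_zero]

theorem bd_comp_deformation (K : ∀ n, Op R p p n (n + 1)) :
    (bd p n).comp (deformation K (n + 1)) = (deformation K n).comp (bd p n) := by
  rw [deformation, deformation, comp_sub, sub_comp, bd_comp_homotopyBd, one_comp, comp_one]

theorem Carries.homotopyBd {K : ∀ n, Op R p p' n (n + 1)} {T : Set Z} {T' : Set Z'}
    (h : ∀ n, (K n).Carries T T') (n : ℕ) : (homotopyBd K n).Carries T T' := by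
  cases n with
  | zero => exact (carries_bd T').comp (h 0)
  | succ n => exact ((carries_bd T').comp (h _)).add ((h n).comp (carries_bd T))

theorem Carries.deformation {K : ∀ n, Op R p p n (n + 1)} {T : Set Z}
    (h : ∀ n, (K n).Carries T T) (n : ℕ) : (deformation K n).Carries T T :=
  (carries_one T).sub (Carries.homotopyBd h n)

variable (A : LocalSystem R B)

theorem chain_deformation_add (K : ∀ n, Op R p p n (n + 1)) (c : Chain (A.pullback p) n) :
    chain A (deformation K n) c + chain A (homotopyBd K n) c = c := by
  rw [deformation, map_sub, LinearMap.sub_apply, chain_one, sub_add_cancel]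

theorem cochain_deformation_add (K : ∀ n, Op R p p n (n + 1)) (φ : Cochain (A.pullback p) n) :
    cochain A (deformation K n) φ + cochain A (homotopyBd K n) φ = φ := by
  rw [deformation, map_sub, LinearMap.sub_apply, cochain_one, sub_add_cancel]

theorem boundary_chain {L : Op R p p' n n} {L' : Op R p p' (n + 1) (n + 1)}
    (h : (bd p' n).comp L' = L.comp (bd p n)) (c : Chain (A.pullback p) (n + 1)) :
    boundary (A.pullback p') n (chain A L' c) = chain A L (boundary (A.pullback p) n c) := by
  rw [← chain_bd, ← chain_bd, ← chain_comp, ← chain_comp, h]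

theorem coboundary_cochain {L : Op R p p' n n} {L' : Op R p p' (n + 1) (n + 1)}
    (h : (bd p' n).comp L' = L.comp (bd p n)) (φ : Cochain (A.pullback p') n) :
    coboundary (A.pullback p) n (cochain A L φ) =
      cochain A L' (coboundary (A.pullback p') n φ) := by
  rw [← cochain_bd, ← cochain_bd, ← cochain_comp, ← cochain_comp, h]

theorem boundary_chain_push (g : C(Z, Z')) (hg : ∀ z, p' (g z) = p z)
    (c : Chain (A.pullback p) (n + 1)) :
    boundary (A.pullback p') n (chain A (push g hg (n + 1)) c) =
      chain A (push g hg n) (boundary (A.pullback p) n c) :=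
  boundary_chain A (bd_comp_push g hg) c

theorem coboundary_cochain_push (g : C(Z, Z')) (hg : ∀ z, p' (g z) = p z)
    (φ : Cochain (A.pullback p') n) :
    coboundary (A.pullback p) n (cochain A (push g hg n) φ) =
      cochain A (push g hg (n + 1)) (coboundary (A.pullback p') n φ) :=
  coboundary_cochain A (bd_comp_push g hg) φ

theorem boundary_boundary (c : Chain (A.pullback p) (n + 2)) :
    boundary (A.pullback p) n (boundary (A.pullback p) (n + 1) c) = 0 := by
  rw [← chain_bd, ← chain_bd, ← chain_comp, bd_comp_bd, map_zero, LinearMap.zero_apply]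

theorem coboundary_coboundary (φ : Cochain (A.pullback p) n) :
    coboundary (A.pullback p) (n + 1) (coboundary (A.pullback p) n φ) = 0 := by
  rw [← cochain_bd, ← cochain_bd, ← cochain_comp, bd_comp_bd, map_zero, LinearMap.zero_apply]

theorem boundary_mem_chainsIn {T : Set Z} {c : Chain (A.pullback p) (n + 1)}
    (h : c ∈ chainsIn (A.pullback p) T (n + 1)) :
    boundary (A.pullback p) n c ∈ chainsIn (A.pullback p) T n := by
  rw [← chain_bd]
  exact (carries_bd T).chain_mem A h

theorem coboundary_mem_relCochains {T : Set Z} {φ : Cochain (A.pullback p) n}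
    (h : φ ∈ relCochains (A.pullback p) T n) :
    coboundary (A.pullback p) n φ ∈ relCochains (A.pullback p) T (n + 1) := by
  rw [← cochain_bd]
  exact (carries_bd T).cochain_mem A h

theorem push_mem_chainsIn_range (g : C(Z, Z')) (hg : ∀ z, p' (g z) = p z)
    (c : Chain (A.pullback p) n) :
    chain A (push g hg n) c ∈ chainsIn (A.pullback p') (Set.range g) n :=
  (carries_push fun z _ => Set.mem_range_self z).chain_mem A (mem_chainsIn_univ _ c)

open scoped Classical in
theorem chain_push_single (g : C(Z, Z')) (hg : ∀ z, p' (g z) = p z) (σ : C(Simplex n, Z))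
    (x : (A.pullback p).obj ⟨σ (v₀ n)⟩) :
    chain A (push g hg n) (DFinsupp.single σ x) =
      DFinsupp.single (β := fun τ : C(Simplex n, Z') => (A.pullback p').obj ⟨τ (v₀ n)⟩)
        (g.comp σ) ((A.map (overHom (p := p) (p' := p') (hg (σ (v₀ n))))).hom x) := by
  rw [chain_single, push, chainEval_single, one_smul]

theorem cochain_push_apply (g : C(Z, Z')) (hg : ∀ z, p' (g z) = p z)
    (φ : Cochain (A.pullback p') n) (σ : C(Simplex n, Z)) :
    cochain A (push g hg n) φ σ = (A.map (Groupoid.inv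
      (overHom (p := p) (p' := p') (hg (σ (v₀ n)))))).hom (φ (g.comp σ)) := by
  rw [cochain_apply, push, cochainEval_single, one_smul]

theorem map_inv_map {b b' : FundamentalGroupoid B} (γ : b ⟶ b') (x : A.obj b) :
    (A.map (Groupoid.inv γ)).hom ((A.map γ).hom x) = x := by
  rw [← LinearMap.comp_apply, ← ModuleCat.hom_comp, ← A.map_comp, Groupoid.comp_inv, A.map_id]
  rfl

theorem map_map_inv {b b' : FundamentalGroupoid B} (γ : b ⟶ b') (x : A.obj b') :
    (A.map γ).hom ((A.map (Groupoid.inv γ)).hom x) = x := by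
  rw [← LinearMap.comp_apply, ← ModuleCat.hom_comp, ← A.map_comp, Groupoid.inv_comp, A.map_id]
  rfl

theorem map_hom_injective {b b' : FundamentalGroupoid B} (γ : b ⟶ b') :
    Function.Injective (A.map γ).hom :=
  Function.LeftInverse.injective (map_inv_map A γ)

theorem cochain_push_apply_eq_zero_iff {g : C(Z, Z')} (hg : ∀ z, p' (g z) = p z)
    {φ : Cochain (A.pullback p') n} {σ : C(Simplex n, Z)} :
    cochain A (push g hg n) φ σ = 0 ↔ φ (g.comp σ) = 0 := by
  rw [cochain_push_apply]
  exact map_eq_zero_iff _ (map_hom_injective A _)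

theorem chain_push_apply {g : C(Z, Z')} (hg : ∀ z, p' (g z) = p z) (hinj : Function.Injective g)
    (c : Chain (A.pullback p) n) (σ : C(Simplex n, Z)) :
    chain A (push g hg n) c (g.comp σ) =
      (A.map (overHom (p := p) (p' := p') (hg (σ (v₀ n))))).hom (c σ) := by
  classical
  induction c using DFinsupp.induction with
  | h0 => simp
  | ha τ x c _ _ ih =>
    rw [map_add, DFinsupp.add_apply, DFinsupp.add_apply, ih, map_add, chain_push_single]
    congr 1
    by_cases h : τ = σ
    · subst h
      rw [DFinsupp.single_eq_same, DFinsupp.single_eq_same]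
    · rw [DFinsupp.single_eq_of_ne (Ne.symm h), DFinsupp.single_eq_of_ne, map_zero]
      intro h'
      exact h (ContinuousMap.ext fun x => (hinj (DFunLike.congr_fun h' x)).symm)

theorem mem_chainsIn_of_push {g : C(Z, Z')} (hg : ∀ z, p' (g z) = p z)
    (hinj : Function.Injective g) {T : Set Z'} {c : Chain (A.pullback p) n}
    (h : chain A (push g hg n) c ∈ chainsIn (A.pullback p') T n) :
    c ∈ chainsIn (A.pullback p) (g ⁻¹' T) n := by
  intro σ hσ
  have := h (g.comp σ) fun hr => hσ (by
    rintro _ ⟨x, rfl⟩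
    exact hr ⟨x, rfl⟩)
  rw [chain_push_apply A hg hinj] at this
  exact map_hom_injective A _ (this.trans (map_zero _).symm)

theorem exists_lift {g : C(Z, Z')} (hemb : Topology.IsEmbedding g) {τ : C(Simplex n, Z')}
    (h : Set.range τ ⊆ Set.range g) : ∃ σ : C(Simplex n, Z), g.comp σ = τ := by
  choose s hs using fun x => h ⟨x, rfl⟩
  refine ⟨⟨s, hemb.continuous_iff.2 ?_⟩, ContinuousMap.ext hs⟩
  have : g ∘ s = τ := funext hs
  rw [this]
  exact τ.continuous

theorem exists_chain_push_eq {g : C(Z, Z')} (hg : ∀ z, p' (g z) = p z)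
    (hemb : Topology.IsEmbedding g) {c : Chain (A.pullback p') n}
    (hc : c ∈ chainsIn (A.pullback p') (Set.range g) n) :
    ∃ c', chain A (push g hg n) c' = c := by
  classical
  refine chainsIn_le (N := LinearMap.range (chain A (push g hg n))) (fun τ x hτ => ?_) hc
  obtain ⟨σ, rfl⟩ := exists_lift hemb hτ
  refine ⟨DFinsupp.single σ ((A.map (Groupoid.inv
    (overHom (p := p) (p' := p') (hg (σ (v₀ n)))))).hom x), ?_⟩
  rw [chain_push_single]
  exact congrArg (DFinsupp.single _) (map_map_inv A _ x)

theorem cochain_push_eq_zero_iff {g : C(Z, Z')} (hg : ∀ z, p' (g z) = p z)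
    (hemb : Topology.IsEmbedding g) {φ : Cochain (A.pullback p') n} :
    cochain A (push g hg n) φ = 0 ↔ φ ∈ relCochains (A.pullback p') (Set.range g) n := by
  refine ⟨fun h τ hτ => ?_, fun h => funext fun σ =>
    (cochain_push_apply_eq_zero_iff A hg).2 (h _ (Set.range_comp_subset_range σ g))⟩
  obtain ⟨σ, rfl⟩ := exists_lift hemb hτ
  exact (cochain_push_apply_eq_zero_iff A hg).1 (congrFun h σ)

theorem exists_cochain_push_eq {g : C(Z, Z')} (hg : ∀ z, p' (g z) = p z)
    (hinj : Function.Injective g) (ψ : Cochain (A.pullback p) n) :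
    ∃ φ : Cochain (A.pullback p') n, cochain A (push g hg n) φ = ψ ∧
      ∀ τ : C(Simplex n, Z'), (¬ ∃ σ, g.comp σ = τ) → φ τ = 0 := by
  classical
  have hτ : ∀ {τ : C(Simplex n, Z')} (h : ∃ σ : C(Simplex n, Z), g.comp σ = τ),
      p' (τ (v₀ n)) = p (h.choose (v₀ n)) := fun h => by
    rw [← hg]
    exact congrArg p' (DFunLike.congr_fun h.choose_spec (v₀ n)).symm
  refine ⟨fun τ => if h : ∃ σ : C(Simplex n, Z), g.comp σ = τ then
    (A.map (overHom (p := p) (p' := p') (hτ h))).hom (ψ h.choose) else 0, ?_, ?_⟩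
  · funext σ
    have hex : ∃ σ' : C(Simplex n, Z), g.comp σ' = g.comp σ := ⟨σ, rfl⟩
    rw [cochain_push_apply, dif_pos hex]
    have hch : hex.choose = σ := ContinuousMap.ext fun x =>
      hinj (DFunLike.congr_fun hex.choose_spec x)
    have key : ∀ (σ' : C(Simplex n, Z)) (_ : σ' = σ) (h : p' (g (σ (v₀ n))) = p (σ' (v₀ n))),
        (A.map (Groupoid.inv (overHom (p := p) (p' := p') (hg (σ (v₀ n)))))).hom
          ((A.map (overHom (p := p) (p' := p') h)).hom (ψ σ')) = ψ σ := by
      rintro _ rfl _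
      exact map_inv_map A _ _
    exact key _ hch _
  · intro τ h
    exact dif_neg h

end Op

end PushForward

/-! ### Homotopy invariance -/

section HomotopyInvariance

variable {R : Type*} [CommRing R] {B Z Z' : Type*} [TopologicalSpace B]
  [TopologicalSpace Z] [TopologicalSpace Z'] {p : C(Z, B)} {p' : C(Z', B)} {n : ℕ}
  (A : LocalSystem R B)

namespace Op

theorem homotopyBd_chain_mem {K : ∀ n, Op R p p' n (n + 1)} {S T : Set Z} {S' T' : Set Z'}
    (hS : ∀ n, (K n).Carries S S') (hT : ∀ n, (K n).Carries T T') {c : Chain (A.pullback p) n}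
    (hc : c ∈ pairCycles (A.pullback p) S T n) :
    chain A (homotopyBd K n) c ∈ pairBoundaries (A.pullback p') S' T' n := by
  cases n with
  | zero =>
    rw [homotopyBd, chain_comp, chain_bd]
    exact Submodule.mem_sup_left ⟨_, (hS 0).chain_mem A hc.1, rfl⟩
  | succ n =>
    rw [homotopyBd, map_add, LinearMap.add_apply, chain_comp, chain_bd, chain_comp, chain_bd]
    exact Submodule.add_mem _ (Submodule.mem_sup_left ⟨_, (hS _).chain_mem A hc.1, rfl⟩)
      (Submodule.mem_sup_right ((hT n).chain_mem A hc.2))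

theorem homotopyBd_chain_mem_boundaries {K : ∀ n, Op R p p' n (n + 1)} {T : Set Z} {T' : Set Z'}
    (hT : ∀ n, (K n).Carries T T') {c : Chain (A.pullback p) n}
    (hc : c ∈ cycles (A.pullback p) T n) :
    chain A (homotopyBd K n) c ∈ boundaries (A.pullback p') T' n :=
  pairBoundaries_le _ _ _ _ (homotopyBd_chain_mem A (S := Set.univ) (S' := Set.univ)
    (fun _ _ _ _ _ => Set.subset_univ _) hT ⟨mem_chainsIn_univ _ c, hc⟩)

theorem homotopyBd_cochain_mem {K : ∀ n, Op R p p' n (n + 1)} {S T : Set Z} {S' T' : Set Z'}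
    (hS : ∀ n, (K n).Carries S S') (hT : ∀ n, (K n).Carries T T')
    {φ : Cochain (A.pullback p') n} (hφ : φ ∈ pairCocycles (A.pullback p') S' T' n) :
    cochain A (homotopyBd K n) φ ∈ pairCoboundaries (A.pullback p) S T n := by
  cases n with
  | zero =>
    rw [homotopyBd, cochain_comp, cochain_bd]
    exact Submodule.mem_sup_right ((hS 0).cochain_mem A hφ.2)
  | succ n =>
    rw [homotopyBd, map_add, LinearMap.add_apply, cochain_comp, cochain_bd, cochain_comp,
      cochain_bd]
    exact Submodule.add_mem _ (Submodule.mem_sup_right ((hS _).cochain_mem A hφ.2))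
      (Submodule.mem_sup_left ⟨_, (hT n).cochain_mem A hφ.1, rfl⟩)

theorem homotopyBd_cochain_mem_coboundaries {K : ∀ n, Op R p p' n (n + 1)} {T : Set Z}
    {T' : Set Z'} (hT : ∀ n, (K n).Carries T T') {φ : Cochain (A.pullback p') n}
    (hφ : φ ∈ cocycles (A.pullback p') T' n) :
    cochain A (homotopyBd K n) φ ∈ coboundaries (A.pullback p) T n := by
  have h := homotopyBd_cochain_mem A (S := Set.univ) (S' := Set.univ) (T := T) (T' := T')
    (K := K) (φ := φ) (fun _ _ _ _ _ => Set.subset_univ _) hT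
    ((mem_pairCocycles _).2 ⟨hφ.1, by
      rw [((mem_cocycles _).1 hφ).2]
      exact Submodule.zero_mem _⟩)
  obtain ⟨x, hx, y, hy, hxy⟩ := Submodule.mem_sup.1 h
  rw [eq_zero_of_mem_relCochains_univ _ hy, add_zero] at hxy
  rwa [← hxy]

variable {g : C(Z, Z')} (hg : ∀ z, p' (g z) = p z) {T : Set Z} {T' : Set Z'}

theorem push_mem_cycles (h : Set.MapsTo g T T') {c : Chain (A.pullback p) n}
    (hc : c ∈ cycles (A.pullback p) T n) :
    chain A (push g hg n) c ∈ cycles (A.pullback p') T' n := by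
  cases n with
  | zero => exact Submodule.mem_top
  | succ n =>
    rw [mem_cycles_succ, boundary_chain_push]
    exact (carries_push h).chain_mem A hc

theorem boundary_mem_cycles (c : Chain (A.pullback p) (n + 1)) :
    boundary (A.pullback p) n c ∈ cycles (A.pullback p) ∅ n := by
  cases n with
  | zero => exact Submodule.mem_top
  | succ n =>
    rw [mem_cycles_succ, boundary_boundary]
    exact Submodule.zero_mem _

theorem mem_cycles_of_push (hinj : Function.Injective g) {T : Set Z'} {c : Chain (A.pullback p) n}
    (h : chain A (push g hg n) c ∈ cycles (A.pullback p') T n) :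
    c ∈ cycles (A.pullback p) (g ⁻¹' T) n := by
  cases n with
  | zero => exact Submodule.mem_top
  | succ n =>
    rw [mem_cycles_succ, boundary_chain_push] at h
    exact mem_chainsIn_of_push A hg hinj h

theorem push_mem_boundaries (h : Set.MapsTo g T T') {c : Chain (A.pullback p) n}
    (hc : c ∈ boundaries (A.pullback p) T n) :
    chain A (push g hg n) c ∈ boundaries (A.pullback p') T' n := by
  obtain ⟨_, ⟨d, rfl⟩, t, ht, rfl⟩ := Submodule.mem_sup.1 hc
  rw [map_add, ← boundary_chain_push]
  exact Submodule.add_mem _ (Submodule.mem_sup_left ⟨_, rfl⟩)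
    (Submodule.mem_sup_right ((carries_push h).chain_mem A ht))

theorem push_mem_cocycles (h : Set.MapsTo g T T') {φ : Cochain (A.pullback p') n}
    (hφ : φ ∈ cocycles (A.pullback p') T' n) :
    cochain A (push g hg n) φ ∈ cocycles (A.pullback p) T n := by
  refine (mem_cocycles _).2 ⟨(carries_push h).cochain_mem A hφ.1, ?_⟩
  rw [coboundary_cochain_push, ((mem_cocycles _).1 hφ).2, map_zero]

theorem push_mem_coboundaries (h : Set.MapsTo g T T') {φ : Cochain (A.pullback p') n}
    (hφ : φ ∈ coboundaries (A.pullback p') T' n) :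
    cochain A (push g hg n) φ ∈ coboundaries (A.pullback p) T n := by
  cases n with
  | zero =>
    obtain rfl : φ = 0 := hφ
    rw [map_zero]
    exact Submodule.zero_mem _
  | succ n =>
    obtain ⟨ψ, hψ, rfl⟩ := hφ
    rw [← coboundary_cochain_push]
    exact ⟨_, (carries_push h).cochain_mem A hψ, rfl⟩

end Op

/-- Two maps over `B` induce homotopic operators on singular chains. -/
def ChainHomotopic (R : Type*) [CommRing R] {g g' : C(Z, Z')} (hg : ∀ z, p' (g z) = p z)
    (hg' : ∀ z, p' (g' z) = p z) : Prop :=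
  ∃ K : ∀ n, Op R p p' n (n + 1), ∀ n, Op.push g hg n - Op.push g' hg' n = Op.homotopyBd K n

theorem ChainHomotopic.trans {g g' g'' : C(Z, Z')} {hg : ∀ z, p' (g z) = p z}
    {hg' : ∀ z, p' (g' z) = p z} {hg'' : ∀ z, p' (g'' z) = p z} (h : ChainHomotopic R hg hg')
    (h' : ChainHomotopic R hg' hg'') : ChainHomotopic R hg hg'' := by
  obtain ⟨K, hK⟩ := h
  obtain ⟨K', hK'⟩ := h'
  exact ⟨fun n => K n + K' n, fun n => by
    rw [Op.homotopyBd_add, ← hK, ← hK', sub_add_sub_cancel]⟩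

theorem ChainHomotopic.of_homotopy (Φ : C(Z × unitInterval, Z')) (hΦ : ∀ z t, p' (Φ (z, t)) = p z)
    {g g' : C(Z, Z')} (hg : ∀ z, p' (g z) = p z) (hg' : ∀ z, p' (g' z) = p z)
    (h₀ : ∀ z, Φ (z, 0) = g' z) (h₁ : ∀ z, Φ (z, 1) = g z) : ChainHomotopic R hg hg' :=
  ⟨Op.prism Φ hΦ, fun _ => (Op.homotopyBd_prism Φ hΦ h₀ h₁ hg' hg).symm⟩

theorem ChainHomotopic.chain_sub_mem {g g' : C(Z, Z')} {hg : ∀ z, p' (g z) = p z}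
    {hg' : ∀ z, p' (g' z) = p z} (h : ChainHomotopic R hg hg') {c : Chain (A.pullback p) n}
    (hc : c ∈ cycles (A.pullback p) ∅ n) :
    Op.chain A (Op.push g hg n) c - Op.chain A (Op.push g' hg' n) c ∈
      boundaries (A.pullback p') ∅ n := by
  obtain ⟨K, hK⟩ := h
  rw [← LinearMap.sub_apply, ← map_sub, hK]
  exact Op.homotopyBd_chain_mem_boundaries A (fun _ σ hσ => (hσ ⟨v₀ _, rfl⟩).elim) hc

theorem ChainHomotopic.cochain_sub_mem {g g' : C(Z, Z')} {hg : ∀ z, p' (g z) = p z}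
    {hg' : ∀ z, p' (g' z) = p z} (h : ChainHomotopic R hg hg') {φ : Cochain (A.pullback p') n}
    (hφ : φ ∈ cocycles (A.pullback p') ∅ n) :
    Op.cochain A (Op.push g hg n) φ - Op.cochain A (Op.push g' hg' n) φ ∈
      coboundaries (A.pullback p) ∅ n := by
  obtain ⟨K, hK⟩ := h
  rw [← LinearMap.sub_apply, ← map_sub, hK]
  exact Op.homotopyBd_cochain_mem_coboundaries A (fun _ σ hσ => (hσ ⟨v₀ _, rfl⟩).elim) hφ

/-- A map over `B` with an inverse up to chain homotopy over `B`. -/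
def IsChainEquiv (R : Type*) [CommRing R] {e : C(Z, Z')} (he : ∀ z, p' (e z) = p z) : Prop :=
  ∃ (g : C(Z', Z)) (hg : ∀ z, p (g z) = p' z),
    ChainHomotopic R (p := p) (p' := p) (g := g.comp e) (g' := ContinuousMap.id Z)
      (fun z => (hg (e z)).trans (he z)) (fun _ => rfl) ∧
    ChainHomotopic R (p := p') (p' := p') (g := e.comp g) (g' := ContinuousMap.id Z')
      (fun z => (he (g z)).trans (hg z)) (fun _ => rfl)

namespace IsChainEquiv

variable {e : C(Z, Z')} {he : ∀ z, p' (e z) = p z}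

theorem exists_cycle (h : IsChainEquiv R he) {y : Chain (A.pullback p') n}
    (hy : y ∈ cycles (A.pullback p') ∅ n) :
    ∃ x ∈ cycles (A.pullback p) ∅ n,
      y - Op.chain A (Op.push e he n) x ∈ boundaries (A.pullback p') ∅ n := by
  obtain ⟨g, hg, -, h2⟩ := h
  refine ⟨Op.chain A (Op.push g hg n) y, Op.push_mem_cycles A hg (Set.mapsTo_empty _ _) hy, ?_⟩
  have := h2.chain_sub_mem A hy
  rw [← Op.push_comp_push g hg e he, Op.push_id, Op.chain_comp, Op.chain_one] at this
  rw [← neg_sub]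
  exact Submodule.neg_mem _ this

theorem mem_boundaries (h : IsChainEquiv R he) {x : Chain (A.pullback p) n}
    (hx : x ∈ cycles (A.pullback p) ∅ n)
    (hb : Op.chain A (Op.push e he n) x ∈ boundaries (A.pullback p') ∅ n) :
    x ∈ boundaries (A.pullback p) ∅ n := by
  obtain ⟨g, hg, h1, -⟩ := h
  have := h1.chain_sub_mem A hx
  rw [← Op.push_comp_push e he g hg, Op.push_id, Op.chain_comp, Op.chain_one] at this
  have h3 := Submodule.sub_mem _ (Op.push_mem_boundaries A hg (Set.mapsTo_empty _ _) hb) this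
  rwa [sub_sub_cancel] at h3

theorem exists_cocycle (h : IsChainEquiv R he) {y : Cochain (A.pullback p) n}
    (hy : y ∈ cocycles (A.pullback p) ∅ n) :
    ∃ x ∈ cocycles (A.pullback p') ∅ n,
      y - Op.cochain A (Op.push e he n) x ∈ coboundaries (A.pullback p) ∅ n := by
  obtain ⟨g, hg, h1, -⟩ := h
  refine ⟨Op.cochain A (Op.push g hg n) y, Op.push_mem_cocycles A hg (Set.mapsTo_empty _ _) hy, ?_⟩
  have := h1.cochain_sub_mem A hy
  rw [← Op.push_comp_push e he g hg, Op.push_id, Op.cochain_comp, Op.cochain_one] at this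
  rw [← neg_sub]
  exact Submodule.neg_mem _ this

theorem mem_coboundaries (h : IsChainEquiv R he) {x : Cochain (A.pullback p') n}
    (hx : x ∈ cocycles (A.pullback p') ∅ n)
    (hb : Op.cochain A (Op.push e he n) x ∈ coboundaries (A.pullback p) ∅ n) :
    x ∈ coboundaries (A.pullback p') ∅ n := by
  obtain ⟨g, hg, -, h2⟩ := h
  have := h2.cochain_sub_mem A hx
  rw [← Op.push_comp_push g hg e he, Op.push_id, Op.cochain_comp, Op.cochain_one] at this
  have h3 := Submodule.sub_mem _ (Op.push_mem_coboundaries A hg (Set.mapsTo_empty _ _) hb) this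
  rwa [sub_sub_cancel] at h3

theorem mem_boundaries_range (h : IsChainEquiv R he) {c : Chain (A.pullback p') n}
    (hc : c ∈ cycles (A.pullback p') ∅ n) : c ∈ boundaries (A.pullback p') (Set.range e) n := by
  obtain ⟨x, -, hx⟩ := h.exists_cycle A hc
  have := Submodule.add_mem _ (boundaries_mono _ (Set.empty_subset _) n hx)
    (Submodule.mem_sup_right (Op.push_mem_chainsIn_range A e he x))
  rwa [sub_add_cancel] at this

theorem cycles_range_le_boundaries (h : IsChainEquiv R he) (hemb : Topology.IsEmbedding e) :
    cycles (A.pullback p') (Set.range e) n ≤ boundaries (A.pullback p') (Set.range e) n := by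
  intro c hc
  cases n with
  | zero => exact h.mem_boundaries_range A Submodule.mem_top
  | succ n =>
    obtain ⟨m, hm⟩ := Op.exists_chain_push_eq A he hemb hc
    have hmc : m ∈ cycles (A.pullback p) ∅ n := by
      rw [← Set.preimage_empty (f := e)]
      refine Op.mem_cycles_of_push A he hemb.injective ?_
      rw [hm]
      exact Op.boundary_mem_cycles A c
    obtain ⟨d, rfl⟩ := (mem_boundaries_empty _).1
      (h.mem_boundaries A hmc ((mem_boundaries_empty _).2 ⟨c, hm.symm⟩))
    have hcd : c - Op.chain A (Op.push e he (n + 1)) d ∈ cycles (A.pullback p') ∅ (n + 1) := by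
      rw [mem_cycles_succ, map_sub, Op.boundary_chain_push, hm, sub_self]
      exact Submodule.zero_mem _
    have := Submodule.add_mem _ (h.mem_boundaries_range A hcd)
      (Submodule.mem_sup_right (Op.push_mem_chainsIn_range A e he d))
    rwa [sub_add_cancel] at this

theorem exists_cocycle_push_eq (h : IsChainEquiv R he) (hemb : Topology.IsEmbedding e)
    {ψ : Cochain (A.pullback p) n} (hψ : ψ ∈ cocycles (A.pullback p) ∅ n) :
    ∃ x ∈ cocycles (A.pullback p') ∅ n, Op.cochain A (Op.push e he n) x = ψ := by
  obtain ⟨y, hy, hyψ⟩ := h.exists_cocycle A hψ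
  cases n with
  | zero => exact ⟨y, hy, (sub_eq_zero.1 hyψ).symm⟩
  | succ n =>
    obtain ⟨χ, -, hχ⟩ := hyψ
    obtain ⟨χ', rfl, -⟩ := Op.exists_cochain_push_eq (p' := p') A he hemb.injective χ
    refine ⟨y + coboundary (A.pullback p') n χ', Submodule.add_mem _ hy
      ((mem_cocycles _).2 ⟨mem_relCochains_empty _ _, Op.coboundary_coboundary A χ'⟩), ?_⟩
    rw [map_add, ← Op.coboundary_cochain_push, hχ, add_sub_cancel]

theorem cocycles_range_le_coboundaries (h : IsChainEquiv R he) (hemb : Topology.IsEmbedding e) :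
    cocycles (A.pullback p') (Set.range e) n ≤ coboundaries (A.pullback p') (Set.range e) n := by
  intro φ hφ
  have hz : Op.cochain A (Op.push e he n) φ = 0 := (Op.cochain_push_eq_zero_iff A he hemb).2 hφ.1
  have hcob := h.mem_coboundaries A (cocycles_anti _ (Set.empty_subset _) n hφ)
    (hz ▸ Submodule.zero_mem _)
  cases n with
  | zero => exact hcob
  | succ n =>
    obtain ⟨ψ, -, rfl⟩ := hcob
    obtain ⟨y, hy, hyψ⟩ := h.exists_cocycle_push_eq A hemb (ψ := Op.cochain A (Op.push e he n) ψ)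
      ((mem_cocycles _).2 ⟨mem_relCochains_empty _ _, by rw [Op.coboundary_cochain_push, hz]⟩)
    refine ⟨ψ - y, (Op.cochain_push_eq_zero_iff A he hemb).1 (by rw [map_sub, hyψ, sub_self]), ?_⟩
    rw [map_sub, ((mem_cocycles _).1 hy).2, sub_zero]

end IsChainEquiv

end HomotopyInvariance

/-! ### Excision -/

section Excision

variable {R : Type*} [CommRing R] {B Z Z' : Type*} [TopologicalSpace B]
  [TopologicalSpace Z] [TopologicalSpace Z'] {p : C(Z, B)} {p' : C(Z', B)} {n : ℕ}

/-- The subsets `T` and `E` of `S` form an excisive couple: a homotopy that preserves `S`, `T`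
and `E` deforms the chains of `S` into sums of chains of `T` and of `E`. -/
def IsExcisive (R : Type*) [CommRing R] (p : C(Z, B)) (S T E : Set Z) : Prop :=
  ∃ K : ∀ n, Op R p p n (n + 1), (∀ n, (K n).Carries S S) ∧ (∀ n, (K n).Carries T T) ∧
    (∀ n, (K n).Carries E E) ∧ ∀ (n : ℕ) (σ : C(Simplex n, Z)), Set.range σ ⊆ S →
      ∀ t ∈ (Op.deformation K n σ).support, Set.range t.1 ⊆ T ∨ Set.range t.1 ⊆ E

variable (A : LocalSystem R B)

namespace Op

theorem chain_mem_sup {L : Op R p p' n n} {S : Set Z} {T E : Set Z'}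
    (hL : ∀ σ : C(Simplex n, Z), Set.range σ ⊆ S → ∀ t ∈ (L σ).support,
      Set.range t.1 ⊆ T ∨ Set.range t.1 ⊆ E) {c : Chain (A.pullback p) n}
    (hc : c ∈ chainsIn (A.pullback p) S n) :
    chain A L c ∈ chainsIn (A.pullback p') T n ⊔ chainsIn (A.pullback p') E n :=
  chain_mem A (fun σ hσ t ht => (hL σ hσ t ht).elim
    (fun h => (chainsIn_mono _ h n).trans le_sup_left)
    (fun h => (chainsIn_mono _ h n).trans le_sup_right)) hc

theorem cochain_mem_of_inf {L : Op R p p' n n} {S : Set Z} {T E : Set Z'}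
    (hL : ∀ σ : C(Simplex n, Z), Set.range σ ⊆ S → ∀ t ∈ (L σ).support,
      Set.range t.1 ⊆ T ∨ Set.range t.1 ⊆ E) {φ : Cochain (A.pullback p') n}
    (hT : φ ∈ relCochains (A.pullback p') T n) (hE : φ ∈ relCochains (A.pullback p') E n) :
    cochain A L φ ∈ relCochains (A.pullback p) S n :=
  fun σ hσ => cochainEval_eq_zero A fun t ht => (hL σ hσ t ht).elim (hT _) (hE _)

variable {g : C(Z, Z')} (hg : ∀ z, p' (g z) = p z) {T : Set Z'}

theorem mem_boundaries_of_push (hemb : Topology.IsEmbedding g) {x : Chain (A.pullback p) n}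
    (h : chain A (push g hg n) x ∈ pairBoundaries (A.pullback p') (Set.range g) T n) :
    x ∈ boundaries (A.pullback p) (g ⁻¹' T) n := by
  obtain ⟨_, ⟨d', hd', rfl⟩, t, ht, hdt⟩ := Submodule.mem_sup.1 h
  obtain ⟨d, rfl⟩ := exists_chain_push_eq A hg hemb hd'
  have hmem : x - boundary (A.pullback p) n d ∈ chainsIn (A.pullback p) (g ⁻¹' T) n := by
    refine mem_chainsIn_of_push A hg hemb.injective ?_
    rwa [map_sub, ← hdt, boundary_chain_push, add_sub_cancel_left]
  exact Submodule.mem_sup.2 ⟨_, ⟨d, rfl⟩, _, hmem, add_sub_cancel _ _⟩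

theorem exists_cochain_push_eq_of_mem (hemb : Topology.IsEmbedding g)
    {y : Cochain (A.pullback p) n} (hy : y ∈ relCochains (A.pullback p) (g ⁻¹' T) n) :
    ∃ φ ∈ relCochains (A.pullback p') T n, cochain A (push g hg n) φ = y := by
  obtain ⟨φ, rfl, hφ⟩ := exists_cochain_push_eq (p' := p') A hg hemb.injective y
  refine ⟨φ, fun τ hτ => ?_, rfl⟩
  by_cases hex : ∃ σ, g.comp σ = τ
  · obtain ⟨σ, rfl⟩ := hex
    refine (cochain_push_apply_eq_zero_iff A hg).1 (hy σ ?_)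
    rintro _ ⟨x, rfl⟩
    exact hτ ⟨x, rfl⟩
  · exact hφ τ hex

end Op

namespace IsExcisive

variable {e : C(Z, Z')} {he : ∀ z, p' (e z) = p z} {S T : Set Z'}

theorem exists_cycle (h : IsExcisive R p' S T (Set.range e)) (hemb : Topology.IsEmbedding e)
    {c : Chain (A.pullback p') n} (hc : c ∈ pairCycles (A.pullback p') S T n) :
    ∃ x ∈ cycles (A.pullback p) (e ⁻¹' T) n,
      c - Op.chain A (Op.push e he n) x ∈ pairBoundaries (A.pullback p') S T n := by
  obtain ⟨K, hKS, hKT, -, hsm⟩ := h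
  obtain ⟨t, ht, y, hy, hty⟩ := Submodule.mem_sup.1 (Op.chain_mem_sup A (hsm n) hc.1)
  obtain ⟨x, rfl⟩ := Op.exists_chain_push_eq A he hemb hy
  refine ⟨x, Op.mem_cycles_of_push A he hemb.injective ?_, ?_⟩
  · cases n with
    | zero => exact Submodule.mem_top
    | succ n =>
      rw [mem_cycles_succ, ← add_sub_cancel_left t (Op.chain A (Op.push e he (n + 1)) x), hty,
        map_sub, Op.boundary_chain A (Op.bd_comp_deformation K)]
      exact Submodule.sub_mem _ ((Op.Carries.deformation hKT n).chain_mem A hc.2)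
        (Op.boundary_mem_chainsIn A ht)
  · have hsub : c - Op.chain A (Op.push e he n) x = t + Op.chain A (Op.homotopyBd K n) c := by
      rw [sub_eq_iff_eq_add, add_right_comm, hty, Op.chain_deformation_add]
    rw [hsub]
    exact Submodule.add_mem _ (Submodule.mem_sup_right ht) (Op.homotopyBd_chain_mem A hKS hKT hc)

theorem mem_boundaries (h : IsExcisive R p' S T (Set.range e)) (hemb : Topology.IsEmbedding e)
    {x : Chain (A.pullback p) n} (hx : x ∈ cycles (A.pullback p) (e ⁻¹' T) n)
    (hb : Op.chain A (Op.push e he n) x ∈ pairBoundaries (A.pullback p') S T n) :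
    x ∈ boundaries (A.pullback p) (e ⁻¹' T) n := by
  obtain ⟨K, -, hKT, hKE, hsm⟩ := h
  refine Op.mem_boundaries_of_push A he hemb ?_
  have hhomotopy := Op.homotopyBd_chain_mem A hKE hKT
    (n := n) (c := Op.chain A (Op.push e he n) x)
    ⟨Op.push_mem_chainsIn_range A e he x, Op.push_mem_cycles A he (Set.mapsTo_preimage e T) hx⟩
  have hdeform : Op.chain A (Op.deformation K n) (Op.chain A (Op.push e he n) x) ∈
      pairBoundaries (A.pullback p') (Set.range e) T n := by
    obtain ⟨_, ⟨d, hd, rfl⟩, t, ht, hdt⟩ := Submodule.mem_sup.1 hb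
    obtain ⟨d₁, hd₁, d₂, hd₂, hdd⟩ := Submodule.mem_sup.1 (Op.chain_mem_sup A (hsm (n + 1)) hd)
    rw [← hdt, map_add, ← Op.boundary_chain A (Op.bd_comp_deformation K), ← hdd, map_add]
    exact Submodule.add_mem _ (Submodule.add_mem _
      (Submodule.mem_sup_right (Op.boundary_mem_chainsIn A hd₁))
      (Submodule.mem_sup_left ⟨d₂, hd₂, rfl⟩))
      (Submodule.mem_sup_right ((Op.Carries.deformation hKT n).chain_mem A ht))
  have := Submodule.add_mem _ hdeform hhomotopy
  rwa [Op.chain_deformation_add] at this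

theorem exists_pairCocycle (h : IsExcisive R p' S T (Set.range e)) (hemb : Topology.IsEmbedding e)
    {y : Cochain (A.pullback p) n} (hy : y ∈ cocycles (A.pullback p) (e ⁻¹' T) n) :
    ∃ φ ∈ pairCocycles (A.pullback p') S T n,
      y - Op.cochain A (Op.push e he n) φ ∈ coboundaries (A.pullback p) (e ⁻¹' T) n := by
  obtain ⟨K, -, hKT, hKE, hsm⟩ := h
  obtain ⟨φ, hφ, rfl⟩ := Op.exists_cochain_push_eq_of_mem A he hemb hy.1
  have hδ : coboundary (A.pullback p') n φ ∈
      relCochains (A.pullback p') (Set.range e) (n + 1) := by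
    rw [← Op.cochain_push_eq_zero_iff A he hemb, ← Op.coboundary_cochain_push]
    exact ((mem_cocycles _).1 hy).2
  refine ⟨Op.cochain A (Op.deformation K n) φ, (mem_pairCocycles _).2
    ⟨(Op.Carries.deformation hKT n).cochain_mem A hφ, ?_⟩, ?_⟩
  · rw [Op.coboundary_cochain A (Op.bd_comp_deformation K)]
    exact Op.cochain_mem_of_inf A (hsm (n + 1)) (Op.coboundary_mem_relCochains A hφ) hδ
  · obtain ⟨a, ha, b, hb, hab⟩ := Submodule.mem_sup.1
      (Op.homotopyBd_cochain_mem A hKE hKT ((mem_pairCocycles _).2 ⟨hφ, hδ⟩))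
    rw [← map_sub, sub_eq_of_eq_add' (Op.cochain_deformation_add A K φ).symm, ← hab, map_add,
      (Op.cochain_push_eq_zero_iff A he hemb).2 hb, add_zero]
    exact Op.push_mem_coboundaries A he (Set.mapsTo_preimage e T) ha

theorem mem_pairCoboundaries (h : IsExcisive R p' S T (Set.range e))
    (hemb : Topology.IsEmbedding e) {φ : Cochain (A.pullback p') n}
    (hφ : φ ∈ pairCocycles (A.pullback p') S T n)
    (hb : Op.cochain A (Op.push e he n) φ ∈ coboundaries (A.pullback p) (e ⁻¹' T) n) :
    φ ∈ pairCoboundaries (A.pullback p') S T n := by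
  obtain ⟨K, hKS, hKT, -, hsm⟩ := h
  rw [← Op.cochain_deformation_add A K φ]
  refine Submodule.add_mem _ ?_ (Op.homotopyBd_cochain_mem A hKS hKT hφ)
  cases n with
  | zero =>
    exact Submodule.mem_sup_right (Op.cochain_mem_of_inf A (hsm 0) hφ.1
      ((Op.cochain_push_eq_zero_iff A he hemb).1 hb))
  | succ n =>
    obtain ⟨_, hψ', hψφ⟩ := hb
    obtain ⟨ψ, hψ, rfl⟩ := Op.exists_cochain_push_eq_of_mem A he hemb hψ'
    have hT : φ - coboundary (A.pullback p') n ψ ∈ relCochains (A.pullback p') T (n + 1) :=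
      Submodule.sub_mem _ hφ.1 (Op.coboundary_mem_relCochains A hψ)
    have hE : φ - coboundary (A.pullback p') n ψ ∈
        relCochains (A.pullback p') (Set.range e) (n + 1) := by
      rw [← Op.cochain_push_eq_zero_iff A he hemb, map_sub, ← hψφ, Op.coboundary_cochain_push,
        sub_self]
    rw [← sub_add_cancel φ (coboundary (A.pullback p') n ψ), map_add]
    exact Submodule.add_mem _
      (Submodule.mem_sup_right (Op.cochain_mem_of_inf A (hsm (n + 1)) hT hE))
      (Submodule.mem_sup_left ⟨Op.cochain A (Op.deformation K n) ψ,
        (Op.Carries.deformation hKT n).cochain_mem A hψ,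
        Op.coboundary_cochain A (Op.bd_comp_deformation K) ψ⟩)

end IsExcisive

/-! ### Naturality of the cap product -/

theorem push_cap {e : C(Z, Z')} (he : ∀ z, p' (e z) = p z) {k q : ℕ} (h : k + q = n)
    (φ : Cochain (A.pullback p') k) (c : Chain (constSystem R Z) n) :
    Op.chain A (Op.push e he q) (cap (A.pullback p) h (Op.cochain A (Op.push e he k) φ) c) =
      cap (A.pullback p') h φ (Op.chain (constSystem R B) (Op.push e he n) c) := by
  classical
  suffices H : Op.chain A (Op.push e he q) ∘ₗ
      cap (A.pullback p) h (Op.cochain A (Op.push e he k) φ) =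
      cap (A.pullback p') h φ ∘ₗ Op.chain (constSystem R B) (Op.push e he n) from
    LinearMap.congr_fun H c
  refine DFinsupp.lhom_ext' fun σ => LinearMap.ext_ring ?_
  change Op.chain A (Op.push e he q) (cap (A.pullback p) h (Op.cochain A (Op.push e he k) φ)
      (simplexChain R σ)) = cap (A.pullback p') h φ (Op.chain (constSystem R B) (Op.push e he n)
        (simplexChain R σ))
  have h1 : Op.chain (constSystem R B) (Op.push e he n) (simplexChain R σ) =
      simplexChain R (e.comp σ) := Op.chain_push_single (constSystem R B) e he σ (1 : R)
  rw [h1, cap_simplex, cap_simplex, capTerm, capTerm, Op.chain_push_single]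
  refine congrArg (DFinsupp.single (β := fun τ : C(Simplex q, Z') =>
    (A.pullback p').obj ⟨τ (v₀ q)⟩) ((e.comp σ).comp (back h))) ?_
  rw [Op.cochain_push_apply]
  have h2 : Groupoid.inv (Op.overHom (he (σ (front h (v₀ k))))) ≫ (FundamentalGroupoid.map p).map
      (edge σ (front h (v₀ k)) (back h (v₀ q))) ≫ Op.overHom (he (σ (back h (v₀ q)))) =
      (FundamentalGroupoid.map p').map (edge (e.comp σ) (front h (v₀ k)) (back h (v₀ q))) := by
    rw [Groupoid.inv_eq_inv, IsIso.inv_comp_eq]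
    exact (Op.overHom_comp_edge he σ _ _).symm
  have h3 := congrArg (fun g => (A.map g).hom (φ ((e.comp σ).comp (front h)))) h2
  simp only [A.map_comp, ModuleCat.hom_comp, LinearMap.comp_apply] at h3
  exact h3

end Excision

/-! ### Mapping cylinders and the suspension over the base -/

section Cylinders

open unitInterval

variable {X Y W : Type*} [TopologicalSpace X] [TopologicalSpace Y] [TopologicalSpace W]

namespace MappingCylinder

variable {f : C(X, Y)}

/-- The inclusion of the target in the mapping cylinder. -/
def base (f : C(X, Y)) : C(Y, MappingCylinder f) where
  toFun y := Quot.mk _ (Sum.inr y)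
  continuous_toFun := continuous_quot_mk.comp (by fun_prop)

/-- The canonical map of the cylinder on the source to the mapping cylinder. -/
def cyl (f : C(X, Y)) : C(X × I, MappingCylinder f) where
  toFun a := Quot.mk _ (Sum.inl a)
  continuous_toFun := continuous_quot_mk.comp (by fun_prop)

theorem cyl_zero (x : X) : cyl f (x, 0) = base f (f x) := Quot.sound (.glue x)

theorem cyl_one (x : X) : cyl f (x, 1) = top f x := rfl

theorem forall_iff {P : MappingCylinder f → Prop} :
    (∀ z, P z) ↔ (∀ x s, P (cyl f (x, s))) ∧ ∀ y, P (base f y) :=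
  ⟨fun h => ⟨fun _ _ => h _, fun _ => h _⟩, fun h => by
    rintro ⟨⟨x, s⟩ | y⟩
    exacts [h.1 x s, h.2 y]⟩

/-- The map out of the mapping cylinder given by compatible maps on `X × [0, 1]` and on `Y`. -/
def desc (g : C(X × I, W)) (k : C(Y, W)) (h : ∀ x, g (x, 0) = k (f x)) :
    C(MappingCylinder f, W) where
  toFun := Quot.lift (Sum.elim g k) (by rintro _ _ ⟨x⟩; exact h x)
  continuous_toFun := continuous_quot_lift _ (by fun_prop)

/-- The homotopy of maps out of the mapping cylinder given by compatible homotopies on `X × [0, 1]`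
and on `Y`. -/
def descHomotopy (g : C((X × I) × I, W)) (k : C(Y × I, W))
    (h : ∀ x t, g ((x, 0), t) = k (f x, t)) : C(MappingCylinder f × I, W) :=
  (desc g.curry k.curry fun x => ContinuousMap.ext (h x)).uncurry

/-- The height function on the mapping cylinder: `1` on the top, `0` on the base. -/
def height (f : C(X, Y)) : C(MappingCylinder f, ℝ) :=
  desc ⟨fun a => (a.2 : ℝ), by fun_prop⟩ 0 fun _ => rfl

theorem height_base (y : Y) : height f (base f y) = 0 := rfl

theorem height_top (x : X) : height f (top f x) = 1 := rfl

theorem mem_range_top_of_height {z : MappingCylinder f} (h : height f z = 1) :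
    z ∈ Set.range (top f) := by
  revert z
  change ∀ z : MappingCylinder f, height f z = 1 → z ∈ Set.range (top f)
  refine forall_iff.2 ⟨fun x s h => ⟨x, ?_⟩, fun y h => (zero_ne_one h).elim⟩
  rw [← cyl_one, show s = 1 from Subtype.ext h]

theorem eq_of_mk_eq_top {a : (X × I) ⊕ Y} {x : X} (h : Quot.mk (Rel f) a = top f x) :
    a = Sum.inl (x, 1) :=
  let isTop : MappingCylinder f → Prop := Quot.lift (· = Sum.inl (x, 1)) (by rintro _ _ ⟨x'⟩; simp)
  (congrArg isTop h).mpr rfl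

theorem top_injective (f : C(X, Y)) : Function.Injective (top f) := fun x x' h => by
  simpa using eq_of_mk_eq_top (a := Sum.inl (x, 1)) h

theorem mk_preimage_image_top (C : Set X) :
    Quot.mk (Rel f) ⁻¹' (top f '' C) = Sum.inl '' (C ×ˢ {1}) := by
  ext a
  constructor
  · rintro ⟨x, hx, h⟩
    exact ⟨(x, 1), ⟨hx, rfl⟩, (eq_of_mk_eq_top h.symm).symm⟩
  · rintro ⟨⟨x, s⟩, ⟨hx, rfl⟩, rfl⟩
    exact ⟨x, hx, rfl⟩

theorem isEmbedding_top (f : C(X, Y)) : Topology.IsEmbedding (top f) := by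
  refine (Topology.IsClosedEmbedding.of_continuous_injective_isClosedMap (top f).continuous
    (top_injective f) fun C hC => ?_).isEmbedding
  refine (isQuotientMap_quot_mk.isClosed_preimage (s := top f '' C)).1 ?_
  rw [mk_preimage_image_top]
  exact Topology.IsClosedEmbedding.inl.isClosedMap _ (hC.prod isClosed_singleton)

/-- The deformation of the mapping cylinder onto its base. -/
def contraction (f : C(X, Y)) : C(MappingCylinder f × I, MappingCylinder f) :=
  descHomotopy ⟨fun a => cyl f (a.1.1, a.1.2 * σ a.2), by fun_prop⟩
    ⟨fun a => base f a.1, by fun_prop⟩ fun x t => by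
      simp only [ContinuousMap.coe_mk, zero_mul, cyl_zero]

theorem contraction_zero (z : MappingCylinder f) : contraction f (z, 0) = z := by
  revert z
  refine forall_iff.2 ⟨fun x s => ?_, fun _ => rfl⟩
  change cyl f (x, s * σ 0) = _
  simp

theorem contraction_one (z : MappingCylinder f) : contraction f (z, 1) = base f (proj f z) := by
  revert z
  refine forall_iff.2 ⟨fun x s => ?_, fun _ => rfl⟩
  change cyl f (x, s * σ 1) = base f (f x)
  simp [cyl_zero]

theorem proj_contraction (z : MappingCylinder f) (t : I) :
    proj f (contraction f (z, t)) = proj f z := by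
  revert z
  exact forall_iff.2 ⟨fun _ _ => rfl, fun _ => rfl⟩

/-- The extension of a homotopy of the source over the target to the mapping cylinder. -/
def mapHomotopy (Φ : C(X × I, X)) (hΦ : ∀ x t, f (Φ (x, t)) = f x) :
    C(MappingCylinder f × I, MappingCylinder f) :=
  descHomotopy ⟨fun a => cyl f (Φ (a.1.1, a.2), a.1.2), by fun_prop⟩
    ⟨fun a => base f a.1, by fun_prop⟩ fun x t => by
      simp only [ContinuousMap.coe_mk, cyl_zero, hΦ]

section mapHomotopy

variable (Φ : C(X × I, X)) (hΦ : ∀ x t, f (Φ (x, t)) = f x)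

theorem mapHomotopy_zero (h : ∀ x, Φ (x, 0) = x) (z : MappingCylinder f) :
    mapHomotopy Φ hΦ (z, 0) = z := by
  revert z
  refine forall_iff.2 ⟨fun x s => ?_, fun _ => rfl⟩
  change cyl f (Φ (x, 0), s) = _
  rw [h]

theorem proj_mapHomotopy (z : MappingCylinder f) (t : I) :
    proj f (mapHomotopy Φ hΦ (z, t)) = proj f z := by
  revert z
  exact forall_iff.2 ⟨fun x _ => hΦ x t, fun _ => rfl⟩

end mapHomotopy

/-- The homotopy of the unit interval, relative to the end points, that stretches `[0, 1/2]` to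
`[0, 1]`. -/
def stretch : C(I × I, I) where
  toFun a := Set.projIcc 0 1 zero_le_one ((1 + a.2) * a.1 : ℝ)
  continuous_toFun := continuous_projIcc.comp (by fun_prop)

theorem stretch_zero_left (t : I) : stretch (0, t) = 0 := by
  simp [stretch]

theorem stretch_one_left (t : I) : stretch (1, t) = 1 := by
  refine Set.projIcc_of_right_le zero_le_one ?_
  simpa using t.2.1

theorem stretch_zero_right (s : I) : stretch (s, 0) = s := by
  simp [stretch]

theorem stretch_one_right {s : I} (h : 1 / 2 < (s : ℝ)) : stretch (s, 1) = 1 := by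
  refine Set.projIcc_of_right_le zero_le_one ?_
  simp only [Set.Icc.coe_one]
  linarith

/-- The deformation of the mapping cylinder that pushes a collar of its top into the top. -/
def collarPush (f : C(X, Y)) : C(MappingCylinder f × I, MappingCylinder f) :=
  descHomotopy ⟨fun a => cyl f (a.1.1, stretch (a.1.2, a.2)), by fun_prop⟩
    ⟨fun a => base f a.1, by fun_prop⟩ fun x t => by
      simp only [ContinuousMap.coe_mk, stretch_zero_left, cyl_zero]

theorem collarPush_cyl (x : X) (s t : I) :
    collarPush f (cyl f (x, s), t) = cyl f (x, stretch (s, t)) := rfl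

theorem collarPush_top (x : X) (t : I) : collarPush f (top f x, t) = top f x := by
  rw [← cyl_one, collarPush_cyl, stretch_one_left]

theorem collarPush_zero (z : MappingCylinder f) : collarPush f (z, 0) = z := by
  revert z
  refine forall_iff.2 ⟨fun x s => ?_, fun _ => rfl⟩
  rw [collarPush_cyl, stretch_zero_right]

theorem collarPush_one {z : MappingCylinder f} (h : 1 / 2 < height f z) :
    collarPush f (z, 1) ∈ Set.range (top f) := by
  revert z
  change ∀ z : MappingCylinder f, 1 / 2 < height f z → collarPush f (z, 1) ∈ Set.range (top f)
  refine forall_iff.2 ⟨fun x s h => ⟨x, ?_⟩, fun y h => ?_⟩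
  · rw [collarPush_cyl, stretch_one_right h, cyl_one]
  · rw [height_base] at h
    norm_num at h

theorem proj_collarPush (z : MappingCylinder f) (t : I) :
    proj f (collarPush f (z, t)) = proj f z := by
  revert z
  exact forall_iff.2 ⟨fun _ _ => rfl, fun _ => rfl⟩

end MappingCylinder

namespace Double

variable {i : C(X, Y)}

/-- The inclusions of the two copies in the double. -/
def incl (i : C(X, Y)) (j : Bool) : C(Y, Double i) where
  toFun y := Quot.mk _ (j.rec (Sum.inl y) (Sum.inr y))
  continuous_toFun := continuous_quot_mk.comp (by cases j <;> fun_prop)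

theorem incl_apply (x : X) (j j' : Bool) : incl i j (i x) = incl i j' (i x) := by
  have h : incl i false (i x) = incl i true (i x) := Quot.sound (.glue x)
  cases j <;> cases j' <;> simp [h]

theorem forall_iff {P : Double i → Prop} : (∀ z, P z) ↔ ∀ j y, P (incl i j y) :=
  ⟨fun h _ _ => h _, fun h => by
    rintro ⟨y | y⟩
    exacts [h false y, h true y]⟩

/-- The map out of the double given by maps on the two copies, indexed by `Bool`. -/
def desc (g : Bool → C(Y, W)) (h : ∀ x, g false (i x) = g true (i x)) : C(Double i, W) where
  toFun := Quot.lift (Sum.elim (g false) (g true)) (by rintro _ _ ⟨x⟩; exact h x)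
  continuous_toFun := continuous_quot_lift _ (by fun_prop)

theorem desc_incl (g : Bool → C(Y, W)) (h : ∀ x, g false (i x) = g true (i x)) (j : Bool) (y : Y) :
    desc g h (incl i j y) = g j y := by
  cases j <;> rfl

/-- The folding map. -/
def fold (i : C(X, Y)) : C(Double i, Y) := desc (fun _ => ContinuousMap.id Y) fun _ => rfl

theorem fold_incl (j : Bool) (y : Y) : fold i (incl i j y) = y := desc_incl _ _ j y

theorem isEmbedding_incl (j : Bool) : Topology.IsEmbedding (incl i j) :=
  Function.LeftInverse.isEmbedding (fold_incl j) (fold i).continuous (incl i j).continuous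

/-- The double of a homotopy relative to the image of `i`. -/
def mapHomotopy (Φ : C(Y × I, Y)) (hΦ : ∀ x t, Φ (i x, t) = i x) : C(Double i × I, Double i) :=
  (desc (fun j => ((incl i j).comp Φ).curry) fun x => ContinuousMap.ext fun t => by
    simp [hΦ, incl_apply x false true]).uncurry

theorem mapHomotopy_incl (Φ : C(Y × I, Y)) (hΦ : ∀ x t, Φ (i x, t) = i x) (j : Bool) (y : Y)
    (t : I) : mapHomotopy Φ hΦ (incl i j y, t) = incl i j (Φ (y, t)) := by
  cases j <;> rfl

end Double

end Cylinders

section Deformation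

variable {R : Type*} [CommRing R] {B Z : Type*} [TopologicalSpace B] [TopologicalSpace Z]
  {p : C(Z, B)}

namespace Op

variable {U : Bool → Set Z} (hU : ∀ j, IsOpen (U j)) (hcov : ⋃ j, U j = Set.univ)
  (Φ : C(Z × unitInterval, Z)) (hΦ : ∀ z t, p (Φ (z, t)) = p z)

/-- The operators whose deformation first makes the simplices small with respect to the cover `U`
and then moves them by the end `Φ₁` of the deformation `Φ`. -/
def smallPushHomotopy (n : ℕ) : Op R p p n (n + 1) :=
  (push (⟨fun z => Φ (z, 1), by fun_prop⟩ : C(Z, Z)) (hΦ · 1) (n + 1)).comp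
    (smallHomotopy p hU hcov n) - prism Φ hΦ n

theorem carries_smallPushHomotopy {T : Set Z} (hT : ∀ z ∈ T, ∀ t, Φ (z, t) ∈ T) (n : ℕ) :
    (smallPushHomotopy (R := R) hU hcov Φ hΦ n).Carries T T :=
  ((carries_push fun z hz => hT z hz 1).comp (carries_localOp _ T)).sub (carries_prism Φ hΦ hT)

theorem deformation_smallPushHomotopy (h₀ : ∀ z, Φ (z, 0) = z) (n : ℕ) :
    deformation (R := R) (smallPushHomotopy hU hcov Φ hΦ) n =
      (push (⟨fun z => Φ (z, 1), by fun_prop⟩ : C(Z, Z)) (hΦ · 1) n).comp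
        (deformation (smallHomotopy p hU hcov) n) := by
  unfold smallPushHomotopy
  rw [deformation, deformation, homotopyBd_sub, comp_sub, comp_homotopyBd, comp_one,
    homotopyBd_prism Φ hΦ (g₀ := ContinuousMap.id Z) (g₁ := ⟨fun z => Φ (z, 1), by fun_prop⟩)
      h₀ (fun _ => rfl) (fun _ => rfl) (hΦ · 1), push_id]
  abel

end Op

/-- Subdivide the chains of `S` until every simplex lies in one of the two open sets, and then
deform. -/
theorem IsExcisive.of_deformation {S T E : Set Z} {U : Bool → Set Z} (hU : ∀ j, IsOpen (U j))
    (hcov : ⋃ j, U j = Set.univ) (Φ : C(Z × unitInterval, Z)) (hΦ : ∀ z t, p (Φ (z, t)) = p z)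
    (h₀ : ∀ z, Φ (z, 0) = z) (hS : ∀ z ∈ S, ∀ t, Φ (z, t) ∈ S) (hT : ∀ z ∈ T, ∀ t, Φ (z, t) ∈ T)
    (hE : ∀ z ∈ E, ∀ t, Φ (z, t) ∈ E) (hUT : ∀ z ∈ S, z ∈ U false → Φ (z, 1) ∈ T)
    (hUE : ∀ z ∈ S, z ∈ U true → Φ (z, 1) ∈ E) : IsExcisive R p S T E := by
  refine ⟨Op.smallPushHomotopy hU hcov Φ hΦ, Op.carries_smallPushHomotopy hU hcov Φ hΦ hS,
    Op.carries_smallPushHomotopy hU hcov Φ hΦ hT, Op.carries_smallPushHomotopy hU hcov Φ hΦ hE,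
    fun n σ hσ t ht => ?_⟩
  rw [Op.deformation_smallPushHomotopy hU hcov Φ hΦ h₀] at ht
  obtain ⟨u, hu, v, hv, rfl⟩ := Op.exists_of_mem_support_extend ht
  obtain rfl := Finset.mem_singleton.1 (Finsupp.support_single_subset hv)
  have huS : Set.range u.1 ⊆ S :=
    Op.Carries.deformation (fun n => Op.carries_localOp _ S) n σ hσ u hu
  obtain ⟨j, hj⟩ := Op.isSmall_of_mem_support hU hcov σ hu
  cases j
  · left
    rintro _ ⟨x, rfl⟩
    exact hUT _ (huS ⟨x, rfl⟩) (hj ⟨x, rfl⟩)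
  · right
    rintro _ ⟨x, rfl⟩
    exact hUE _ (huS ⟨x, rfl⟩) (hj ⟨x, rfl⟩)

end Deformation

section Suspension

open MappingCylinder

variable {X B : Type*} [TopologicalSpace X] [TopologicalSpace B] (f : C(X, B))

/-- The mapping cylinder of the canonical map of the suspension `SX → B`. -/
abbrev SusCylinder := MappingCylinder (suspensionMap f)

/-- The suspension `SX` as a subspace of the mapping cylinder of `SX → B`. -/
abbrev susTop : Set (SusCylinder f) := Set.range (top (suspensionMap f))

/-- The inclusions of the two mapping cylinders of `f` in the mapping cylinder of the
suspension. -/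
def susIncl (j : Bool) : C(MappingCylinder f, SusCylinder f) :=
  (top (suspensionMap f)).comp (Double.incl (top f) j)

/-- The two mapping cylinders of `f` as subspaces of the mapping cylinder of the suspension. -/
abbrev susSide (j : Bool) : Set (SusCylinder f) := Set.range (susIncl f j)

theorem suspensionMap_incl (j : Bool) (m : MappingCylinder f) :
    suspensionMap f (Double.incl (top f) j m) = proj f m := by
  cases j <;> rfl

theorem proj_susIncl (j : Bool) (m : MappingCylinder f) :
    proj (suspensionMap f) (susIncl f j m) = proj f m :=
  suspensionMap_incl f j m

theorem isEmbedding_susIncl (j : Bool) : Topology.IsEmbedding (susIncl f j) :=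
  (isEmbedding_top _).comp (Double.isEmbedding_incl j)

theorem susSide_subset_susTop (j : Bool) : susSide f j ⊆ susTop f := by
  rintro _ ⟨m, rfl⟩
  exact ⟨_, rfl⟩

/-- The signed height on the suspension; it vanishes on `X`, and it is `1` and `-1` on the two
copies of the base. -/
def signedHeight : C(Suspension f, ℝ) :=
  Double.desc (fun j => (j.rec 1 (-1) : ℝ) • (1 - height f)) fun x => by
    simp [height_top]

theorem signedHeight_incl_false (m : MappingCylinder f) :
    signedHeight f (Double.incl (top f) false m) = 1 - height f m := by
  simp [signedHeight, Double.desc_incl]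

theorem signedHeight_incl_true (m : MappingCylinder f) :
    signedHeight f (Double.incl (top f) true m) = -(1 - height f m) := by
  simp [signedHeight, Double.desc_incl]

theorem preimage_susSide : susIncl f true ⁻¹' susSide f false =
    Set.range (top f) := by
  ext m
  constructor
  · rintro ⟨m', h⟩
    have h1 : Double.incl (top f) false m' = Double.incl (top f) true m :=
      top_injective _ h
    have h2 : m' = m := by
      have := congrArg (Double.fold (top f)) h1
      rwa [Double.fold_incl, Double.fold_incl] at this
    subst h2
    have h3 := congrArg (signedHeight f) h1
    rw [signedHeight_incl_false, signedHeight_incl_true] at h3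
    exact mem_range_top_of_height (by linarith)
  · rintro ⟨x, rfl⟩
    exact ⟨top f x, congrArg (top (suspensionMap f)) (Double.incl_apply x false true)⟩

theorem isChainEquiv_susIncl (R : Type*) [CommRing R] (j : Bool) :
    IsChainEquiv R (proj_susIncl f j) := by
  refine ⟨(base f).comp (proj (suspensionMap f)), fun _ => rfl,
    .of_homotopy (contraction f) proj_contraction _ _ contraction_zero fun z => ?_,
    .trans (g' := (base (suspensionMap f)).comp (proj (suspensionMap f))) (hg' := fun _ => rfl)
      (.of_homotopy ⟨fun a => cyl (suspensionMap f)
        (Double.incl (top f) j (base f (proj (suspensionMap f) a.1)), a.2), by fun_prop⟩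
        (fun z t => ?_) _ _ (fun z => ?_) fun _ => rfl)
      (.of_homotopy (contraction (suspensionMap f)) proj_contraction _ _
        contraction_zero contraction_one)⟩
  · rw [contraction_one]
    exact congrArg (base f) (proj_susIncl f j z).symm
  · exact suspensionMap_incl f j _
  · exact (cyl_zero _).trans (congrArg (base (suspensionMap f)) (suspensionMap_incl f j _))

/-- The deformation of the suspension that pushes a collar of `X` on either side into `X`. -/
def suspensionCollarPush : C(Suspension f × unitInterval, Suspension f) :=
  Double.mapHomotopy (collarPush f) collarPush_top

theorem suspensionCollarPush_incl (j : Bool) (m : MappingCylinder f) (t : unitInterval) :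
    suspensionCollarPush f (Double.incl (top f) j m, t) =
      Double.incl (top f) j (collarPush f (m, t)) :=
  Double.mapHomotopy_incl _ _ j m t

theorem suspensionMap_suspensionCollarPush (y : Suspension f) (t : unitInterval) :
    suspensionMap f (suspensionCollarPush f (y, t)) = suspensionMap f y := by
  revert y
  refine Double.forall_iff.2 fun j m => ?_
  rw [suspensionCollarPush_incl, suspensionMap_incl, suspensionMap_incl, proj_collarPush]

theorem suspensionCollarPush_zero (y : Suspension f) : suspensionCollarPush f (y, 0) = y := by
  revert y
  refine Double.forall_iff.2 fun j m => ?_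
  rw [suspensionCollarPush_incl, collarPush_zero]

/-- The extension of `suspensionCollarPush` to the mapping cylinder of the suspension. -/
def susCollarPush : C(SusCylinder f × unitInterval, SusCylinder f) :=
  mapHomotopy (suspensionCollarPush f) (suspensionMap_suspensionCollarPush f)

theorem susCollarPush_susIncl (j : Bool) (m : MappingCylinder f) (t : unitInterval) :
    susCollarPush f (susIncl f j m, t) = susIncl f j (collarPush f (m, t)) :=
  congrArg (top (suspensionMap f)) (suspensionCollarPush_incl f j m t)

theorem susCollarPush_mem_susSide (j : Bool) :
    ∀ z ∈ susSide f j, ∀ t, susCollarPush f (z, t) ∈ susSide f j := by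
  rintro _ ⟨m, rfl⟩ t
  exact ⟨_, (susCollarPush_susIncl f j m t).symm⟩

/-- The open neighbourhood of the copy `j` of the mapping cylinder of `f` that reaches half way
into the other copy, as the preimage of a half line under a signed height. -/
def susNhd (j : Bool) : Set (SusCylinder f) :=
  desc ⟨fun a => (a.2 : ℝ) * signedHeight f a.1, by fun_prop⟩ 0 (fun _ => zero_mul _) ⁻¹'
    (j.rec (Set.Ioi (-(1 / 2))) (Set.Iio (1 / 2)))

theorem isOpen_susNhd (j : Bool) : IsOpen (susNhd f j) := by
  cases j
  exacts [isOpen_Ioi.preimage (map_continuous _), isOpen_Iio.preimage (map_continuous _)]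

theorem iUnion_susNhd : ⋃ j, susNhd f j = Set.univ := by
  refine Set.eq_univ_of_forall fun z => Set.mem_iUnion.2 ?_
  by_cases h : z ∈ susNhd f true
  · exact ⟨true, h⟩
  · exact ⟨false, lt_of_lt_of_le (by norm_num : -(1 / 2 : ℝ) < 1 / 2) (not_lt.1 h)⟩

theorem half_lt_height_of_mem_susNhd {j : Bool} {m : MappingCylinder f}
    (h : susIncl f (!j) m ∈ susNhd f j) : 1 / 2 < height f m := by
  cases j
  · have h1 : -(1 / 2) < 1 * signedHeight f (Double.incl (top f) true m) := h
    rw [one_mul, signedHeight_incl_true] at h1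
    linarith
  · have h1 : 1 * signedHeight f (Double.incl (top f) false m) < 1 / 2 := h
    rw [one_mul, signedHeight_incl_false] at h1
    linarith

theorem susCollarPush_one_mem_susSide (j : Bool) :
    ∀ z ∈ susTop f, z ∈ susNhd f j →
      susCollarPush f (z, 1) ∈ susSide f j := by
  rintro _ ⟨y, rfl⟩
  revert y
  refine Double.forall_iff.2 fun j' m hm => ?_
  obtain rfl | rfl : j' = j ∨ j' = !j := by cases j <;> cases j' <;> simp
  · exact susCollarPush_mem_susSide f j' _ ⟨m, rfl⟩ 1
  · obtain ⟨x, hx⟩ := collarPush_one (half_lt_height_of_mem_susNhd f hm)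
    refine ⟨top f x, Eq.trans ?_ (susCollarPush_susIncl f (!j) m 1).symm⟩
    rw [← hx]
    exact congrArg (top (suspensionMap f)) (Double.incl_apply x j (!j))

theorem isExcisive_susIncl (R : Type*) [CommRing R] :
    IsExcisive R (proj (suspensionMap f)) (susTop f)
      (susSide f false) (susSide f true) := by
  refine .of_deformation (isOpen_susNhd f) (iUnion_susNhd f) (susCollarPush f)
    (proj_mapHomotopy _ _) (mapHomotopy_zero _ _ (suspensionCollarPush_zero f)) ?_
    (susCollarPush_mem_susSide f false) (susCollarPush_mem_susSide f true)
    (susCollarPush_one_mem_susSide f false) (susCollarPush_one_mem_susSide f true)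
  rintro _ ⟨y, rfl⟩ t
  exact ⟨_, rfl⟩

end Suspension

/-! ### Maps of subquotients -/

/-- The linear map `F` induces an isomorphism of the subquotients `U / V` and `U' / V'`; stated by
elements, so that maps of (co)homology groups can be compared on representatives. -/
structure IsSubquotientIso {R M M' : Type*} [CommRing R] [AddCommGroup M] [Module R M]
    [AddCommGroup M'] [Module R M'] (F : M →ₗ[R] M') (U V : Submodule R M)
    (U' V' : Submodule R M') : Prop where
  map : ∀ x ∈ U, F x ∈ U'
  map_denom : ∀ x ∈ V, F x ∈ V'
  inj : ∀ x ∈ U, F x ∈ V' → x ∈ V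
  surj : ∀ y ∈ U', ∃ x ∈ U, y - F x ∈ V'

theorem subsingleton_subquotient_iff {R M : Type*} [CommRing R] [AddCommGroup M] [Module R M]
    {U V : Submodule R M} : Subsingleton (U ⧸ V.submoduleOf U) ↔ U ≤ V := by
  rw [Submodule.Quotient.subsingleton_iff, Submodule.submoduleOf, Submodule.comap_subtype_eq_top]

namespace IsSubquotientIso

variable {R M M' M'' N N' : Type*} [CommRing R] [AddCommGroup M] [Module R M]
  [AddCommGroup M'] [Module R M'] [AddCommGroup M''] [Module R M''] [AddCommGroup N] [Module R N]
  {F : M →ₗ[R] M'} {U V : Submodule R M} {U' V' : Submodule R M'} {U'' V'' : Submodule R M''}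

theorem comp {G : M' →ₗ[R] M''} (hG : IsSubquotientIso G U' V' U'' V'')
    (hF : IsSubquotientIso F U V U' V') : IsSubquotientIso (G ∘ₗ F) U V U'' V'' where
  map x hx := hG.map _ (hF.map x hx)
  map_denom x hx := hG.map_denom _ (hF.map_denom x hx)
  inj x hx h := hF.inj x hx (hG.inj _ (hF.map x hx) h)
  surj z hz := by
    obtain ⟨y, hy, hyz⟩ := hG.surj z hz
    obtain ⟨x, hx, hxy⟩ := hF.surj y hy
    refine ⟨x, hx, ?_⟩
    have := Submodule.add_mem _ hyz (hG.map_denom _ hxy)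
    rwa [map_sub, sub_add_sub_cancel] at this

theorem smul (u : Rˣ) (hF : IsSubquotientIso F U V U' V') :
    IsSubquotientIso ((u : R) • F) U V U' V' where
  map x hx := Submodule.smul_mem _ _ (hF.map x hx)
  map_denom x hx := Submodule.smul_mem _ _ (hF.map_denom x hx)
  inj x hx h := hF.inj x hx (by
    have := Submodule.smul_mem _ (↑u⁻¹ : R) h
    rwa [LinearMap.smul_apply, smul_smul, Units.inv_mul, one_smul] at this)
  surj y hy := by
    obtain ⟨x, hx, hxy⟩ := hF.surj y hy
    refine ⟨(↑u⁻¹ : R) • x, Submodule.smul_mem _ _ hx, ?_⟩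
    rwa [LinearMap.smul_apply, map_smul, smul_smul, Units.mul_inv, one_smul]

/-- The fourth side of a square, commutative up to elements of the denominator, is an isomorphism
if the other three are. -/
theorem of_square {W Q : Submodule R N} {C : M' →ₗ[R] M''} {G : M'' →ₗ[R] N} {H : M →ₗ[R] N}
    (hF : IsSubquotientIso F U V U' V') (hG : IsSubquotientIso G U'' V'' W Q)
    (hH : IsSubquotientIso H U V W Q) (hC : ∀ x ∈ U', C x ∈ U'') (hCV : ∀ x ∈ V', C x ∈ V'')
    (hcomm : ∀ x ∈ U, H x - G (C (F x)) ∈ Q) : IsSubquotientIso C U' V' U'' V'' where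
  map := hC
  map_denom := hCV
  inj x hx h := by
    obtain ⟨w, hw, hwx⟩ := hF.surj x hx
    have h1 : C (F w) ∈ V'' := by
      have := Submodule.sub_mem _ h (hCV _ hwx)
      rwa [← map_sub, sub_sub_cancel] at this
    have h2 : H w ∈ Q := by
      have := Submodule.add_mem _ (hcomm w hw) (hG.map_denom _ h1)
      rwa [sub_add_cancel] at this
    have := Submodule.add_mem _ hwx (hF.map_denom _ (hH.inj w hw h2))
    rwa [sub_add_cancel] at this
  surj y hy := by
    obtain ⟨w, hw, hwy⟩ := hH.surj (G y) (hG.map y hy)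
    refine ⟨F w, hF.map w hw,
      hG.inj _ (Submodule.sub_mem _ hy (hC _ (hF.map w hw))) ?_⟩
    have := Submodule.add_mem _ hwy (hcomm w hw)
    rwa [sub_add_sub_cancel, ← map_sub] at this

/-- The isomorphism of subquotients. -/
def toEquiv (h : IsSubquotientIso F U V U' V') :
    (U ⧸ V.submoduleOf U) ≃ₗ[R] U' ⧸ V'.submoduleOf U' :=
  LinearEquiv.ofBijective
    (Submodule.mapQ (V.submoduleOf U) (V'.submoduleOf U') (F.restrict h.map)
      fun x hx => h.map_denom x hx) (by
    constructor
    · rw [injective_iff_map_eq_zero]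
      intro x hx
      obtain ⟨x, rfl⟩ := Submodule.Quotient.mk_surjective _ x
      exact (Submodule.Quotient.mk_eq_zero _).2
        (h.inj x x.2 ((Submodule.Quotient.mk_eq_zero (V'.submoduleOf U')).1 hx))
    · intro y
      obtain ⟨y, rfl⟩ := Submodule.Quotient.mk_surjective _ y
      obtain ⟨x, hx, hxy⟩ := h.surj y y.2
      exact ⟨Submodule.Quotient.mk ⟨x, hx⟩,
        ((Submodule.Quotient.eq (V'.submoduleOf U') (x := y)).2 hxy).symm⟩)

theorem toEquiv_mk (h : IsSubquotientIso F U V U' V') {x : M} (hx : x ∈ U) :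
    h.toEquiv (Submodule.Quotient.mk ⟨x, hx⟩) = Submodule.Quotient.mk ⟨F x, h.map x hx⟩ := rfl

theorem sub_mem_of_toEquiv_eq {F' : M'' →ₗ[R] M'} (h : IsSubquotientIso F U V U' V')
    (h' : IsSubquotientIso F' U'' V'' U' V') {x : M} {hx : x ∈ U} {y : M''} {hy : y ∈ U''}
    (hxy : h.toEquiv (Submodule.Quotient.mk ⟨x, hx⟩) =
      h'.toEquiv (Submodule.Quotient.mk ⟨y, hy⟩)) : F x - F' y ∈ V' :=
  (Submodule.Quotient.eq (V'.submoduleOf U')).1 hxy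

theorem le_iff (h : IsSubquotientIso F U V U' V') : U ≤ V ↔ U' ≤ V' := by
  rw [← subsingleton_subquotient_iff, ← subsingleton_subquotient_iff]
  exact h.toEquiv.toEquiv.subsingleton_congr

end IsSubquotientIso

section CapBijective

variable {R : Type*} [CommRing R] {Z : Type*} [TopologicalSpace Z] (A : LocalSystem R Z)

theorem homologyCap_mk {S S' T : Set Z} (hS : S' ⊆ S ∨ S' ⊆ T) {p q n : ℕ}
    (h : p + q = n) {c : Chain (constSystem R Z) n} (hc : c ∈ cycles (constSystem R Z) S' n)
    {φ : Cochain A p} (hφ : φ ∈ cocycles A S p) :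
    homologyCap A hS h (Submodule.Quotient.mk ⟨c, hc⟩) (Submodule.Quotient.mk ⟨φ, hφ⟩) =
      Submodule.Quotient.mk ⟨cap A h φ c, cap_mem_cycles A hS h hφ hc⟩ := rfl

theorem bijective_homologyCap_iff {S S' T : Set Z} (hS : S' ⊆ S ∨ S' ⊆ T) {p q n : ℕ}
    (h : p + q = n) {c : Chain (constSystem R Z) n} (hc : c ∈ cycles (constSystem R Z) S' n) :
    Function.Bijective (homologyCap A hS h (Submodule.Quotient.mk ⟨c, hc⟩)) ↔
      IsSubquotientIso ((cap A h).flip c) (cocycles A S p) (coboundaries A S p)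
        (cycles A T q) (boundaries A T q) := by
  constructor
  · intro hb
    refine ⟨fun φ hφ => cap_mem_cycles A hS h hφ hc,
      fun φ hφ => cap_mem_boundaries_left A hS h hφ hc, fun φ hφ hb0 => ?_, fun y hy => ?_⟩
    · refine (Submodule.Quotient.mk_eq_zero _ (x := ⟨φ, hφ⟩)).1
        (hb.1 (Eq.trans ?_ (map_zero _).symm))
      rw [homologyCap_mk]
      exact (Submodule.Quotient.mk_eq_zero _).2 hb0
    · obtain ⟨φ, hφ⟩ := hb.2 (Submodule.Quotient.mk ⟨y, hy⟩)
      obtain ⟨⟨φ, hφ'⟩, rfl⟩ := Submodule.Quotient.mk_surjective _ φ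
      rw [homologyCap_mk] at hφ
      exact ⟨φ, hφ', (Submodule.Quotient.eq
        ((boundaries A T q).submoduleOf (cycles A T q))).1 hφ.symm⟩
  · intro hiso
    convert hiso.toEquiv.bijective using 1
    funext φ
    obtain ⟨⟨φ, hφ⟩, rfl⟩ := Submodule.Quotient.mk_surjective _ φ
    exact (homologyCap_mk A hS h hc hφ).trans (hiso.toEquiv_mk hφ).symm

end CapBijective

/-! ### The exact sequence of the triple and the Leibniz rule -/

section Triple

variable {R : Type*} [CommRing R] {B Z Z' : Type*} [TopologicalSpace B]
  [TopologicalSpace Z] [TopologicalSpace Z'] {p : C(Z, B)} {p' : C(Z', B)} (A : LocalSystem R B)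

theorem isSubquotientIso_boundary {S T : Set Z} (hTS : T ⊆ S)
    (hT : ∀ n, cycles (A.pullback p) T n ≤ boundaries (A.pullback p) T n) (n : ℕ) :
    IsSubquotientIso (boundary (A.pullback p) n) (cycles (A.pullback p) S (n + 1))
      (boundaries (A.pullback p) S (n + 1)) (pairCycles (A.pullback p) S T n)
      (pairBoundaries (A.pullback p) S T n) where
  map c hc := ⟨hc, cycles_mono _ (Set.empty_subset _) n (Op.boundary_mem_cycles A c)⟩
  map_denom c hc := by
    obtain ⟨_, ⟨d, rfl⟩, s, hs, rfl⟩ := Submodule.mem_sup.1 hc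
    rw [map_add, Op.boundary_boundary, zero_add]
    exact Submodule.mem_sup_left ⟨s, hs, rfl⟩
  inj c _ h := by
    obtain ⟨_, ⟨s, hs, rfl⟩, t, ht, hst⟩ := Submodule.mem_sup.1 h
    have h1 : c - s ∈ cycles (A.pullback p) T (n + 1) := by
      rw [mem_cycles_succ, map_sub, ← hst, add_sub_cancel_left]
      exact ht
    have := Submodule.add_mem _ (boundaries_mono _ hTS _ (hT _ h1)) (Submodule.mem_sup_right hs)
    rwa [sub_add_cancel] at this
  surj y hy := by
    obtain ⟨_, ⟨d, rfl⟩, t, ht, rfl⟩ := Submodule.mem_sup.1 (hT n hy.2)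
    refine ⟨d, ?_, ?_⟩
    · have := Submodule.sub_mem _ hy.1 (chainsIn_mono _ hTS n ht)
      rwa [add_sub_cancel_right] at this
    · rw [add_sub_cancel_left]
      exact Submodule.mem_sup_right ht

theorem isSubquotientIso_coboundary {S T : Set Z} (hTS : T ⊆ S)
    (hT : ∀ n, cocycles (A.pullback p) T n ≤ coboundaries (A.pullback p) T n) (n : ℕ) :
    IsSubquotientIso (coboundary (A.pullback p) n) (pairCocycles (A.pullback p) S T n)
      (pairCoboundaries (A.pullback p) S T n) (cocycles (A.pullback p) S (n + 1))
      (coboundaries (A.pullback p) S (n + 1)) where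
  map φ hφ := (mem_cocycles _).2 ⟨hφ.2, Op.coboundary_coboundary A φ⟩
  map_denom φ hφ := by
    obtain ⟨ψ, hψ, s, hs, rfl⟩ := Submodule.mem_sup.1 hφ
    have h0 : coboundary (A.pullback p) n ψ = 0 := by
      cases n with
      | zero =>
        obtain rfl : ψ = 0 := hψ
        exact map_zero _
      | succ n =>
        obtain ⟨χ, -, rfl⟩ := hψ
        exact Op.coboundary_coboundary A χ
    rw [map_add, h0, zero_add]
    exact ⟨s, hs, rfl⟩
  inj φ hφ h := by
    obtain ⟨ψ, hψ, hψφ⟩ := h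
    have h1 : φ - ψ ∈ cocycles (A.pullback p) T n :=
      (mem_cocycles _).2 ⟨Submodule.sub_mem _ hφ.1 (relCochains_anti _ hTS n hψ), by
        rw [map_sub, hψφ, sub_self]⟩
    exact Submodule.mem_sup.2 ⟨φ - ψ, hT n h1, ψ, hψ, sub_add_cancel _ _⟩
  surj y hy := by
    obtain ⟨φ, hφ, rfl⟩ := hT (n + 1) (cocycles_anti _ hTS _ hy)
    exact ⟨φ, ⟨hφ, hy.1⟩, by rw [sub_self]; exact Submodule.zero_mem _⟩

variable {e : C(Z, Z')} {he : ∀ z, p' (e z) = p z} {S T : Set Z'} {n : ℕ}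

theorem IsChainEquiv.isSubquotientIso_chain (h : IsChainEquiv R he) :
    IsSubquotientIso (Op.chain A (Op.push e he n)) (cycles (A.pullback p) ∅ n)
      (boundaries (A.pullback p) ∅ n) (cycles (A.pullback p') ∅ n)
      (boundaries (A.pullback p') ∅ n) where
  map _ := Op.push_mem_cycles A he (Set.mapsTo_empty _ _)
  map_denom _ := Op.push_mem_boundaries A he (Set.mapsTo_empty _ _)
  inj _ := h.mem_boundaries A
  surj _ := h.exists_cycle A

theorem IsChainEquiv.isSubquotientIso_cochain (h : IsChainEquiv R he) :
    IsSubquotientIso (Op.cochain A (Op.push e he n)) (cocycles (A.pullback p') ∅ n)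
      (coboundaries (A.pullback p') ∅ n) (cocycles (A.pullback p) ∅ n)
      (coboundaries (A.pullback p) ∅ n) where
  map _ := Op.push_mem_cocycles A he (Set.mapsTo_empty _ _)
  map_denom _ := Op.push_mem_coboundaries A he (Set.mapsTo_empty _ _)
  inj _ := h.mem_coboundaries A
  surj _ := h.exists_cocycle A

theorem IsExcisive.isSubquotientIso_chain (h : IsExcisive R p' S T (Set.range e))
    (hemb : Topology.IsEmbedding e) (hS : Set.range e ⊆ S) :
    IsSubquotientIso (Op.chain A (Op.push e he n)) (cycles (A.pullback p) (e ⁻¹' T) n)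
      (boundaries (A.pullback p) (e ⁻¹' T) n) (pairCycles (A.pullback p') S T n)
      (pairBoundaries (A.pullback p') S T n) where
  map c hc := ⟨chainsIn_mono _ hS n (Op.push_mem_chainsIn_range A e he c),
    Op.push_mem_cycles A he (Set.mapsTo_preimage e T) hc⟩
  map_denom c hc := by
    obtain ⟨_, ⟨d, rfl⟩, t, ht, rfl⟩ := Submodule.mem_sup.1 hc
    rw [map_add, ← Op.boundary_chain_push]
    exact Submodule.add_mem _
      (Submodule.mem_sup_left
        ⟨_, chainsIn_mono _ hS _ (Op.push_mem_chainsIn_range A e he d), rfl⟩)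
      (Submodule.mem_sup_right ((Op.carries_push (Set.mapsTo_preimage e T)).chain_mem A ht))
  inj _ := h.mem_boundaries A hemb
  surj _ := h.exists_cycle A hemb

theorem IsExcisive.isSubquotientIso_cochain (h : IsExcisive R p' S T (Set.range e))
    (hemb : Topology.IsEmbedding e) (hS : Set.range e ⊆ S) :
    IsSubquotientIso (Op.cochain A (Op.push e he n)) (pairCocycles (A.pullback p') S T n)
      (pairCoboundaries (A.pullback p') S T n) (cocycles (A.pullback p) (e ⁻¹' T) n)
      (coboundaries (A.pullback p) (e ⁻¹' T) n) where
  map φ hφ := (mem_cocycles _).2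
    ⟨(Op.carries_push (Set.mapsTo_preimage e T)).cochain_mem A hφ.1, by
      rw [Op.coboundary_cochain_push]
      exact (Op.cochain_push_eq_zero_iff A he hemb).2 (relCochains_anti _ hS _ hφ.2)⟩
  map_denom φ hφ := by
    obtain ⟨ψ, hψ, s, hs, rfl⟩ := Submodule.mem_sup.1 hφ
    rw [map_add, (Op.cochain_push_eq_zero_iff A he hemb).2 (relCochains_anti _ hS _ hs), add_zero]
    exact Op.push_mem_coboundaries A he (Set.mapsTo_preimage e T) hψ
  inj _ := h.mem_pairCoboundaries A hemb
  surj _ := h.exists_pairCocycle A hemb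

theorem cap_mem_pairBoundaries {k q : ℕ} (h : k + q = n) {φ : Cochain (A.pullback p) k}
    (hφ : φ ∈ cocycles (A.pullback p) ∅ k) {S T : Set Z} {x : Chain (constSystem R Z) n}
    (hx : x ∈ pairBoundaries (constSystem R Z) S T n) :
    cap (A.pullback p) h φ x ∈ pairBoundaries (A.pullback p) S T q := by
  obtain ⟨_, ⟨s, hs, rfl⟩, t, ht, rfl⟩ := Submodule.mem_sup.1 hx
  rw [map_add, cap_boundary, ((mem_cocycles _).1 hφ).2, map_zero, LinearMap.zero_apply, zero_add]
  exact Submodule.add_mem _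
    (Submodule.mem_sup_left (Submodule.smul_mem _ _
      ⟨_, cap_mem_chainsIn _ (Or.inr subset_rfl) _ hφ.1 hs, rfl⟩))
    (Submodule.mem_sup_right (cap_mem_chainsIn _ (Or.inr subset_rfl) _ hφ.1 ht))

theorem cap_eq_zero {k q : ℕ} (h : k + q = n) {S : Set Z} {φ : Cochain (A.pullback p) k}
    (hφ : φ ∈ relCochains (A.pullback p) S k) {c : Chain (constSystem R Z) n}
    (hc : c ∈ chainsIn (constSystem R Z) S n) : cap (A.pullback p) h φ c = 0 := by
  have := cap_mem_chainsIn (A.pullback p) (T := ∅) (Or.inl subset_rfl) h hφ hc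
  rwa [chainsIn_empty] at this

theorem cap_mem_boundaries_of_pairCocycles {k q : ℕ} (h : k + q = n)
    {φ : Cochain (A.pullback p) k} {S T : Set Z} (hφ : φ ∈ pairCocycles (A.pullback p) S T k)
    {x : Chain (constSystem R Z) n} (hx : x ∈ pairBoundaries (constSystem R Z) S T n) :
    cap (A.pullback p) h φ x ∈ boundaries (A.pullback p) ∅ q := by
  obtain ⟨_, ⟨s, hs, rfl⟩, t, ht, rfl⟩ := Submodule.mem_sup.1 hx
  rw [map_add, cap_boundary, cap_eq_zero A _ hφ.2 hs, cap_eq_zero A _ hφ.1 ht, zero_add, add_zero]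
  exact Submodule.smul_mem _ _ (Submodule.mem_sup_left ⟨_, rfl⟩)

variable {k q : ℕ} (h : k + q = n) {c : Chain (constSystem R Z') (n + 1)}
  {x : Chain (constSystem R Z') n} {c' : Chain (constSystem R Z) n}

/-- By the Leibniz rule `φ ∩ ∂c = (-1)^k ∂(φ ∩ c)` for an absolute cocycle `φ`. -/
theorem boundary_cap_sub_mem (hx : x ∈ pairBoundaries (constSystem R Z') S T n)
    (hcc : Op.chain (constSystem R B) (Op.push e he n) c' = boundary (constSystem R Z') n c - x)
    {φ : Cochain (A.pullback p') k} (hφ : φ ∈ cocycles (A.pullback p') ∅ k) :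
    (-1 : R) ^ k • boundary (A.pullback p') q
        (cap (A.pullback p') (show k + (q + 1) = n + 1 by omega) φ c) -
      Op.chain A (Op.push e he q) (cap (A.pullback p) h (Op.cochain A (Op.push e he k) φ) c') ∈
      pairBoundaries (A.pullback p') S T q := by
  have hleibniz := cap_boundary (A.pullback p') h φ c
  rw [((mem_cocycles _).1 hφ).2, map_zero, LinearMap.zero_apply, zero_add] at hleibniz
  rw [push_cap, hcc, ← hleibniz, map_sub, sub_sub_cancel]
  exact cap_mem_pairBoundaries A h hφ hx

/-- By the Leibniz rule `δφ ∩ c` and `φ ∩ ∂c` are homologous. -/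
theorem cap_coboundary_sub_mem (hx : x ∈ pairBoundaries (constSystem R Z') S T n)
    (hcc : Op.chain (constSystem R B) (Op.push e he n) c' = boundary (constSystem R Z') n c - x)
    {φ : Cochain (A.pullback p') k} (hφ : φ ∈ pairCocycles (A.pullback p') S T k) :
    cap (A.pullback p') (show k + 1 + q = n + 1 by omega) (coboundary (A.pullback p') k φ) c -
      Op.chain A (Op.push e he q) (cap (A.pullback p) h (Op.cochain A (Op.push e he k) φ) c') ∈
      boundaries (A.pullback p') ∅ q := by
  have hleibniz := cap_boundary (A.pullback p') h φ c
  rw [push_cap, hcc, map_sub, eq_sub_of_add_eq hleibniz.symm, sub_sub_sub_comm, sub_self,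
    zero_sub, neg_sub]
  exact Submodule.sub_mem _ (cap_mem_boundaries_of_pairCocycles A h hφ hx)
    (Submodule.smul_mem _ _ (Submodule.mem_sup_left ⟨_, rfl⟩))

end Triple

/-! ### Desuspension of Poincaré duality -/

section Desuspension

open MappingCylinder

variable {R : Type*} [CommRing R] {X B : Type*} [TopologicalSpace X] [TopologicalSpace B]
  (f : C(X, B)) (A : LocalSystem R B)

theorem cycles_susSide_le_boundaries (j : Bool) (k : ℕ) :
    cycles (A.pullback (proj (suspensionMap f))) (susSide f j) k ≤
      boundaries (A.pullback (proj (suspensionMap f))) (susSide f j) k :=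
  (isChainEquiv_susIncl f R j).cycles_range_le_boundaries A (isEmbedding_susIncl f j)

theorem cocycles_susSide_le_coboundaries (j : Bool) (k : ℕ) :
    cocycles (A.pullback (proj (suspensionMap f))) (susSide f j) k ≤
      coboundaries (A.pullback (proj (suspensionMap f))) (susSide f j) k :=
  (isChainEquiv_susIncl f R j).cocycles_range_le_coboundaries A (isEmbedding_susIncl f j)

theorem isSubquotientIso_suspension_boundary (k : ℕ) :
    IsSubquotientIso (boundary (A.pullback (proj (suspensionMap f))) k)
      (cycles (A.pullback (proj (suspensionMap f))) (susTop f) (k + 1))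
      (boundaries (A.pullback (proj (suspensionMap f))) (susTop f) (k + 1))
      (pairCycles (A.pullback (proj (suspensionMap f))) (susTop f) (susSide f false) k)
      (pairBoundaries (A.pullback (proj (suspensionMap f))) (susTop f) (susSide f false) k) :=
  isSubquotientIso_boundary A (susSide_subset_susTop f false)
    (cycles_susSide_le_boundaries f A false) k

theorem isSubquotientIso_suspension_coboundary (k : ℕ) :
    IsSubquotientIso (coboundary (A.pullback (proj (suspensionMap f))) k)
      (pairCocycles (A.pullback (proj (suspensionMap f))) (susTop f) (susSide f false) k)
      (pairCoboundaries (A.pullback (proj (suspensionMap f))) (susTop f) (susSide f false) k)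
      (cocycles (A.pullback (proj (suspensionMap f))) (susTop f) (k + 1))
      (coboundaries (A.pullback (proj (suspensionMap f))) (susTop f) (k + 1)) :=
  isSubquotientIso_coboundary A (susSide_subset_susTop f false)
    (cocycles_susSide_le_coboundaries f A false) k

theorem isSubquotientIso_suspension_chain (k : ℕ) :
    IsSubquotientIso (Op.chain A (Op.push (susIncl f true) (proj_susIncl f true) k))
      (cycles (A.pullback (proj f)) (Set.range (top f)) k)
      (boundaries (A.pullback (proj f)) (Set.range (top f)) k)
      (pairCycles (A.pullback (proj (suspensionMap f))) (susTop f) (susSide f false) k)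
      (pairBoundaries (A.pullback (proj (suspensionMap f))) (susTop f) (susSide f false) k) := by
  rw [← preimage_susSide f]
  exact (isExcisive_susIncl f R).isSubquotientIso_chain A (isEmbedding_susIncl f true)
    (susSide_subset_susTop f true)

theorem isSubquotientIso_suspension_cochain (k : ℕ) :
    IsSubquotientIso (Op.cochain A (Op.push (susIncl f true) (proj_susIncl f true) k))
      (pairCocycles (A.pullback (proj (suspensionMap f))) (susTop f) (susSide f false) k)
      (pairCoboundaries (A.pullback (proj (suspensionMap f))) (susTop f) (susSide f false) k)
      (cocycles (A.pullback (proj f)) (Set.range (top f)) k)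
      (coboundaries (A.pullback (proj f)) (Set.range (top f)) k) := by
  rw [← preimage_susSide f]
  exact (isExcisive_susIncl f R).isSubquotientIso_cochain A (isEmbedding_susIncl f true)
    (susSide_subset_susTop f true)

/-- The suspension isomorphism `H_k(B, X; R) ≅ H_{k+1}(B, SX; R)`: excision followed by the inverse
of the boundary map of the triple of the mapping cylinder of `SX → B`, `SX` and one of the two
mapping cylinders of `f`. -/
def suspensionEquiv (R : Type*) [CommRing R] (f : C(X, B)) (k : ℕ) :
    Homology (constSystem R (MappingCylinder f)) (Set.range (top f)) k ≃ₗ[R]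
      Homology (constSystem R (SusCylinder f)) (susTop f) (k + 1) :=
  (isSubquotientIso_suspension_chain f (constSystem R B) k).toEquiv.trans
    (isSubquotientIso_suspension_boundary f (constSystem R B) k).toEquiv.symm

section Cap

variable {n p q : ℕ} {c : Chain (constSystem R (SusCylinder f)) (n + 1)}
  {c' : Chain (constSystem R (MappingCylinder f)) n}

theorem exists_push_eq_boundary_sub
    (hc : c ∈ cycles (constSystem R (SusCylinder f)) (susTop f) (n + 1))
    (hc' : c' ∈ cycles (constSystem R (MappingCylinder f)) (Set.range (top f)) n)
    (h : suspensionEquiv R f n (Submodule.Quotient.mk ⟨c', hc'⟩) =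
      Submodule.Quotient.mk ⟨c, hc⟩) :
    ∃ x ∈ pairBoundaries (constSystem R (SusCylinder f)) (susTop f) (susSide f false) n,
      Op.chain (constSystem R B) (Op.push (susIncl f true) (proj_susIncl f true) n) c' =
        boundary (constSystem R (SusCylinder f)) n c - x :=
  ⟨_, IsSubquotientIso.sub_mem_of_toEquiv_eq _ _ ((LinearEquiv.symm_apply_eq _).1 h).symm,
    (sub_sub_cancel _ _).symm⟩

variable (hc' : c' ∈ cycles (constSystem R (MappingCylinder f)) (Set.range (top f)) n)
  {x : Chain (constSystem R (SusCylinder f)) n}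
  (hx : x ∈ pairBoundaries (constSystem R (SusCylinder f)) (susTop f) (susSide f false) n)
  (hcc : Op.chain (constSystem R B) (Op.push (susIncl f true) (proj_susIncl f true) n) c' =
    boundary (constSystem R (SusCylinder f)) n c - x)
include hc' hx hcc

theorem isSubquotientIso_cap_abs (hpq : p + q = n)
    (h : IsSubquotientIso
      ((cap (A.pullback (proj (suspensionMap f))) (show p + (q + 1) = n + 1 by omega)).flip c)
      (cocycles (A.pullback (proj (suspensionMap f))) ∅ p)
      (coboundaries (A.pullback (proj (suspensionMap f))) ∅ p)
      (cycles (A.pullback (proj (suspensionMap f))) (susTop f) (q + 1))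
      (boundaries (A.pullback (proj (suspensionMap f))) (susTop f) (q + 1))) :
    IsSubquotientIso ((cap (A.pullback (proj f)) hpq).flip c')
      (cocycles (A.pullback (proj f)) ∅ p) (coboundaries (A.pullback (proj f)) ∅ p)
      (cycles (A.pullback (proj f)) (Set.range (top f)) q)
      (boundaries (A.pullback (proj f)) (Set.range (top f)) q) := by
  refine .of_square ((isChainEquiv_susIncl f R true).isSubquotientIso_cochain A)
    (isSubquotientIso_suspension_chain f A q)
    (((isSubquotientIso_suspension_boundary f A q).comp h).smul ((-1) ^ p))
    (fun φ hφ => cap_mem_cycles _ (Or.inr subset_rfl) hpq hφ hc')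
    (fun φ hφ => cap_mem_boundaries_left _ (Or.inr subset_rfl) hpq hφ hc') fun φ hφ => ?_
  simpa using boundary_cap_sub_mem A hpq hx hcc hφ

theorem isSubquotientIso_cap_rel (hpq : p + q = n)
    (h : IsSubquotientIso
      ((cap (A.pullback (proj (suspensionMap f))) (show p + 1 + q = n + 1 by omega)).flip c)
      (cocycles (A.pullback (proj (suspensionMap f))) (susTop f) (p + 1))
      (coboundaries (A.pullback (proj (suspensionMap f))) (susTop f) (p + 1))
      (cycles (A.pullback (proj (suspensionMap f))) ∅ q)
      (boundaries (A.pullback (proj (suspensionMap f))) ∅ q)) :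
    IsSubquotientIso ((cap (A.pullback (proj f)) hpq).flip c')
      (cocycles (A.pullback (proj f)) (Set.range (top f)) p)
      (coboundaries (A.pullback (proj f)) (Set.range (top f)) p)
      (cycles (A.pullback (proj f)) ∅ q) (boundaries (A.pullback (proj f)) ∅ q) :=
  .of_square (isSubquotientIso_suspension_cochain f A p)
    ((isChainEquiv_susIncl f R true).isSubquotientIso_chain A)
    (h.comp (isSubquotientIso_suspension_coboundary f A p))
    (fun _ hφ => cap_mem_cycles _ (Or.inl subset_rfl) hpq hφ hc')
    (fun _ hφ => cap_mem_boundaries_left _ (Or.inl subset_rfl) hpq hφ hc')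
    fun _ hφ => cap_coboundary_sub_mem A hpq hx hcc hφ

end Cap

namespace IsDualityClass

variable {f A} {n : ℕ}

section

variable {z : Homology (constSystem R (SusCylinder f)) (susTop f) (n + 1)}
  (h : IsDualityClass (n + 1) (suspensionMap f) A z)
include h

/-- In degree `n + 1` duality turns the cohomology into `H_0(B, SX)`, which vanishes. -/
theorem cocycles_empty_le_coboundaries {k : ℕ} (hk : n < k) :
    cocycles (A.pullback (proj (suspensionMap f))) ∅ k ≤
      coboundaries (A.pullback (proj (suspensionMap f))) ∅ k := by
  rcases (Nat.succ_le_of_lt hk).eq_or_lt with rfl | hk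
  · obtain ⟨⟨c, hc⟩, rfl⟩ := Submodule.Quotient.mk_surjective _ z
    exact ((bijective_homologyCap_iff _ _ _ hc).1 (h.bijective_abs (n + 1) 0 rfl)).le_iff.2
      ((cycles_susSide_le_boundaries f A false 0).trans
        (boundaries_mono _ (susSide_subset_susTop f false) 0))
  · exact subsingleton_subquotient_iff.1 (h.cohomology_abs k hk)

/-- In degree `n + 1` duality turns the homology into `H^0(B, SX)`, which vanishes. -/
theorem cycles_empty_le_boundaries {k : ℕ} (hk : n < k) :
    cycles (A.pullback (proj (suspensionMap f))) ∅ k ≤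
      boundaries (A.pullback (proj (suspensionMap f))) ∅ k := by
  rcases (Nat.succ_le_of_lt hk).eq_or_lt with rfl | hk
  · obtain ⟨⟨c, hc⟩, rfl⟩ := Submodule.Quotient.mk_surjective _ z
    exact ((bijective_homologyCap_iff _ _ _ hc).1
      (h.bijective_rel 0 (n + 1) (zero_add _))).le_iff.1
        ((cocycles_anti _ (susSide_subset_susTop f false) 0).trans
          (cocycles_susSide_le_coboundaries f A false 0))
  · exact subsingleton_subquotient_iff.1 (h.homology_abs k hk)

end

theorem of_suspensionEquiv
    {z : Homology (constSystem R (MappingCylinder f)) (Set.range (top f)) n}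
    (h : IsDualityClass (n + 1) (suspensionMap f) A (suspensionEquiv R f n z)) :
    IsDualityClass n f A z := by
  obtain ⟨⟨c', hc'⟩, rfl⟩ := Submodule.Quotient.mk_surjective _ z
  obtain ⟨⟨c, hc⟩, hz⟩ := Submodule.Quotient.mk_surjective _
    (suspensionEquiv R f n (Submodule.Quotient.mk ⟨c', hc'⟩))
  obtain ⟨x, hx, hcc⟩ := exists_push_eq_boundary_sub f hc hc' hz.symm
  rw [← hz] at h
  have hE := isChainEquiv_susIncl f R true
  exact {
    bijective_abs p q hpq := (bijective_homologyCap_iff _ _ hpq hc').2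
      (isSubquotientIso_cap_abs f A hc' hx hcc hpq
        ((bijective_homologyCap_iff _ _ _ hc).1 (h.bijective_abs p (q + 1) (by omega))))
    bijective_rel p q hpq := (bijective_homologyCap_iff _ _ hpq hc').2
      (isSubquotientIso_cap_rel f A hc' hx hcc hpq
        ((bijective_homologyCap_iff _ _ _ hc).1 (h.bijective_rel (p + 1) q (by omega))))
    cohomology_abs k hk := subsingleton_subquotient_iff.2
      ((hE.isSubquotientIso_cochain A).le_iff.1 (h.cocycles_empty_le_coboundaries hk))
    homology_abs k hk := subsingleton_subquotient_iff.2
      ((hE.isSubquotientIso_chain A).le_iff.2 (h.cycles_empty_le_boundaries hk))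
    homology_rel k hk := subsingleton_subquotient_iff.2
      ((isSubquotientIso_suspension_chain f A k).le_iff.2
        ((isSubquotientIso_suspension_boundary f A k).le_iff.1
          (subsingleton_subquotient_iff.1 (h.homology_rel (k + 1) (by omega)))))
    cohomology_rel k hk := subsingleton_subquotient_iff.2
      ((isSubquotientIso_suspension_cochain f A k).le_iff.1
        ((isSubquotientIso_suspension_coboundary f A k).le_iff.2
          (subsingleton_subquotient_iff.1 (h.cohomology_rel (k + 1) (by omega))))) }

end IsDualityClass

end Desuspension

end PoincareStab

end

theorem mainTheorem9_general {R : Type*} [CommRing R] {X B : Type*} [TopologicalSpace X]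
    [TopologicalSpace B] (hX : PathConnectedSpace X) (hXfin : PoincareStab.IsFiniteComplex X)
    (f : C(X, B)) (hf : PoincareStab.IsPiOneIso f) (n : ℕ)
    (h : PoincareStab.IsPoincarePair R (n + 1) (PoincareStab.suspensionMap f)) :
    PoincareStab.IsPoincarePair R n f where
  finite_source := hXfin
  finite_target := h.finite_target
  connected_source := hX
  connected_target := h.connected_target
  piOneIso := hf
  duality := by
    obtain ⟨e, he⟩ := h.duality
    refine ⟨(PoincareStab.suspensionEquiv R f n).trans e, fun y₀ => .of_suspensionEquiv ?_⟩
    rw [LinearEquiv.trans_symm, LinearEquiv.trans_apply, LinearEquiv.apply_symm_apply]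
    exact he y₀

theorem mainTheorem9 {Γ : Type*} [Group Γ] {X B : Type*} [TopologicalSpace X] [TopologicalSpace B]
    (hB : PoincareStab.IsClassifyingSpace Γ B) (hBfin : PoincareStab.IsFiniteComplex B)
    (hX : PathConnectedSpace X) (hXfin : PoincareStab.IsFiniteComplex X)
    (f : C(X, B)) (hf : PoincareStab.IsPiOneIso f) (n : ℕ) :
    (PoincareStab.IsPoincarePair ℤ (n + 1) (PoincareStab.suspensionMap f) →
        PoincareStab.IsPoincarePair ℤ n f) ∧
      (PoincareStab.IsPoincarePair ℚ (n + 1) (PoincareStab.suspensionMap f) →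
        PoincareStab.IsPoincarePair ℚ n f) := by
  exact ⟨mainTheorem9_general hX hXfin f hf n, mainTheorem9_general hX hXfin f hf n⟩
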